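/- Let $q>0$ be real and let $\mathcal H_\infty(q)$ be the unital complex algebra with generators $\sigma_1,\sigma_2,\dots$ and relations $\sigma_m^2=(q-1)\sigma_m+q$, $\sigma_m\sigma_{m+1}\sigma_m=\sigma_{m+1}\sigma_m\sigma_{m+1}$, and $\sigma_m\sigma_l=\sigma_l\sigma_m$ for $|m-l|>1$. It carries the antilinear anti-automorphism $A\mapsto A^\star$ and the linear anti-automorphism $A\mapsto A^t$ with $\sigma_m^\star=\sigma_m^t=\sigma_m$. A trace on $\mathcal H_\infty(q)$ is a linear functional $\chi$ with $\chi(AB)=\chi(BA)$, $\chi(A^\star)=\overline{\chi(A)}$ and $\chi(A^\star A)\ge 0$; it is normalized if $\chi(1)=1$, and indecomposable if it is not of the form $a_1\chi_1+a_2\chi_2$ with $a_1,a_2>0$ and traces $\chi_1,\chi_2$ not proportional to $\chi$. Let $\alpha_1\ge\alpha_2\ge\dots\ge0$ and $\beta_1\ge\beta_2\ge\dots\ge0$ with $\sum_i\alpha_i+\sum_j\beta_j=1$. Put $p_k=\sum_i\alpha_i^k+(-1)^{k+1}\sum_i\beta_i^k$ and $\zeta_m=\sigma_{m-1}\sigma_{m-2}\cdots\sigma_1$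 (so $\zeta_1=1$). Let $\chi=\chi^{\alpha,\beta,0}$ be the normalized indecomposable trace on $\mathcal H_\infty(q)$ such that, for all $m\ge1$, $$\chi(\zeta_m)=\frac1{q-1}\sum_{\mu_1,\mu_2,\dots\ge0,\ \sum k\mu_k=m}\ \prod_{k\ge1}\frac{(q^k-1)^{\mu_k}}{k^{\mu_k}\mu_k!}\prod_{k\ge2}p_k^{\mu_k}$$ (for $q=1$ the singularity is removed: $\chi(\zeta_1)=1$ and $\chi(\zeta_m)=p_m$ for $m\ge2$). Part of the assertion is that exactly one such trace exists. Let $V$ and $W$ be Hilbert spaces with orthonormal bases $v_i$ and $w_i$, $i\in\mathbb Z\setminus\{0\}$. Let $R$ be the bounded operator on $V\otimes V$ with $$R(v_i\otimes v_i)=\begin{cases}-v_i\otimes v_i,& i<0,\\ q\,v_i\otimes v_i,& i>0,\end{cases}\qquad R(v_i\otimes v_j)=-\sqrt q\,v_j\otimes v_i+\begin{cases}(q-1)\,v_i\otimes v_j,& i<j,\\ 0,& i>j,\end{cases}$$ and use the same formula with $w$ in place of $v$ on $W\otimes W$. Let $$\xi=\sum_{j>0}\sqrt{\beta_j}\,v_{-j}\otimes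 w_{-j}+\sum_{j>0}\sqrt{\alpha_j}\,v_j\otimes w_j,$$ a unit vector of $V\otimes W$, let $\mathcal X=(V\otimes W,\xi)\otimes(V\otimes W,\xi)\otimes\cdots$ be the infinite tensor product of Hilbert spaces with distinguished vector $\xi$, and let $\Xi=\xi\otimes\xi\otimes\cdots\in\mathcal X$. Let $A\mapsto A^{(l)}$ (respectively $A\mapsto A^{(r)}$) be the representation of $\mathcal H_\infty(q)$ by bounded operators on $\mathcal X$ in which $\sigma_j$ acts as $R$ on the $j$-th and $(j+1)$-st factors $V$ (respectively $W$). These two representations commute, so that $A\otimes B\mapsto A^{(l)}B^{(r)}$ is a representation of $\mathcal H_\infty(q)\otimes\mathcal H_\infty(q)$ on $\mathcal X$. Then: (a) $\langle A^{(l)}\Xi,\Xi\rangle_{\mathcal X}=\chi^{\alpha,\beta,0}(A)$ for every $A\in\mathcal H_\infty(q)$. (b) The representation of $\mathcal H_\infty(q)\otimes\mathcal H_\infty(q)$ on the cyclic span of $\Xi$, that is, on the closed subspace generated by the vectors $T\Xi$, $T\in\mathcal H_\infty(q)\otimes\mathcal H_\infty(q)$, is unitarily equivalent to its representation on the Hilbert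 space completion of $\mathcal H_\infty(q)$ with respect to $\langle A,B\rangle_\chi=\chi(B^\star A)$, in which $A\otimes B$ acts by $X\mapsto AXB^t$. -/

import Mathlib

open scoped TensorProduct ComplexOrder

noncomputable section

namespace IwahoriHecke

/-! ### The algebra -/

/-- The defining relations of the infinite-dimensional Iwahori--Hecke algebra. The generator
`FreeAlgebra.ι ℂ m` is `σ_{m+1}` in the usual numbering `σ₁, σ₂, …`. -/
inductive Rel (q : ℝ) : FreeAlgebra ℂ ℕ → FreeAlgebra ℂ ℕ → Prop
  | quadratic (m : ℕ) : Rel q (FreeAlgebra.ι ℂ m * FreeAlgebra.ι ℂ m)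
      (((q : ℂ) - 1) • FreeAlgebra.ι ℂ m + algebraMap ℂ _ (q : ℂ))
  | braid (m : ℕ) : Rel q
      (FreeAlgebra.ι ℂ m * FreeAlgebra.ι ℂ (m + 1) * FreeAlgebra.ι ℂ m)
      (FreeAlgebra.ι ℂ (m + 1) * FreeAlgebra.ι ℂ m * FreeAlgebra.ι ℂ (m + 1))
  | comm (m l : ℕ) (h : m + 1 < l ∨ l + 1 < m) : Rel q
      (FreeAlgebra.ι ℂ m * FreeAlgebra.ι ℂ l) (FreeAlgebra.ι ℂ l * FreeAlgebra.ι ℂ m)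

/-- The algebra `H_∞(q)`: the unital associative complex algebra presented by the generators
`σ₁, σ₂, …` and the relations `Rel q`. -/
def H (q : ℝ) : Type := RingQuot (Rel q)

instance (q : ℝ) : Ring (H q) := inferInstanceAs (Ring (RingQuot (Rel q)))
instance (q : ℝ) : Algebra ℂ (H q) := inferInstanceAs (Algebra ℂ (RingQuot (Rel q)))

/-- The quotient map from the free algebra. -/
def mk (q : ℝ) : FreeAlgebra ℂ ℕ →ₐ[ℂ] H q := RingQuot.mkAlgHom ℂ (Rel q)

/-- The generators; `σ q m` is `σ_{m+1}` in the usual numbering. -/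
def σ (q : ℝ) (m : ℕ) : H q := mk q (FreeAlgebra.ι ℂ m)

theorem mk_surjective (q : ℝ) : Function.Surjective (mk q) := RingQuot.mkAlgHom_surjective ℂ _

theorem mk_rel {q : ℝ} {a b : FreeAlgebra ℂ ℕ} (h : Rel q a b) : mk q a = mk q b :=
  RingQuot.mkAlgHom_rel ℂ h

theorem σ_sq (q : ℝ) (m : ℕ) : σ q m * σ q m = ((q : ℂ) - 1) • σ q m + algebraMap ℂ _ (q : ℂ) := by
  simpa [σ] using mk_rel (Rel.quadratic (q := q) m)

theorem σ_braid (q : ℝ) (m : ℕ) :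
    σ q m * σ q (m + 1) * σ q m = σ q (m + 1) * σ q m * σ q (m + 1) := by
  simpa [σ] using mk_rel (Rel.braid (q := q) m)

theorem σ_comm (q : ℝ) (m l : ℕ) (h : m + 1 < l ∨ l + 1 < m) :
    σ q m * σ q l = σ q l * σ q m := by
  simpa [σ] using mk_rel (Rel.comm (q := q) m l h)

theorem H.induction {q : ℝ} {P : H q → Prop} (hσ : ∀ m, P (σ q m))
    (hc : ∀ c : ℂ, P (algebraMap ℂ (H q) c)) (hadd : ∀ A B, P A → P B → P (A + B))
    (hmul : ∀ A B, P A → P B → P (A * B)) (A : H q) : P A := by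
  obtain ⟨a, rfl⟩ := mk_surjective q A
  induction a using FreeAlgebra.induction with
  | grade0 r => rw [AlgHom.commutes]; exact hc r
  | grade1 x => exact hσ x
  | mul a b ha hb => rw [map_mul]; exact hmul _ _ ha hb
  | add a b ha hb => rw [map_add]; exact hadd _ _ ha hb

/-- An algebra homomorphism out of `H_∞(q)`, given by the images of the generators. -/
def lift {q : ℝ} {B : Type} [Ring B] [Algebra ℂ B] (s : ℕ → B)
    (h1 : ∀ m, s m * s m = ((q : ℂ) - 1) • s m + algebraMap ℂ _ (q : ℂ))
    (h2 : ∀ m, s m * s (m + 1) * s m = s (m + 1) * s m * s (m + 1))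
    (h3 : ∀ m l, m + 1 < l → s m * s l = s l * s m) : H q →ₐ[ℂ] B :=
  RingQuot.liftAlgHom ℂ ⟨FreeAlgebra.lift ℂ s, by
    intro x y h
    cases h with
    | quadratic m => simpa using h1 m
    | braid m => simpa using h2 m
    | comm m l h =>
      rcases h with h | h
      · simpa using h3 m l h
      · simpa using (h3 l m h).symm⟩

@[simp] theorem lift_σ {q : ℝ} {B : Type} [Ring B] [Algebra ℂ B] (s : ℕ → B) (h1 h2 h3) (m : ℕ) :
    lift (q := q) s h1 h2 h3 (σ q m) = s m := by
  simp only [lift, σ, mk]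
  erw [RingQuot.liftAlgHom_mkAlgHom_apply]
  simp

/-- The transposition: the linear anti-automorphism of `H_∞(q)` with `σ_m ↦ σ_m`, as a
homomorphism to the opposite algebra. -/
def transposeHom (q : ℝ) : H q →ₐ[ℂ] (H q)ᵐᵒᵖ :=
  lift (fun m => MulOpposite.op (σ q m))
    (fun m => by
      apply MulOpposite.unop_injective
      simpa using σ_sq q m)
    (fun m => by
      apply MulOpposite.unop_injective
      simpa [mul_assoc] using σ_braid q m)
    (fun m l h => by
      apply MulOpposite.unop_injective
      simpa using (σ_comm q m l (Or.inl h)).symm)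

/-- The transpose `Aᵗ`. -/
def transpose {q : ℝ} (A : H q) : H q := (transposeHom q A).unop

@[simp] theorem transpose_σ (q : ℝ) (m : ℕ) : transpose (σ q m) = σ q m := by
  simp [transpose, transposeHom]

@[simp] theorem transpose_mul {q : ℝ} (A B : H q) :
    transpose (A * B) = transpose B * transpose A := by simp [transpose]

@[simp] theorem transpose_add {q : ℝ} (A B : H q) :
    transpose (A + B) = transpose A + transpose B := by simp [transpose]

@[simp] theorem transpose_algebraMap (q : ℝ) (c : ℂ) :
    transpose (algebraMap ℂ (H q) c) = algebraMap ℂ (H q) c := by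
  simp [transpose]

/-- Complex conjugation of the coefficients on the free algebra. -/
def freeConj : FreeAlgebra ℂ ℕ →+* FreeAlgebra ℂ ℕ :=
  (FreeAlgebra.equivMonoidAlgebraFreeMonoid (R := ℂ) (X := ℕ)).symm.toRingEquiv.toRingHom.comp
    ((MonoidAlgebra.mapRingHom (FreeMonoid ℕ) (starRingEnd ℂ)).comp
      (FreeAlgebra.equivMonoidAlgebraFreeMonoid (R := ℂ) (X := ℕ)).toRingEquiv.toRingHom)

@[simp] theorem freeConj_ι (m : ℕ) : freeConj (FreeAlgebra.ι ℂ m) = FreeAlgebra.ι ℂ m := by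
  simp [freeConj, FreeAlgebra.equivMonoidAlgebraFreeMonoid]

@[simp] theorem freeConj_algebraMap (c : ℂ) :
    freeConj (algebraMap ℂ _ c) = algebraMap ℂ _ (starRingEnd ℂ c) := by
  simp [freeConj, FreeAlgebra.equivMonoidAlgebraFreeMonoid]
  rw [Algebra.algebraMap_eq_smul_one]

/-- The antilinear ring automorphism of `H_∞(q)` with `σ_m ↦ σ_m`. -/
def conj (q : ℝ) : H q →+* H q :=
  RingQuot.lift ⟨((mk q : FreeAlgebra ℂ ℕ →ₐ[ℂ] H q) : FreeAlgebra ℂ ℕ →+* H q).comp freeConj, by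
    intro x y h
    cases h with
    | quadratic m => simpa [Algebra.smul_def, σ] using σ_sq q m
    | braid m => simpa [σ] using σ_braid q m
    | comm m l h => simpa [σ] using σ_comm q m l h⟩

theorem conj_mk (q : ℝ) (a : FreeAlgebra ℂ ℕ) : conj q (mk q a) = mk q (freeConj a) := by
  have : mk q a = RingQuot.mkRingHom (Rel q) a := by
    rw [← RingQuot.mkAlgHom_coe ℂ]; rfl
  rw [this, conj]
  erw [RingQuot.lift_mkRingHom_apply]
  rfl

@[simp] theorem conj_σ (q : ℝ) (m : ℕ) : conj q (σ q m) = σ q m := by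
  simp [σ, conj_mk]

@[simp] theorem conj_algebraMap (q : ℝ) (c : ℂ) :
    conj q (algebraMap ℂ (H q) c) = algebraMap ℂ (H q) (starRingEnd ℂ c) := by
  rw [← (mk q).commutes, conj_mk, freeConj_algebraMap, AlgHom.commutes]

/-- The involution `A ↦ A⋆` of `H_∞(q)`: the antilinear anti-automorphism with `σ_m⋆ = σ_m`. -/
instance (q : ℝ) : StarRing (H q) where
  star A := conj q (transpose A)
  star_involutive A := by
    induction A using H.induction with
    | hσ m => simp
    | hc c => simp
    | hadd A B hA hB => simp [hA, hB]
    | hmul A B hA hB => simp [hA, hB]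
  star_mul A B := by simp
  star_add A B := by simp

theorem star_def {q : ℝ} (A : H q) : star A = conj q (transpose A) := rfl

@[simp] theorem star_σ (q : ℝ) (m : ℕ) : star (σ q m) = σ q m := by simp [star_def]

instance (q : ℝ) : StarModule ℂ (H q) where
  star_smul c A := by simp [star_def, Algebra.smul_def, Algebra.commutes]

/-! ### Traces and their bimodules -/

/-- A trace on `H_∞(q)`: a central, hermitian, positive linear functional. -/
structure IsTrace {q : ℝ} (χ : H q →ₗ[ℂ] ℂ) : Prop where
  comm : ∀ A B, χ (A * B) = χ (B * A)
  hermitian : ∀ A, χ (star A) = starRingEnd ℂ (χ A)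
  nonneg : ∀ A, 0 ≤ χ (star A * A)

/-- A trace is indecomposable if it is not a combination `a₁ χ₁ + a₂ χ₂`, with `a₁, a₂ > 0`, of two
traces neither of which is proportional to it. -/
structure IsIndecomposableTrace {q : ℝ} (χ : H q →ₗ[ℂ] ℂ) : Prop extends IsTrace χ where
  indecomposable : ¬ ∃ χ₁ χ₂ : H q →ₗ[ℂ] ℂ, IsTrace χ₁ ∧ IsTrace χ₂ ∧
    (¬ ∃ c : ℂ, χ₁ = c • χ) ∧ (¬ ∃ c : ℂ, χ₂ = c • χ) ∧
    ∃ a₁ a₂ : ℝ, 0 < a₁ ∧ 0 < a₂ ∧ χ = (a₁ : ℂ) • χ₁ + (a₂ : ℂ) • χ₂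

/-- `ζ_m = σ_{m-1} σ_{m-2} ⋯ σ_1` for `m ≥ 1`, so that `ζ_1 = 1` (the value at `m = 0` is not
used). -/
def zeta (q : ℝ) : ℕ → H q
  | 0 => 1
  | 1 => 1
  | m + 2 => σ q m * zeta q (m + 1)

/-- The parameters `α₁ ≥ α₂ ≥ ⋯ ≥ 0`, `β₁ ≥ β₂ ≥ ⋯ ≥ 0`, `γ ≥ 0` with
`∑ α_i + ∑ β_j + γ = 1`; here `α i` is `α_{i+1}` and `β i` is `β_{i+1}`. -/
structure IsParameter (α β : ℕ → ℝ) (γ : ℝ) : Prop where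
  antitone_left : Antitone α
  antitone_right : Antitone β
  nonneg_left : ∀ i, 0 ≤ α i
  nonneg_right : ∀ i, 0 ≤ β i
  nonneg : 0 ≤ γ
  summable_left : Summable α
  summable_right : Summable β
  sum_eq : ∑' i, α i + ∑' i, β i + γ = 1

/-- The super-Newton sums `p_k(α, β) = ∑ α_i^k + (-1)^(k+1) ∑ β_i^k`. -/
def superNewton (α β : ℕ → ℝ) (k : ℕ) : ℝ := ∑' i, α i ^ k + (-1) ^ (k + 1) * ∑' i, β i ^ k

/-- The value on `ζ_m`, `m ≥ 1`, of the trace with parameters `α, β`: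
`(q-1)⁻¹ ∑ ∏_{k ≥ 1} (q^k-1)^{μ_k} / (k^{μ_k} μ_k!) ∏_{k ≥ 2} p_k(α,β)^{μ_k}`, summed over all
`(μ_1, μ_2, …)` with `∑ k μ_k = m`, that is, over the partitions of `m`, `μ_k` being the number of
parts equal to `k`. At `q = 1` the singularity is removed: the value is `1` for `m = 1` and
`p_m(α,β)` for `m ≥ 2`. -/
def traceValue (q : ℝ) (α β : ℕ → ℝ) (m : ℕ) : ℝ :=
  if q = 1 then
    if m = 1 then 1 else superNewton α β m
  else
    1 / (q - 1) * ∑ P : Nat.Partition m,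
      (∏ k ∈ Finset.Icc 1 m, (q ^ k - 1) ^ P.parts.count k /
        ((k : ℝ) ^ P.parts.count k * (P.parts.count k).factorial)) *
      ∏ k ∈ Finset.Icc 2 m, superNewton α β k ^ P.parts.count k

/-- `χ` is the trace `χ^{α,β,γ}`: the normalized indecomposable trace with the prescribed values
on the elements `ζ_m`. -/
structure IsVershikKerovTrace (q : ℝ) (α β : ℕ → ℝ) (γ : ℝ) (χ : H q →ₗ[ℂ] ℂ) : Prop
    extends IsIndecomposableTrace χ where
  parameter : IsParameter α β γ
  map_one : χ 1 = 1
  map_zeta : ∀ m, 1 ≤ m → χ (zeta q m) = (traceValue q α β m : ℂ)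

section GNS

variable {q : ℝ} {χ : H q →ₗ[ℂ] ℂ}

set_option linter.unusedVariables false in
/-- The space `H_∞(q)` with the semi-inner product `χ(A⋆ B)` of a trace `χ`. -/
def PreGNS (hχ : IsTrace χ) : Type := H q

instance (hχ : IsTrace χ) : AddCommGroup (PreGNS hχ) := inferInstanceAs (AddCommGroup (H q))
instance (hχ : IsTrace χ) : Module ℂ (PreGNS hχ) := inferInstanceAs (Module ℂ (H q))

/-- An element of `H_∞(q)` as a vector. -/
def toPreGNS (hχ : IsTrace χ) : H q ≃ₗ[ℂ] PreGNS hχ := LinearEquiv.refl ℂ (H q)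

/-- Mathlib's inner products are antilinear in the first argument, so `inner A B = χ(A⋆ B)` is
`⟨B, A⟩_χ` in the convention with linearity in the first argument. -/
abbrev preGNSCore (hχ : IsTrace χ) : PreInnerProductSpace.Core ℂ (PreGNS hχ) where
  inner A B := χ (star ((toPreGNS hχ).symm A) * (toPreGNS hχ).symm B)
  conj_inner_symm A B := by rw [← hχ.hermitian]; simp
  re_inner_nonneg A := (RCLike.nonneg_iff.mp (hχ.nonneg ((toPreGNS hχ).symm A))).1
  add_left A B C := by simp [add_mul]
  smul_left A B c := by simp

instance (hχ : IsTrace χ) : SeminormedAddCommGroup (PreGNS hχ) :=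
  InnerProductSpace.Core.toSeminormedAddCommGroup (c := preGNSCore hχ)
instance (hχ : IsTrace χ) : InnerProductSpace ℂ (PreGNS hχ) :=
  InnerProductSpace.ofCore (preGNSCore hχ)

theorem preGNS_inner (hχ : IsTrace χ) (A B : H q) :
    inner ℂ (toPreGNS hχ A) (toPreGNS hχ B) = χ (star A * B) := rfl

theorem preGNS_norm_sq (hχ : IsTrace χ) (A : H q) :
    ‖toPreGNS hχ A‖ ^ 2 = (χ (star A * A)).re := by
  rw [← preGNS_inner hχ]
  exact norm_sq_eq_re_inner (𝕜 := ℂ) _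

/-- The Hilbert space completion of `H_∞(q)` with respect to a trace `χ`. -/
abbrev GNS (hχ : IsTrace χ) : Type := UniformSpace.Completion (PreGNS hχ)

theorem norm_star_eq (hχ : IsTrace χ) (A : H q) :
    ‖toPreGNS hχ (star A)‖ = ‖toPreGNS hχ A‖ := by
  rw [← sq_eq_sq₀ (norm_nonneg _) (norm_nonneg _), preGNS_norm_sq, preGNS_norm_sq, star_star,
    hχ.comm]

theorem norm_σ_mul_le (hχ : IsTrace χ) (m : ℕ) (X : H q) :
    ‖toPreGNS hχ (σ q m * X)‖ ≤ (|q - 1| + |q| + 1) * ‖toPreGNS hχ X‖ := by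
  set t := ‖toPreGNS hχ (σ q m * X)‖ with ht
  set s := ‖toPreGNS hχ X‖ with hs
  have h1 : t ^ 2 = (q - 1) * (inner ℂ (toPreGNS hχ X) (toPreGNS hχ (σ q m * X))).re
      + q * s ^ 2 := by
    rw [ht, hs, preGNS_norm_sq, preGNS_norm_sq, preGNS_inner]
    have : star (σ q m * X) * (σ q m * X) =
        ((q : ℂ) - 1) • (star X * (σ q m * X)) + (q : ℂ) • (star X * X) := by
      rw [star_mul, star_σ, mul_assoc, ← mul_assoc (σ q m), σ_sq]
      simp only [add_mul, mul_add, Algebra.smul_mul_assoc, Algebra.mul_smul_comm,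
        ← Algebra.smul_def]
    rw [this, map_add, map_smul, map_smul]
    have e : ((q : ℂ) - 1) = ((q - 1 : ℝ) : ℂ) := by push_cast; rfl
    rw [e]
    simp only [smul_eq_mul, Complex.add_re, Complex.re_ofReal_mul]
  have h2 : |(inner ℂ (toPreGNS hχ X) (toPreGNS hχ (σ q m * X))).re| ≤ s * t :=
    (Complex.abs_re_le_norm _).trans (norm_inner_le_norm _ _)
  have ht0 : 0 ≤ t := norm_nonneg _
  have hs0 : 0 ≤ s := norm_nonneg _
  have h3 : t ^ 2 ≤ |q - 1| * (s * t) + |q| * s ^ 2 := by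
    rw [h1]
    refine add_le_add ?_ ?_
    · refine (le_abs_self _).trans ?_
      rw [abs_mul]; exact mul_le_mul_of_nonneg_left h2 (abs_nonneg _)
    · exact mul_le_mul_of_nonneg_right (le_abs_self q) (sq_nonneg s)
  by_contra hlt
  push Not at hlt
  have ha := abs_nonneg (q - 1)
  have hb := abs_nonneg q
  have hst : s ≤ t := by nlinarith [mul_nonneg ha hs0, mul_nonneg hb hs0]
  have h4 : |q| * s ^ 2 ≤ |q| * (s * t) := mul_le_mul_of_nonneg_left (by nlinarith) hb
  have h5 : t * t ≤ ((|q - 1| + |q|) * s) * t := by nlinarith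
  have htpos : 0 < t := lt_of_le_of_lt (by positivity) hlt
  have h6 := le_of_mul_le_mul_right h5 htpos
  nlinarith

theorem exists_norm_mul_le (hχ : IsTrace χ) (A : H q) :
    ∃ C, ∀ X, ‖toPreGNS hχ (A * X)‖ ≤ C * ‖toPreGNS hχ X‖ := by
  induction A using H.induction with
  | hσ m => exact ⟨_, norm_σ_mul_le hχ m⟩
  | hc c =>
    refine ⟨‖c‖, fun X => ?_⟩
    rw [← Algebra.smul_def, map_smul, norm_smul]
  | hadd A B hA hB =>
    obtain ⟨C, hC⟩ := hA
    obtain ⟨D, hD⟩ := hB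
    refine ⟨C + D, fun X => ?_⟩
    rw [add_mul, map_add, add_mul]
    exact (norm_add_le _ _).trans (add_le_add (hC X) (hD X))
  | hmul A B hA hB =>
    obtain ⟨C, hC⟩ := hA
    obtain ⟨D, hD⟩ := hB
    refine ⟨|C| * D, fun X => ?_⟩
    rw [mul_assoc, mul_assoc]
    exact (hC _).trans ((mul_le_mul_of_nonneg_right (le_abs_self C) (norm_nonneg _)).trans
      (mul_le_mul_of_nonneg_left (hD X) (abs_nonneg C)))

theorem exists_norm_mul_le' (hχ : IsTrace χ) (B : H q) :
    ∃ C, ∀ X, ‖toPreGNS hχ (X * B)‖ ≤ C * ‖toPreGNS hχ X‖ := by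
  obtain ⟨C, hC⟩ := exists_norm_mul_le hχ (star B)
  refine ⟨C, fun X => ?_⟩
  rw [← norm_star_eq, star_mul, ← norm_star_eq hχ X]
  exact hC _

/-- Left multiplication by `A`. -/
def preLeftMul (hχ : IsTrace χ) (A : H q) : PreGNS hχ →L[ℂ] PreGNS hχ :=
  LinearMap.mkContinuousOfExistsBound
    ((toPreGNS hχ).toLinearMap ∘ₗ LinearMap.mulLeft ℂ A ∘ₗ (toPreGNS hχ).symm.toLinearMap)
    (exists_norm_mul_le hχ A)

/-- Right multiplication by `B`. -/
def preRightMul (hχ : IsTrace χ) (B : H q) : PreGNS hχ →L[ℂ] PreGNS hχ :=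
  LinearMap.mkContinuousOfExistsBound
    ((toPreGNS hχ).toLinearMap ∘ₗ LinearMap.mulRight ℂ B ∘ₗ (toPreGNS hχ).symm.toLinearMap)
    (exists_norm_mul_le' hχ B)

theorem preLeftMul_apply (hχ : IsTrace χ) (A X : H q) :
    preLeftMul hχ A (toPreGNS hχ X) = toPreGNS hχ (A * X) := rfl

theorem preRightMul_apply (hχ : IsTrace χ) (B X : H q) :
    preRightMul hχ B (toPreGNS hχ X) = toPreGNS hχ (X * B) := rfl

end GNS

section Completion

variable {E : Type} [SeminormedAddCommGroup E] [InnerProductSpace ℂ E]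

/-- Continuous extension to the completion, as a homomorphism of algebras of bounded operators. -/
def complHom : (E →L[ℂ] E) →ₐ[ℂ]
    (UniformSpace.Completion E →L[ℂ] UniformSpace.Completion E) :=
  AlgHom.ofLinearMap
    { toFun := fun f => f.completion
      map_add' := fun f g => by
        ext x
        induction x using UniformSpace.Completion.induction_on with
        | hp => apply isClosed_eq <;> fun_prop
        | ih x => simp [UniformSpace.Completion.coe_add]
      map_smul' := fun c f => by
        ext x
        induction x using UniformSpace.Completion.induction_on with
        | hp => exact isClosed_eq (c • f).completion.continuous (c • f.completion).continuous
        | ih x => simp [UniformSpace.Completion.coe_smul] }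
    (by
      ext x
      induction x using UniformSpace.Completion.induction_on with
      | hp => apply isClosed_eq <;> fun_prop
      | ih x => simp)
    (fun f g => by
      ext x
      induction x using UniformSpace.Completion.induction_on with
      | hp => apply isClosed_eq <;> fun_prop
      | ih x => simp)

@[simp] theorem complHom_coe (f : E →L[ℂ] E) (x : E) :
    complHom f (x : UniformSpace.Completion E) = (f x : UniformSpace.Completion E) :=
  f.completion_apply_coe x

end Completion

section GNSRep

variable {q : ℝ} {χ : H q →ₗ[ℂ] ℂ}

/-- `H_∞(q)` acting by left multiplications `X ↦ A X` on the completion. -/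
def gnsLeft (hχ : IsTrace χ) : H q →ₐ[ℂ] (GNS hχ →L[ℂ] GNS hχ) :=
  complHom.comp (AlgHom.ofLinearMap
    { toFun := preLeftMul hχ
      map_add' := fun A B => ContinuousLinearMap.ext fun X =>
        congrArg (toPreGNS hχ) (add_mul A B ((toPreGNS hχ).symm X))
      map_smul' := fun c A => ContinuousLinearMap.ext fun X =>
        congrArg (toPreGNS hχ) (smul_mul_assoc c A ((toPreGNS hχ).symm X)) }
    (ContinuousLinearMap.ext fun X => congrArg (toPreGNS hχ) (one_mul ((toPreGNS hχ).symm X)))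
    (fun A B => ContinuousLinearMap.ext fun X =>
      congrArg (toPreGNS hχ) (mul_assoc A B ((toPreGNS hχ).symm X))))

/-- `H_∞(q)` acting by `X ↦ X Bᵗ` on the completion. -/
def gnsRight (hχ : IsTrace χ) : H q →ₐ[ℂ] (GNS hχ →L[ℂ] GNS hχ) :=
  complHom.comp (AlgHom.ofLinearMap
    { toFun := fun B => preRightMul hχ (transpose B)
      map_add' := fun A B => ContinuousLinearMap.ext fun X => congrArg (toPreGNS hχ) <| by
        change (toPreGNS hχ).symm X * transpose (A + B) = _
        rw [transpose_add, mul_add]; rfl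
      map_smul' := fun c A => ContinuousLinearMap.ext fun X => congrArg (toPreGNS hχ) <| by
        change (toPreGNS hχ).symm X * transpose (c • A) = c • ((toPreGNS hχ).symm X * transpose A)
        rw [← mul_smul_comm]; simp [transpose] }
    (ContinuousLinearMap.ext fun X => congrArg (toPreGNS hχ) <| by
      change (toPreGNS hχ).symm X * transpose 1 = (toPreGNS hχ).symm X
      simp [transpose])
    (fun A B => ContinuousLinearMap.ext fun X => congrArg (toPreGNS hχ) <| by
      change (toPreGNS hχ).symm X * transpose (A * B)
        = (toPreGNS hχ).symm X * transpose B * transpose A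
      rw [transpose_mul, mul_assoc]))

theorem gnsLeft_coe (hχ : IsTrace χ) (A X : H q) :
    gnsLeft hχ A (toPreGNS hχ X : GNS hχ) = (toPreGNS hχ (A * X) : GNS hχ) :=
  complHom_coe _ _

theorem gnsRight_coe (hχ : IsTrace χ) (B X : H q) :
    gnsRight hχ B (toPreGNS hχ X : GNS hχ) = (toPreGNS hχ (X * transpose B) : GNS hχ) :=
  complHom_coe _ _

theorem gns_commute (hχ : IsTrace χ) (A B : H q) : Commute (gnsLeft hχ A) (gnsRight hχ B) := by
  refine ContinuousLinearMap.ext fun x => ?_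
  induction x using UniformSpace.Completion.induction_on with
  | hp =>
    exact isClosed_eq (gnsLeft hχ A * gnsRight hχ B).continuous
      (gnsRight hχ B * gnsLeft hχ A).continuous
  | ih x =>
    obtain ⟨X, rfl⟩ := (toPreGNS hχ).surjective x
    simp only [mul_apply_eq_comp, gnsLeft_coe, gnsRight_coe, mul_assoc]

/-- The representation of `H_∞(q) ⊗ H_∞(q)` on the completion of `H_∞(q)` with respect to `χ`,
determined by `(A ⊗ B) X = A X Bᵗ`. -/
def gnsDouble (hχ : IsTrace χ) : H q ⊗[ℂ] H q →ₐ[ℂ] (GNS hχ →L[ℂ] GNS hχ) :=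
  Algebra.TensorProduct.lift (gnsLeft hχ) (gnsRight hχ) (gns_commute hχ)

end GNSRep

/-! ### The infinite tensor product -/

/-- The Hilbert space `ℓ²(ι)`, with its standard orthonormal basis indexed by `ι`. -/
abbrev L2 (ι : Type) : Type := lp (fun _ : ι => ℂ) 2

theorem L2.norm_sq {ι : Type} (f : L2 ι) : ‖f‖ ^ 2 = ∑' i, ‖f i‖ ^ 2 := by
  have := lp.norm_rpow_eq_tsum (p := 2) (by norm_num) f
  simpa using this

theorem L2.summable {ι : Type} (f : L2 ι) : Summable fun i => ‖f i‖ ^ 2 := by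
  have := (lp.memℓp f).summable (by norm_num)
  simpa using this

theorem L2.mem {ι : Type} {f : ι → ℂ} (hf : Summable fun i => ‖f i‖ ^ 2) :
    Memℓp f 2 := by
  refine memℓp_gen ?_
  simpa using hf

section Tensor

variable {S : Type}

/-- Adding a last entry to a word of length `n`. -/
def snocEquiv (S : Type) (n : ℕ) : S × (Fin n → S) ≃ (Fin (n + 1) → S) where
  toFun p := Fin.snoc (α := fun _ => S) p.2 p.1
  invFun s := (s (Fin.last n), Fin.init s)
  left_inv p := by simp
  right_inv s := by simp

theorem hasSum_mul_of_nonneg {ι κ : Type} {f : ι → ℝ} {g : κ → ℝ} {a b : ℝ} (hf : HasSum f a)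
    (hg : HasSum g b) (hf0 : ∀ i, 0 ≤ f i) (hg0 : ∀ i, 0 ≤ g i) :
    HasSum (fun p : ι × κ => f p.1 * g p.2) (a * b) :=
  hf.mul hg (hf.summable.mul_of_nonneg hg.summable hf0 hg0)

theorem hasSum_tensorVec (ξ : Metric.sphere (0 : L2 S) 1) (n : ℕ) (f : L2 (Fin n → S)) :
    HasSum (fun s : Fin (n + 1) → S => ‖f (Fin.init s) * (ξ : L2 S) (s (Fin.last n))‖ ^ 2)
      (‖f‖ ^ 2) := by
  have h := hasSum_mul_of_nonneg (L2.summable (ξ : L2 S)).hasSum (L2.summable f).hasSum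
    (fun _ => sq_nonneg _) (fun _ => sq_nonneg _)
  rw [← L2.norm_sq, ← L2.norm_sq, norm_eq_of_mem_sphere ξ, one_pow, one_mul] at h
  rw [← (snocEquiv S n).hasSum_iff]
  have e : (fun s : Fin (n + 1) → S => ‖f (Fin.init s) * (ξ : L2 S) (s (Fin.last n))‖ ^ 2) ∘
      snocEquiv S n = fun p : S × (Fin n → S) => ‖(ξ : L2 S) p.1‖ ^ 2 * ‖f p.2‖ ^ 2 := by
    funext p
    simp [snocEquiv, mul_pow, mul_comm]
  rw [e]
  exact h

/-- For a unit vector `ξ` of `ℓ²(S)`: the isometric embedding `f ↦ f ⊗ ξ` of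
`ℓ²(S)^{⊗ n} = ℓ²(Sⁿ)` into `ℓ²(S)^{⊗ (n+1)} = ℓ²(Sⁿ⁺¹)`. -/
def tensorVec (ξ : Metric.sphere (0 : L2 S) 1) (n : ℕ) :
    L2 (Fin n → S) →ₗᵢ[ℂ] L2 (Fin (n + 1) → S) where
  toFun f := ⟨fun s => f (Fin.init s) * (ξ : L2 S) (s (Fin.last n)),
    L2.mem (hasSum_tensorVec ξ n f).summable⟩
  map_add' f g := lp.ext (funext fun s => add_mul _ _ _)
  map_smul' c f := lp.ext (funext fun s => mul_assoc _ _ _)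
  norm_map' f := by
    rw [← sq_eq_sq₀ (norm_nonneg _) (norm_nonneg _), L2.norm_sq]
    exact (hasSum_tensorVec ξ n f).tsum_eq

/-- The sequences `x_n ∈ ℓ²(S)^{⊗ n}` with `x_{n+1} = x_n ⊗ ξ` for all large `n`. Such a sequence
stands for the vector `x_n ⊗ ξ ⊗ ξ ⊗ ⋯`, `n` large. -/
def coherent (ξ : Metric.sphere (0 : L2 S) 1) : Submodule ℂ (∀ n, L2 (Fin n → S)) where
  carrier := {x | ∃ N, ∀ n ≥ N, x (n + 1) = tensorVec ξ n (x n)}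
  zero_mem' := ⟨0, fun n _ => by simp⟩
  add_mem' := by
    rintro x y ⟨N, hN⟩ ⟨M, hM⟩
    refine ⟨max N M, fun n hn => ?_⟩
    simp [hN n (le_of_max_le_left hn), hM n (le_of_max_le_right hn)]
  smul_mem' := by
    rintro c x ⟨N, hN⟩
    exact ⟨N, fun n hn => by simp [hN n hn]⟩

/-- The algebraic infinite tensor product: the direct limit of the `ℓ²(S)^{⊗ n}` under the maps
`f ↦ f ⊗ ξ`, before separation and completion. -/
def PreTensor (ξ : Metric.sphere (0 : L2 S) 1) : Type := coherent ξ

variable {ξ : Metric.sphere (0 : L2 S) 1}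

instance : AddCommGroup (PreTensor ξ) := inferInstanceAs (AddCommGroup (coherent ξ))
instance : Module ℂ (PreTensor ξ) := inferInstanceAs (Module ℂ (coherent ξ))

/-- The element given by a coherent sequence. -/
def PreTensor.mk (x : ∀ n, L2 (Fin n → S))
    (hx : ∃ N, ∀ n ≥ N, x (n + 1) = tensorVec ξ n (x n)) : PreTensor ξ :=
  (⟨x, hx⟩ : coherent ξ)

/-- The component of `x` in `ℓ²(S)^{⊗ n}`. -/
def component (n : ℕ) : PreTensor ξ →ₗ[ℂ] L2 (Fin n → S) :=
  (LinearMap.proj n).comp (coherent ξ).subtype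

theorem exists_coherent (x : PreTensor ξ) :
    ∃ N, ∀ n ≥ N, component (n + 1) x = tensorVec ξ n (component n x) := x.2

/-- The inner product of two coherent sequences is the eventual value of the inner products of
their components. -/
def tensorInner (x y : PreTensor ξ) : ℂ :=
  Filter.limUnder Filter.atTop fun n => inner ℂ (component n x) (component n y)

theorem eventually_tensorInner (x y : PreTensor ξ) :
    ∀ᶠ n in Filter.atTop, inner ℂ (component n x) (component n y) = tensorInner x y := by
  obtain ⟨N, hN⟩ := exists_coherent x
  obtain ⟨M, hM⟩ := exists_coherent y
  have key : ∀ n ≥ max N M, inner ℂ (component n x) (component n y)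
      = inner ℂ (component (max N M) x) (component (max N M) y) := by
    intro n hn
    induction n, hn using Nat.le_induction with
    | base => rfl
    | succ n hn ih =>
      rw [hN n (le_of_max_le_left hn), hM n (le_of_max_le_right hn), LinearIsometry.inner_map_map,
        ih]
  have hlim : tensorInner x y = inner ℂ (component (max N M) x) (component (max N M) y) := by
    refine Filter.Tendsto.limUnder_eq (tendsto_const_nhds.congr' ?_)
    filter_upwards [Filter.eventually_ge_atTop (max N M)] with n hn
    exact (key n hn).symm
  rw [hlim]
  filter_upwards [Filter.eventually_ge_atTop (max N M)] with n hn using key n hn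

abbrev preTensorCore (ξ : Metric.sphere (0 : L2 S) 1) :
    PreInnerProductSpace.Core ℂ (PreTensor ξ) where
  inner := tensorInner
  conj_inner_symm x y := by
    obtain ⟨n, h1, h2⟩ := ((eventually_tensorInner x y).and (eventually_tensorInner y x)).exists
    rw [← h1, ← h2, inner_conj_symm]
  re_inner_nonneg x := by
    obtain ⟨n, h⟩ := (eventually_tensorInner x x).exists
    rw [← h]
    exact inner_self_nonneg
  add_left x y z := by
    obtain ⟨n, h1, h2, h3⟩ := ((eventually_tensorInner (x + y) z).and
      ((eventually_tensorInner x z).and (eventually_tensorInner y z))).exists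
    rw [← h1, ← h2, ← h3, map_add, inner_add_left]
  smul_left x y c := by
    obtain ⟨n, h1, h2⟩ := ((eventually_tensorInner (c • x) y).and
      (eventually_tensorInner x y)).exists
    rw [← h1, ← h2, map_smul, inner_smul_left]

instance : SeminormedAddCommGroup (PreTensor ξ) :=
  InnerProductSpace.Core.toSeminormedAddCommGroup (c := preTensorCore ξ)
instance : InnerProductSpace ℂ (PreTensor ξ) := InnerProductSpace.ofCore (preTensorCore ξ)

theorem eventually_norm (x : PreTensor ξ) :
    ∀ᶠ n in Filter.atTop, ‖component n x‖ = ‖x‖ := by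
  filter_upwards [eventually_tensorInner x x] with n hn
  rw [← sq_eq_sq₀ (norm_nonneg _) (norm_nonneg _), norm_sq_eq_re_inner (𝕜 := ℂ),
    norm_sq_eq_re_inner (𝕜 := ℂ), hn]
  rfl

variable (ξ) in
/-- The infinite tensor product of Hilbert spaces `(ℓ²(S), ξ) ⊗ (ℓ²(S), ξ) ⊗ ⋯`. -/
abbrev InfTensor : Type := UniformSpace.Completion (PreTensor ξ)

theorem coe_eq_of_eventually {x y : PreTensor ξ}
    (h : ∀ᶠ n in Filter.atTop, component n x = component n y) :
    (x : InfTensor ξ) = (y : InfTensor ξ) := by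
  obtain ⟨n, h1, h2⟩ := (h.and (eventually_norm (x - y))).exists
  rw [← sub_eq_zero, ← UniformSpace.Completion.coe_sub, ← norm_eq_zero,
    UniformSpace.Completion.norm_coe, ← h2, map_sub, h1, sub_self, norm_zero]

variable (ξ) in
/-- The vector `ξ^{⊗ n}`. -/
def tensorPow : ∀ n, L2 (Fin n → S)
  | 0 => lp.single 2 Fin.elim0 1
  | n + 1 => tensorVec ξ n (tensorPow n)

variable (ξ) in
/-- The vector `Ξ = ξ ⊗ ξ ⊗ ⋯`. -/
def vacuum : InfTensor ξ :=
  (PreTensor.mk (tensorPow ξ) ⟨0, fun _ _ => rfl⟩ : PreTensor ξ)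

/-- The operator on the infinite tensor product given by a uniformly bounded sequence of operators
`T n` on the spaces `ℓ²(S)^{⊗ n}` with `T (n + 1) (f ⊗ ξ) = T n f ⊗ ξ` for all large `n`. -/
def limitOp (T : ∀ n, L2 (Fin n → S) →L[ℂ] L2 (Fin n → S)) (C : ℝ)
    (hC : ∀ n f, ‖T n f‖ ≤ C * ‖f‖)
    (hT : ∃ N, ∀ n ≥ N, ∀ f, T (n + 1) (tensorVec ξ n f) = tensorVec ξ n (T n f)) :
    PreTensor ξ →L[ℂ] PreTensor ξ :=
  LinearMap.mkContinuous
    { toFun := fun x => PreTensor.mk (fun n => T n (component n x)) (by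
        obtain ⟨N, hN⟩ := hT
        obtain ⟨M, hM⟩ := exists_coherent x
        refine ⟨max N M, fun n hn => ?_⟩
        rw [hM n (le_of_max_le_right hn), hN n (le_of_max_le_left hn)])
      map_add' := fun x y => Subtype.ext (funext fun n => by
        change T n (component n (x + y)) = T n (component n x) + T n (component n y)
        rw [map_add, map_add])
      map_smul' := fun c x => Subtype.ext (funext fun n => by
        change T n (component n (c • x)) = c • T n (component n x)
        rw [map_smul, map_smul]) } C
    (fun x => by
      obtain ⟨n, h1, h2⟩ := ((eventually_norm x).and (eventually_norm _)).exists
      rw [← h1, ← h2]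
      exact hC n _)

theorem component_limitOp (T : ∀ n, L2 (Fin n → S) →L[ℂ] L2 (Fin n → S)) (C : ℝ) (hC)
    (hT : ∃ N, ∀ n ≥ N, ∀ f, T (n + 1) (tensorVec ξ n f) = tensorVec ξ n (T n f))
    (n : ℕ) (x : PreTensor ξ) :
    component n (limitOp T C hC hT x) = T n (component n x) := rfl

end Tensor

/-! ### The R-matrix and the representations -/

section Operators

variable {ι : Type}

theorem norm_sq_mul_le {d : ι → ℂ} {C : ℝ} (hC : ∀ i, ‖d i‖ ≤ C) (f : L2 ι) (i : ι) :
    ‖d i * f i‖ ^ 2 ≤ C ^ 2 * ‖f i‖ ^ 2 := by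
  rw [norm_mul, mul_pow]
  exact mul_le_mul_of_nonneg_right (pow_le_pow_left₀ (norm_nonneg _) (hC i) 2) (sq_nonneg _)

theorem summable_norm_sq_mul {d : ι → ℂ} {C : ℝ} (hC : ∀ i, ‖d i‖ ≤ C) (f : L2 ι) :
    Summable fun i => ‖d i * f i‖ ^ 2 :=
  Summable.of_nonneg_of_le (fun _ => sq_nonneg _) (norm_sq_mul_le hC f)
    ((L2.summable f).mul_left _)

/-- Multiplication by a bounded function. -/
def mulOp (d : ι → ℂ) (C : ℝ) (hC : ∀ i, ‖d i‖ ≤ C) : L2 ι →L[ℂ] L2 ι :=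
  LinearMap.mkContinuous
    { toFun := fun f => (⟨fun i => d i * f i, L2.mem (summable_norm_sq_mul hC f)⟩ : L2 ι)
      map_add' := fun f g => lp.ext (funext fun i => mul_add _ _ _)
      map_smul' := fun c f => lp.ext (funext fun i => mul_left_comm _ _ _) } |C|
    (fun f => by
      rw [← sq_le_sq₀ (norm_nonneg _) (by positivity), mul_pow, sq_abs, L2.norm_sq, L2.norm_sq,
        ← tsum_mul_left]
      exact (summable_norm_sq_mul hC f).tsum_le_tsum (norm_sq_mul_le hC f)
        ((L2.summable f).mul_left _))

theorem norm_mulOp_le (d : ι → ℂ) (C : ℝ) (hC : ∀ i, ‖d i‖ ≤ C) (f : L2 ι) :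
    ‖mulOp d C hC f‖ ≤ |C| * ‖f‖ :=
  ContinuousLinearMap.le_of_opNorm_le _
    (LinearMap.mkContinuous_norm_le _ (abs_nonneg C) _) f

/-- Composition with a permutation of the basis. -/
def permOp (τ : ι ≃ ι) : L2 ι →ₗᵢ[ℂ] L2 ι where
  toFun f := ⟨fun i => f (τ i), L2.mem ((τ.summable_iff (f := fun i => ‖f i‖ ^ 2)).mpr (L2.summable f))⟩
  map_add' f g := rfl
  map_smul' c f := rfl
  norm_map' f := by
    rw [← sq_eq_sq₀ (norm_nonneg _) (norm_nonneg _), L2.norm_sq, L2.norm_sq]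
    exact τ.tsum_eq fun i => ‖f i‖ ^ 2

end Operators

/-- The index set of the basis of `V`: the nonzero integers. -/
abbrev Idx : Type := {i : ℤ // i ≠ 0}

/-- The index set of the basis `v_i ⊗ w_j` of `V ⊗ W`; this Hilbert space is `L2 Site`. -/
abbrev Site : Type := Idx × Idx

/-- Kerov's R-matrix acts on `V ⊗ V` by
`R (v_a ⊗ v_b) = diagCoeff q a b • v_a ⊗ v_b + swapCoeff q a b • v_b ⊗ v_a`; thus
`R (v_a ⊗ v_a) = - v_a ⊗ v_a` for `a < 0` and `q v_a ⊗ v_a` for `a > 0`, and for `a ≠ b`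
`R (v_a ⊗ v_b) = - √q v_b ⊗ v_a`, plus `(q - 1) v_a ⊗ v_b` if `a < b`. -/
def diagCoeff (q : ℝ) (a b : Idx) : ℂ :=
  if a = b then (if a.1 < 0 then -1 else (q : ℂ)) else if a.1 < b.1 then (q : ℂ) - 1 else 0

/-- The coefficient at the flip in the R-matrix. -/
def swapCoeff (q : ℝ) (a b : Idx) : ℂ := if a = b then 0 else -(Real.sqrt q : ℂ)

/-- The two kinds of tensor factors: `left` refers to the factors `V`, `right` to the factors
`W`. -/
inductive Side
  | left
  | right

/-- The index of the `V`-factor or of the `W`-factor at a site. -/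
def Side.letter : Side → Site → Idx
  | left, p => p.1
  | right, p => p.2

/-- Exchange the `V`-indices (or the `W`-indices) at the positions `a` and `b`. -/
def Side.exchangeFun {n : ℕ} (a b : Fin n) : Side → (Fin n → Site) → Fin n → Site
  | left, s => fun l => ((s (Equiv.swap a b l)).1, (s l).2)
  | right, s => fun l => ((s l).1, (s (Equiv.swap a b l)).2)

theorem Side.exchangeFun_exchangeFun {n : ℕ} (d : Side) (a b : Fin n) (s : Fin n → Site) :
    d.exchangeFun a b (d.exchangeFun a b s) = s := by
  cases d <;> simp [Side.exchangeFun]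

/-- `Side.exchangeFun` as a permutation of the basis of `(V ⊗ W)^{⊗ n}`. -/
def Side.exchange {n : ℕ} (d : Side) (a b : Fin n) : (Fin n → Site) ≃ (Fin n → Site) where
  toFun := d.exchangeFun a b
  invFun := d.exchangeFun a b
  left_inv := d.exchangeFun_exchangeFun a b
  right_inv := d.exchangeFun_exchangeFun a b

theorem Side.letter_exchange {n : ℕ} (d : Side) (a b l : Fin n) (s : Fin n → Site) :
    d.letter (d.exchange a b s l) = d.letter (s (Equiv.swap a b l)) := by
  cases d <;> rfl

/-- A common bound for the entries of the R-matrix. -/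
def coeffBound (q : ℝ) : ℝ := 1 + |q| + |q - 1| + Real.sqrt q

theorem norm_diagCoeff_le (q : ℝ) (a b : Idx) : ‖diagCoeff q a b‖ ≤ coeffBound q := by
  have h1 := abs_nonneg q
  have h2 := abs_nonneg (q - 1)
  have h3 := Real.sqrt_nonneg q
  have e : ‖(q : ℂ) - 1‖ = |q - 1| := by
    rw [← Complex.ofReal_one, ← Complex.ofReal_sub, Complex.norm_real, Real.norm_eq_abs]
  unfold diagCoeff coeffBound
  split_ifs
  · simp only [norm_neg, norm_one]; linarith
  · rw [Complex.norm_real, Real.norm_eq_abs]; linarith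
  · rw [e]; linarith
  · rw [norm_zero]; linarith

theorem norm_swapCoeff_le (q : ℝ) (a b : Idx) : ‖swapCoeff q a b‖ ≤ coeffBound q := by
  have h1 := abs_nonneg q
  have h2 := abs_nonneg (q - 1)
  have h3 := Real.sqrt_nonneg q
  unfold swapCoeff coeffBound
  split_ifs
  · rw [norm_zero]; linarith
  · rw [norm_neg, Complex.norm_real, Real.norm_eq_abs, abs_of_nonneg h3]; linarith

/-- The operator on `(V ⊗ W)^{⊗ n}` given by the R-matrix in the `V`-factors (or the `W`-factors)
at the positions `a` and `b`. -/
def pairOp (q : ℝ) (d : Side) {n : ℕ} (a b : Fin n) : L2 (Fin n → Site) →L[ℂ] L2 (Fin n → Site) :=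
  mulOp (fun s => diagCoeff q (d.letter (s a)) (d.letter (s b))) (coeffBound q)
      (fun _ => norm_diagCoeff_le q _ _)
    + mulOp (fun s => swapCoeff q (d.letter (s a)) (d.letter (s b))) (coeffBound q)
        (fun _ => norm_swapCoeff_le q _ _) ∘L (permOp (d.exchange a b)).toContinuousLinearMap

theorem pairOp_apply (q : ℝ) (d : Side) {n : ℕ} (a b : Fin n) (f : L2 (Fin n → Site))
    (s : Fin n → Site) : pairOp q d a b f s =
      diagCoeff q (d.letter (s a)) (d.letter (s b)) * f s
        + swapCoeff q (d.letter (s a)) (d.letter (s b)) * f (d.exchange a b s) := rfl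

/-- The action of `pairOp` on the orthonormal basis. -/
theorem pairOp_single (q : ℝ) (d : Side) {n : ℕ} (a b : Fin n) (s : Fin n → Site) :
    pairOp q d a b (lp.single 2 s 1) =
      diagCoeff q (d.letter (s a)) (d.letter (s b)) • (lp.single 2 s 1 : L2 (Fin n → Site))
        + swapCoeff q (d.letter (s a)) (d.letter (s b)) •
          (lp.single 2 (d.exchange a b s) 1 : L2 (Fin n → Site)) := by
  refine lp.ext (funext fun t => ?_)
  rw [pairOp_apply]
  simp only [lp.coeFn_add, lp.coeFn_smul, Pi.add_apply, Pi.smul_apply, smul_eq_mul,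
    lp.single_apply, Pi.single_apply]
  have hiff : d.exchange a b t = s ↔ t = d.exchange a b s := by
    constructor
    · rintro rfl; exact (d.exchangeFun_exchangeFun a b t).symm
    · rintro rfl; exact d.exchangeFun_exchangeFun a b s
  have hsymm : ∀ x y, swapCoeff q x y = swapCoeff q y x := fun x y => by
    simp only [swapCoeff, eq_comm]
  simp only [hiff]
  congr 1
  · split_ifs with h
    · rw [h]
    · simp
  · split_ifs with h
    · rw [h, Side.letter_exchange, Side.letter_exchange, Equiv.swap_apply_left,
        Equiv.swap_apply_right, hsymm]
    · simp

theorem norm_pairOp_le (q : ℝ) (d : Side) {n : ℕ} (a b : Fin n) (f : L2 (Fin n → Site)) :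
    ‖pairOp q d a b f‖ ≤ 2 * |coeffBound q| * ‖f‖ := by
  refine (norm_add_le _ _).trans ?_
  have h2 := norm_mulOp_le _ _ (fun s => norm_diagCoeff_le q (d.letter (s a)) (d.letter (s b))) f
  have h3 := norm_mulOp_le _ _ (fun s => norm_swapCoeff_le q (d.letter (s a)) (d.letter (s b)))
    (permOp (d.exchange a b) f)
  rw [LinearIsometry.norm_map] at h3
  refine (add_le_add h2 h3).trans (le_of_eq (by ring))

/-- The R-matrix in the factors number `j` and `j + 1` (counted from `0`) of `(V ⊗ W)^{⊗ n}`; it is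
set to `0` for the small `n` for which these factors do not exist. -/
def levelOp (q : ℝ) (d : Side) (j n : ℕ) : L2 (Fin n → Site) →L[ℂ] L2 (Fin n → Site) :=
  if h : j + 1 < n then pairOp q d ⟨j, j.lt_succ_self.trans h⟩ ⟨j + 1, h⟩ else 0

theorem levelOp_of_lt (q : ℝ) (d : Side) {j n : ℕ} (h : j + 1 < n) :
    levelOp q d j n = pairOp q d ⟨j, j.lt_succ_self.trans h⟩ ⟨j + 1, h⟩ := dif_pos h

theorem norm_levelOp_le (q : ℝ) (d : Side) (j n : ℕ) (f : L2 (Fin n → Site)) :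
    ‖levelOp q d j n f‖ ≤ 2 * |coeffBound q| * ‖f‖ := by
  unfold levelOp
  split_ifs
  · exact norm_pairOp_le q d _ _ f
  · simp only [zero_apply, norm_zero]; positivity

theorem exchange_castSucc (d : Side) {n : ℕ} (a b : Fin n) (s : Fin (n + 1) → Site) :
    Fin.init (d.exchange a.castSucc b.castSucc s) = d.exchange a b (Fin.init s) ∧
      d.exchange a.castSucc b.castSucc s (Fin.last n) = s (Fin.last n) := by
  have h1 : ∀ l : Fin n, Equiv.swap a.castSucc b.castSucc l.castSucc = (Equiv.swap a b l).castSucc :=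
    fun l => by
      simp only [Equiv.swap_apply_def, Fin.castSucc_inj]
      split_ifs <;> rfl
  have h2 : Equiv.swap a.castSucc b.castSucc (Fin.last n) = Fin.last n :=
    Equiv.swap_apply_of_ne_of_ne (Fin.castSucc_lt_last a).ne' (Fin.castSucc_lt_last b).ne'
  cases d
  · refine ⟨funext fun l => ?_, ?_⟩
    · simp only [Fin.init, Side.exchange, Side.exchangeFun, Equiv.coe_fn_mk, h1]
    · simp only [Side.exchange, Side.exchangeFun, Equiv.coe_fn_mk, h2]
  · refine ⟨funext fun l => ?_, ?_⟩
    · simp only [Fin.init, Side.exchange, Side.exchangeFun, Equiv.coe_fn_mk, h1]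
    · simp only [Side.exchange, Side.exchangeFun, Equiv.coe_fn_mk, h2]

theorem pairOp_tensorVec (q : ℝ) (d : Side) (ξ : Metric.sphere (0 : L2 Site) 1) {n : ℕ}
    (a b : Fin n) (f : L2 (Fin n → Site)) :
    pairOp q d a.castSucc b.castSucc (tensorVec ξ n f) = tensorVec ξ n (pairOp q d a b f) := by
  refine lp.ext (funext fun s => ?_)
  obtain ⟨h1, h2⟩ := exchange_castSucc d a b s
  rw [pairOp_apply]
  change _ * (f (Fin.init s) * _) + _ * (f (Fin.init (d.exchange a.castSucc b.castSucc s)) *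
    (ξ : L2 Site) (d.exchange a.castSucc b.castSucc s (Fin.last n))) =
      pairOp q d a b f (Fin.init s) * _
  rw [h1, h2, pairOp_apply]
  simp only [Fin.init]
  ring

theorem levelOp_tensorVec (q : ℝ) (d : Side) (j : ℕ) (ξ : Metric.sphere (0 : L2 Site) 1) :
    ∃ N, ∀ n ≥ N, ∀ f, levelOp q d j (n + 1) (tensorVec ξ n f)
      = tensorVec ξ n (levelOp q d j n f) := by
  refine ⟨j + 2, fun n hn f => ?_⟩
  rw [levelOp_of_lt q d (show j + 1 < n by omega), levelOp_of_lt q d (show j + 1 < n + 1 by omega)]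
  exact pairOp_tensorVec q d ξ ⟨j, by omega⟩ ⟨j + 1, by omega⟩ f

/-- The operators `R_{j(j+1)}` acting in the `V`-factors, respectively the `W`-factors, of the
infinite tensor product; the factors are counted from `0`. -/
def rOp (q : ℝ) (ξ : Metric.sphere (0 : L2 Site) 1) (d : Side) (j : ℕ) :
    InfTensor ξ →L[ℂ] InfTensor ξ :=
  complHom (limitOp (levelOp q d j) _ (norm_levelOp_le q d j) (levelOp_tensorVec q d j ξ))

/-! The relations are checked in the finite tensor powers. -/

theorem sqrt_mul_sqrt_complex {q : ℝ} (hq : 0 < q) : (Real.sqrt q : ℂ) * (Real.sqrt q : ℂ) = q := by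
  rw [← Complex.ofReal_mul, Real.mul_self_sqrt hq.le]

theorem exchange_exchange (d : Side) {n : ℕ} (a b : Fin n) (s : Fin n → Site) :
    d.exchange a b (d.exchange a b s) = s := d.exchangeFun_exchangeFun a b s

theorem pairOp_sq {q : ℝ} (hq : 0 < q) (d : Side) {n : ℕ} (a b : Fin n)
    (f : L2 (Fin n → Site)) : pairOp q d a b (pairOp q d a b f)
      = ((q : ℂ) - 1) • pairOp q d a b f + (q : ℂ) • f := by
  refine lp.ext (funext fun s => ?_)
  simp only [lp.coeFn_add, lp.coeFn_smul, Pi.add_apply, Pi.smul_apply, smul_eq_mul,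
    pairOp_apply, exchange_exchange, Side.letter_exchange, Equiv.swap_apply_left,
    Equiv.swap_apply_right]
  generalize d.letter (s a) = x
  generalize d.letter (s b) = y
  generalize f (d.exchange a b s) = u
  generalize f s = v
  have hs := sqrt_mul_sqrt_complex hq
  unfold diagCoeff swapCoeff
  rcases lt_trichotomy x y with h | h | h
  · have h1 : x.1 < y.1 := h
    simp only [h.ne, h.ne', h1, h1.not_gt, if_true, if_false]
    linear_combination v * hs
  · subst h
    simp only [if_true]
    split_ifs <;> ring
  · have h1 : y.1 < x.1 := h
    simp only [h.ne, h.ne', h1, h1.not_gt, if_true, if_false]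
    linear_combination v * hs

theorem pairOp_comm_of_disjoint (q : ℝ) (d : Side) {n : ℕ} {a b a' b' : Fin n}
    (h1 : a ≠ a') (h2 : a ≠ b') (h3 : b ≠ a') (h4 : b ≠ b') (f : L2 (Fin n → Site)) :
    pairOp q d a b (pairOp q d a' b' f) = pairOp q d a' b' (pairOp q d a b f) := by
  have hx : ∀ s, d.exchange a b (d.exchange a' b' s) = d.exchange a' b' (d.exchange a b s) := by
    have key : ∀ l, Equiv.swap a b (Equiv.swap a' b' l) = Equiv.swap a' b' (Equiv.swap a b l) := by
      intro l
      simp only [Equiv.swap_apply_def]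
      split_ifs <;> simp_all
    intro s
    cases d <;> simp [Side.exchange, Side.exchangeFun, key]
  refine lp.ext (funext fun s => ?_)
  simp only [pairOp_apply, Side.letter_exchange, hx,
    Equiv.swap_apply_of_ne_of_ne h1 h2, Equiv.swap_apply_of_ne_of_ne h3 h4,
    Equiv.swap_apply_of_ne_of_ne h1.symm h3.symm, Equiv.swap_apply_of_ne_of_ne h2.symm h4.symm]
  ring

theorem pairOp_left_right (q : ℝ) {n : ℕ} (a b a' b' : Fin n) (f : L2 (Fin n → Site)) :
    pairOp q .left a b (pairOp q .right a' b' f) = pairOp q .right a' b' (pairOp q .left a b f) := by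
  refine lp.ext (funext fun s => ?_)
  simp only [pairOp_apply, Side.exchange, Side.exchangeFun, Side.letter, Equiv.coe_fn_mk]
  ring

theorem coeff_braid {q : ℝ} (hs : (Real.sqrt q : ℂ) * (Real.sqrt q : ℂ) = q) (x y z : Idx)
    (u₁ u₂ u₃ u₄ u₅ u₆ : ℂ) :
  diagCoeff q x y * (diagCoeff q y z * (diagCoeff q x y * u₆ + swapCoeff q x y * u₄)
     + swapCoeff q y z * (diagCoeff q x z * u₅ + swapCoeff q x z * u₂))
  + swapCoeff q x y * (diagCoeff q x z * (diagCoeff q y x * u₄ + swapCoeff q y x * u₆)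
     + swapCoeff q x z * (diagCoeff q y z * u₃ + swapCoeff q y z * u₁)) =
  diagCoeff q y z * (diagCoeff q x y * (diagCoeff q y z * u₆ + swapCoeff q y z * u₅)
     + swapCoeff q x y * (diagCoeff q x z * u₄ + swapCoeff q x z * u₃))
  + swapCoeff q y z * (diagCoeff q x z * (diagCoeff q z y * u₅ + swapCoeff q z y * u₆)
     + swapCoeff q x z * (diagCoeff q x y * u₂ + swapCoeff q x y * u₁)) := by
  have e : ∀ a b : Idx, a = b ↔ a.1 = b.1 := fun a b => Subtype.ext_iff
  unfold diagCoeff swapCoeff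
  simp only [e]
  clear e
  generalize (Real.sqrt q : ℂ) = r at hs ⊢
  generalize (q : ℂ) = Q at hs ⊢
  subst hs
  generalize x.1 = x
  generalize y.1 = y
  generalize z.1 = z
  rcases lt_trichotomy x y with h | h | h <;> rcases lt_trichotomy y z with h' | h' | h' <;>
    rcases lt_trichotomy x z with h'' | h'' | h'' <;>
    first
    | (exfalso; omega)
    | (subst_vars
       simp_all only [lt_irrefl, if_true, if_false, LT.lt.ne, LT.lt.ne', LT.lt.not_gt]
       first
       | ring1
       | (split_ifs <;> ring1))

theorem pairOp_braid {q : ℝ} (hq : 0 < q) (d : Side) {n : ℕ} {a b c : Fin n}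
    (hab : a ≠ b) (hbc : b ≠ c) (hac : a ≠ c) (f : L2 (Fin n → Site)) :
    pairOp q d a b (pairOp q d b c (pairOp q d a b f))
      = pairOp q d b c (pairOp q d a b (pairOp q d b c f)) := by
  have hx : ∀ s, d.exchange a b (d.exchange b c (d.exchange a b s))
      = d.exchange b c (d.exchange a b (d.exchange b c s)) := by
    have key : ∀ l, Equiv.swap a b (Equiv.swap b c (Equiv.swap a b l))
        = Equiv.swap b c (Equiv.swap a b (Equiv.swap b c l)) := by
      have h1 : Equiv.swap a b * Equiv.swap b c * Equiv.swap a b = Equiv.swap a c := by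
        rw [Equiv.swap_comm a b, Equiv.swap_comm b c,
          Equiv.swap_mul_swap_mul_swap hbc.symm hac.symm, Equiv.swap_comm]
      have h2 : Equiv.swap b c * Equiv.swap a b * Equiv.swap b c = Equiv.swap a c := by
        rw [Equiv.swap_mul_swap_mul_swap hab hac, Equiv.swap_comm]
      intro l
      simpa only [Equiv.Perm.mul_apply] using congrArg (fun e => e l) (h1.trans h2.symm)
    intro s
    cases d <;> simp [Side.exchange, Side.exchangeFun, key]
  refine lp.ext (funext fun s => ?_)
  simp only [pairOp_apply, Side.letter_exchange, hx, exchange_exchange,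
    Equiv.swap_apply_left, Equiv.swap_apply_right,
    Equiv.swap_apply_of_ne_of_ne hab hac, Equiv.swap_apply_of_ne_of_ne hac.symm hbc.symm]
  generalize f (d.exchange b c (d.exchange a b (d.exchange b c s))) = u₁
  generalize f (d.exchange a b (d.exchange b c s)) = u₂
  generalize f (d.exchange b c (d.exchange a b s)) = u₃
  generalize f (d.exchange a b s) = u₄
  generalize f (d.exchange b c s) = u₅
  generalize f s = u₆
  generalize d.letter (s a) = x
  generalize d.letter (s b) = y
  generalize d.letter (s c) = z
  linear_combination coeff_braid (sqrt_mul_sqrt_complex hq) x y z u₁ u₂ u₃ u₄ u₅ u₆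

section Representation

variable {q : ℝ} (ξ : Metric.sphere (0 : L2 Site) 1)

theorem rOp_coe (d : Side) (j : ℕ) (x : PreTensor ξ) :
    rOp q ξ d j (x : InfTensor ξ) = ((limitOp (levelOp q d j) _ (norm_levelOp_le q d j)
      (levelOp_tensorVec q d j ξ) x : PreTensor ξ) : InfTensor ξ) := complHom_coe _ _

theorem infTensor_ext {T T' : InfTensor ξ →L[ℂ] InfTensor ξ}
    (h : ∀ x : PreTensor ξ, T (x : InfTensor ξ) = T' (x : InfTensor ξ)) : T = T' := by
  refine ContinuousLinearMap.ext fun x => ?_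
  induction x using UniformSpace.Completion.induction_on with
  | hp => exact isClosed_eq T.continuous T'.continuous
  | ih x => exact h x

theorem rOp_sq (hq : 0 < q) (d : Side) (j : ℕ) : rOp q ξ d j * rOp q ξ d j =
    ((q : ℂ) - 1) • rOp q ξ d j + algebraMap ℂ _ (q : ℂ) := by
  refine infTensor_ext ξ fun x => ?_
  rw [Algebra.algebraMap_eq_smul_one]
  change rOp q ξ d j (rOp q ξ d j (x : InfTensor ξ)) =
    ((q : ℂ) - 1) • rOp q ξ d j (x : InfTensor ξ) + (q : ℂ) • (x : InfTensor ξ)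
  simp only [rOp_coe, ← UniformSpace.Completion.coe_smul, ← UniformSpace.Completion.coe_add]
  refine coe_eq_of_eventually ?_
  filter_upwards [Filter.eventually_gt_atTop (j + 1)] with n hn
  simp only [component_limitOp, map_add, map_smul, levelOp_of_lt q d hn]
  exact pairOp_sq hq d _ _ _

theorem rOp_braid (hq : 0 < q) (d : Side) (j : ℕ) :
    rOp q ξ d j * rOp q ξ d (j + 1) * rOp q ξ d j =
      rOp q ξ d (j + 1) * rOp q ξ d j * rOp q ξ d (j + 1) := by
  refine infTensor_ext ξ fun x => ?_
  change rOp q ξ d j (rOp q ξ d (j + 1) (rOp q ξ d j (x : InfTensor ξ))) =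
    rOp q ξ d (j + 1) (rOp q ξ d j (rOp q ξ d (j + 1) (x : InfTensor ξ)))
  simp only [rOp_coe]
  refine coe_eq_of_eventually ?_
  filter_upwards [Filter.eventually_gt_atTop (j + 1 + 1)] with n hn
  simp only [component_limitOp, levelOp_of_lt q d hn,
    levelOp_of_lt q d (show j + 1 < n by omega)]
  exact pairOp_braid hq d (by simp) (by simp) (by simp only [ne_eq, Fin.mk.injEq]; omega) _

theorem rOp_comm (d : Side) (j k : ℕ) (h : j + 1 < k) :
    rOp q ξ d j * rOp q ξ d k = rOp q ξ d k * rOp q ξ d j := by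
  refine infTensor_ext ξ fun x => ?_
  change rOp q ξ d j (rOp q ξ d k (x : InfTensor ξ)) = rOp q ξ d k (rOp q ξ d j (x : InfTensor ξ))
  simp only [rOp_coe]
  refine coe_eq_of_eventually ?_
  filter_upwards [Filter.eventually_gt_atTop (k + 1)] with n hn
  simp only [component_limitOp, levelOp_of_lt q d hn, levelOp_of_lt q d (show j + 1 < n by omega)]
  refine pairOp_comm_of_disjoint q d ?_ ?_ ?_ ?_ _ <;> simp only [ne_eq, Fin.mk.injEq] <;> omega

theorem rOp_left_right (j k : ℕ) :
    rOp q ξ .left j * rOp q ξ .right k = rOp q ξ .right k * rOp q ξ .left j := by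
  refine infTensor_ext ξ fun x => ?_
  change rOp q ξ .left j (rOp q ξ .right k (x : InfTensor ξ)) =
    rOp q ξ .right k (rOp q ξ .left j (x : InfTensor ξ))
  simp only [rOp_coe]
  refine coe_eq_of_eventually ?_
  filter_upwards [Filter.eventually_gt_atTop (j + k + 1)] with n hn
  simp only [component_limitOp, levelOp_of_lt q _ (show k + 1 < n by omega),
    levelOp_of_lt q _ (show j + 1 < n by omega)]
  exact pairOp_left_right q _ _ _ _ _

/-- The representation of `H_∞(q)` in the infinite tensor product in which `σ_j` acts by the
R-matrix in the neighbouring factors number `j` and `j + 1`; on the factors `V` for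
`Side.left` (this is `A ↦ A^{(l)}`), on the factors `W` for `Side.right`. -/
def rep (hq : 0 < q) (d : Side) : H q →ₐ[ℂ] (InfTensor ξ →L[ℂ] InfTensor ξ) :=
  lift (rOp q ξ d) (rOp_sq ξ hq d) (rOp_braid ξ hq d) (rOp_comm ξ d)

theorem rep_commute (hq : 0 < q) (A B : H q) :
    Commute (rep ξ hq .left A) (rep ξ hq .right B) := by
  induction A using H.induction with
  | hσ m =>
    induction B using H.induction with
    | hσ l =>
      simp only [rep, lift_σ]
      exact rOp_left_right ξ m l
    | hc c => rw [AlgHom.commutes]; exact (Algebra.commutes c _).symm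
    | hadd A B hA hB => rw [map_add]; exact hA.add_right hB
    | hmul A B hA hB => rw [map_mul]; exact hA.mul_right hB
  | hc c => rw [AlgHom.commutes]; exact Algebra.commutes c _
  | hadd A B hA hB => rw [map_add]; exact hA.add_left hB
  | hmul A B hA hB => rw [map_mul]; exact hA.mul_left hB

/-- The representation of `H_∞(q) ⊗ H_∞(q)` in the infinite tensor product. -/
def doubleRep (hq : 0 < q) : H q ⊗[ℂ] H q →ₐ[ℂ] (InfTensor ξ →L[ℂ] InfTensor ξ) :=
  Algebra.TensorProduct.lift (rep ξ hq .left) (rep ξ hq .right) (rep_commute ξ hq)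

/-- The cyclic span of `Ξ`: the closure of the set of all vectors `T Ξ`, where `T` ranges in
`H_∞(q) ⊗ H_∞(q)`. -/
def cyclicSpan (hq : 0 < q) : Submodule ℂ (InfTensor ξ) :=
  (LinearMap.range ((ContinuousLinearMap.apply ℂ (InfTensor ξ) (vacuum ξ)).toLinearMap ∘ₗ
    (doubleRep ξ hq).toLinearMap)).topologicalClosure

end Representation

/-- The weights `a_i = β_{-i}` for `i < 0` and `a_i = α_i` for `i > 0` (recall that `α k` is
`α_{k+1}` and `β k` is `β_{k+1}`). -/
def weight (α β : ℕ → ℝ) (i : Idx) : ℝ :=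
  if i.1 < 0 then β (i.1.natAbs - 1) else α (i.1.natAbs - 1)

/-- The nonzero integers as two copies of `ℕ`: `k` in the first copy is `k + 1`, and `k` in the
second copy is `-(k + 1)`. -/
def idxEquiv : ℕ ⊕ ℕ ≃ Idx where
  toFun := Sum.elim (fun k => ⟨(k : ℤ) + 1, by omega⟩) (fun k => ⟨-((k : ℤ) + 1), by omega⟩)
  invFun i := if i.1 < 0 then Sum.inr (i.1.natAbs - 1) else Sum.inl (i.1.natAbs - 1)
  left_inv := by
    rintro (k | k)
    · have : ¬ ((k : ℤ) + 1 < 0) := by omega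
      simp only [Sum.elim_inl, this, if_false, Sum.inl.injEq]
      omega
    · have : -((k : ℤ) + 1) < 0 := by omega
      simp only [Sum.elim_inr, this, if_true, Sum.inr.injEq]
      omega
  right_inv := by
    rintro ⟨i, hi⟩
    apply Subtype.ext
    by_cases h : i < 0
    · simp only [h, if_true, Sum.elim_inr]; omega
    · simp only [h, if_false, Sum.elim_inl]; omega

theorem hasSum_weight {α β : ℕ → ℝ} (h : IsParameter α β 0) : HasSum (weight α β) 1 := by
  rw [← idxEquiv.hasSum_iff]
  have e := h.sum_eq
  rw [add_zero] at e
  rw [← e]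
  refine HasSum.sum (f := weight α β ∘ idxEquiv) ?_ ?_
  · convert h.summable_left.hasSum using 1
    funext k
    have : ¬ ((k : ℤ) + 1 < 0) := by omega
    simp only [Function.comp_apply, weight, idxEquiv, Equiv.coe_fn_mk, Sum.elim_inl, this, if_false]
    congr 1
  · convert h.summable_right.hasSum using 1
    funext k
    have : -((k : ℤ) + 1) < 0 := by omega
    simp only [Function.comp_apply, weight, idxEquiv, Equiv.coe_fn_mk, Sum.elim_inr, this, if_true]
    congr 1

theorem weight_nonneg {α β : ℕ → ℝ} (h : IsParameter α β 0) (i : Idx) : 0 ≤ weight α β i := by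
  unfold weight
  split_ifs
  · exact h.nonneg_right _
  · exact h.nonneg_left _

/-- The coordinates of `ξ = ∑_j √β_j v_{-j} ⊗ w_{-j} + ∑_j √α_j v_j ⊗ w_j`. -/
def xiCoeff (α β : ℕ → ℝ) (p : Site) : ℂ :=
  if p.1 = p.2 then (Real.sqrt (weight α β p.1) : ℂ) else 0

theorem hasSum_xiCoeff {α β : ℕ → ℝ} (h : IsParameter α β 0) :
    HasSum (fun p => ‖xiCoeff α β p‖ ^ 2) 1 := by
  have hinj : Function.Injective fun i : Idx => ((i, i) : Site) := fun i j hij =>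
    congrArg Prod.fst hij
  rw [← hinj.hasSum_iff]
  · convert hasSum_weight h using 1
    funext i
    simp only [Function.comp_apply, xiCoeff, if_true, Complex.norm_real, Real.norm_eq_abs, sq_abs,
      Real.sq_sqrt (weight_nonneg h i)]
  · rintro ⟨i, j⟩ hij
    have : i ≠ j := fun e => hij ⟨i, by rw [e]⟩
    simp [xiCoeff, this]

/-- The unit vector `ξ ∈ V ⊗ W`. -/
def xi (α β : ℕ → ℝ) (h : IsParameter α β 0) : Metric.sphere (0 : L2 Site) 1 :=
  ⟨⟨xiCoeff α β, L2.mem (hasSum_xiCoeff h).summable⟩, by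
    rw [mem_sphere_zero_iff_norm, ← sq_eq_sq₀ (norm_nonneg _) zero_le_one, L2.norm_sq, one_pow]
    exact (hasSum_xiCoeff h).tsum_eq⟩

end IwahoriHecke

end

noncomputable section

namespace IwahoriHecke

variable {q : ℝ}

/-! The vacuum functional `A ↦ ⟨A^{(l)} Ξ, Ξ⟩` is shown to be a normalized indecomposable trace with
the prescribed values on the `ζ_m`, and such a trace is shown to be unique. This gives existence,
uniqueness and (a) together.

Trace property. R is symmetric, so the functional is hermitian and positive. Since `ξ` is supported
on the diagonal, R in the `V`-factors and R in the `W`-factors have the same effect on `Ξ`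
(`pairOp_tensorPow`). Hence `B^{(r)} Ξ = (Bᵗ)^{(l)} Ξ`, and centrality follows because the left and
right operators commute (`isTrace_vacuumState`).

Indecomposability. A normalized trace is indecomposable exactly when it is multiplicative on
consecutive blocks of strands. In one direction, an element moved far away commutes with any given
one, so inserting a far copy of `C⋆C` produces a trace dominated by `χ`, which must be proportional
to `χ`. In the other, distant copies of a `χ`-null element are orthogonal for a multiplicative `χ`,
and averaging them shows that every dominated trace is proportional to `χ`. The vacuum functional is
multiplicative because `Ξ` is a product vector (`isMultiplicative_vacuumState`).

Uniqueness. A central multiplicative functional is determined by its values on the `ζ_m`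
(`eq_of_map_zeta_eq`). This rests on the decomposition `H_{n+2} = H_{n+1} + H_{n+1} σ_{n+1}
H_{n+1}`.

Values on `ζ_m`. Contracting the last tensor factor with `ξ` kills the flip term of R, so the value
is a sum over weakly increasing sequences of letters (`vacuumState_zeta`). For `q ≠ 1` its
generating function is a product of factors `(1 - x_i z)/(1 - y_i z)`, with `y_i = qα, x_i = α` or
`y_i = -β, x_i = -qβ`. Its logarithmic derivative has the coefficients `(q^k - 1) p_k`, and the
prescribed sums over partitions satisfy the same Newton recurrence (`chainCoeff_eq_cycleSum`).

For (b), `A ↦ A^{(l)} Ξ` preserves the norms of the trace and has dense image in the cyclic span,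
because `(A ⊗ B) Ξ = (A Bᵗ)^{(l)} Ξ`. It therefore extends to the required unitary. -/

/-! ### Parabolic subalgebras and shifts -/

/-- The subalgebra `H_n(q)` on the first `n` strands. -/
def parabolic (q : ℝ) (n : ℕ) : Subalgebra ℂ (H q) :=
  Algebra.adjoin ℂ (σ q '' {m | m + 1 < n})

theorem σ_mem_parabolic {n m : ℕ} (h : m + 1 < n) : σ q m ∈ parabolic q n :=
  Algebra.subset_adjoin ⟨m, h, rfl⟩

theorem parabolic_mono : Monotone (parabolic q) := fun _ _ h =>
  Algebra.adjoin_mono (Set.image_mono fun _ hm => lt_of_lt_of_le hm h)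

theorem exists_mem_parabolic (A : H q) : ∃ n, A ∈ parabolic q n := by
  induction A using H.induction with
  | hσ m => exact ⟨m + 2, σ_mem_parabolic (by omega)⟩
  | hc c => exact ⟨0, Subalgebra.algebraMap_mem _ c⟩
  | hadd A B hA hB =>
    obtain ⟨n, hn⟩ := hA
    obtain ⟨m, hm⟩ := hB
    exact ⟨max n m, add_mem (parabolic_mono (le_max_left n m) hn)
      (parabolic_mono (le_max_right n m) hm)⟩
  | hmul A B hA hB =>
    obtain ⟨n, hn⟩ := hA
    obtain ⟨m, hm⟩ := hB
    exact ⟨max n m, mul_mem (parabolic_mono (le_max_left n m) hn)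
      (parabolic_mono (le_max_right n m) hm)⟩

@[elab_as_elim]
theorem parabolic_induction {n : ℕ} {P : ∀ A : H q, A ∈ parabolic q n → Prop}
    (hσ : ∀ m (h : m + 1 < n), P (σ q m) (σ_mem_parabolic h))
    (hc : ∀ c : ℂ, P (algebraMap ℂ (H q) c) (Subalgebra.algebraMap_mem _ c))
    (hadd : ∀ A B hA hB, P A hA → P B hB → P (A + B) (add_mem hA hB))
    (hmul : ∀ A B hA hB, P A hA → P B hB → P (A * B) (mul_mem hA hB)) {A : H q}
    (hA : A ∈ parabolic q n) : P A hA := by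
  refine Algebra.adjoin_induction ?_ hc hadd hmul hA
  rintro _ ⟨m, hm, rfl⟩
  exact hσ m hm

theorem commute_of_mem_parabolic {n : ℕ} {A B : H q} (hA : A ∈ parabolic q n)
    (h : ∀ m, m + 1 < n → Commute (σ q m) B) : Commute A B := by
  induction hA using parabolic_induction with
  | hσ m hm => exact h m hm
  | hc c => exact Algebra.commutes c B
  | hadd A B _ _ hA hB => exact hA.add_left hB
  | hmul A B _ _ hA hB => exact hA.mul_left hB

theorem exists_eq_algebraMap_of_mem_parabolic_one {A : H q} (hA : A ∈ parabolic q 1) :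
    ∃ c : ℂ, A = algebraMap ℂ (H q) c := by
  induction hA using parabolic_induction with
  | hσ m hm => omega
  | hc c => exact ⟨c, rfl⟩
  | hadd A B _ _ hA hB =>
    obtain ⟨c, rfl⟩ := hA
    obtain ⟨d, rfl⟩ := hB
    exact ⟨c + d, (map_add _ _ _).symm⟩
  | hmul A B _ _ hA hB =>
    obtain ⟨c, rfl⟩ := hA
    obtain ⟨d, rfl⟩ := hB
    exact ⟨c * d, (map_mul _ _ _).symm⟩

/-! ### Double coset decomposition of the finite Hecke algebras. -/

/-- The subspace `H_{n+1} + H_{n+1} σ_{n+1} H_{n+1}`. -/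
def doubleCoset (q : ℝ) (n : ℕ) : Submodule ℂ (H q) :=
  (parabolic q (n + 1)).toSubmodule ⊔ Submodule.span ℂ
    {X | ∃ A ∈ parabolic q (n + 1), ∃ B ∈ parabolic q (n + 1), X = A * σ q n * B}

theorem mem_doubleCoset_of_mem {n : ℕ} {A : H q} (hA : A ∈ parabolic q (n + 1)) :
    A ∈ doubleCoset q n := Submodule.mem_sup_left hA

theorem mul_σ_mul_mem_doubleCoset {n : ℕ} {A B : H q} (hA : A ∈ parabolic q (n + 1))
    (hB : B ∈ parabolic q (n + 1)) : A * σ q n * B ∈ doubleCoset q n :=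
  Submodule.mem_sup_right (Submodule.subset_span ⟨A, hA, B, hB, rfl⟩)

@[elab_as_elim]
theorem doubleCoset_induction {n : ℕ} {P : ∀ A : H q, A ∈ doubleCoset q n → Prop}
    (h1 : ∀ A (hA : A ∈ parabolic q (n + 1)), P A (mem_doubleCoset_of_mem hA))
    (h2 : ∀ A (hA : A ∈ parabolic q (n + 1)) B (hB : B ∈ parabolic q (n + 1)),
      P (A * σ q n * B) (mul_σ_mul_mem_doubleCoset hA hB))
    (hadd : ∀ A B hA hB, P A hA → P B hB → P (A + B) (add_mem hA hB))
    (hsmul : ∀ (c : ℂ) A hA, P A hA → P (c • A) (Submodule.smul_mem _ c hA))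
    {A : H q} (hA : A ∈ doubleCoset q n) : P A hA := by
  obtain ⟨y, hy, z, hz, rfl⟩ := Submodule.mem_sup.mp hA
  have hle : ∀ {x}, x ∈ Submodule.span ℂ {X | ∃ A ∈ parabolic q (n + 1),
      ∃ B ∈ parabolic q (n + 1), X = A * σ q n * B} → x ∈ doubleCoset q n :=
    fun hx => Submodule.mem_sup_right hx
  refine hadd _ _ _ (hle hz) (h1 y hy) ?_
  refine Submodule.span_induction (p := fun A hA => P A (hle hA)) ?_ (h1 0 (zero_mem _))
    (fun A B hA hB => hadd A B _ _) (fun c A hA => hsmul c A _) hz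
  rintro _ ⟨A, hA, B, hB, rfl⟩
  exact h2 A hA B hB

theorem mul_mem_doubleCoset {n : ℕ} {A X : H q} (hA : A ∈ parabolic q (n + 1))
    (hX : X ∈ doubleCoset q n) : A * X ∈ doubleCoset q n := by
  induction hX using doubleCoset_induction with
  | h1 B hB => exact mem_doubleCoset_of_mem (mul_mem hA hB)
  | h2 B hB C hC =>
    rw [← mul_assoc, ← mul_assoc]
    exact mul_σ_mul_mem_doubleCoset (mul_mem hA hB) hC
  | hadd B C _ _ hB hC => rw [mul_add]; exact add_mem hB hC
  | hsmul c B _ hB => rw [mul_smul_comm]; exact Submodule.smul_mem _ c hB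

/-- When `A` commutes with `σ q n`, the two generators meet and the quadratic relation removes the
square. -/
theorem σ_mul_mul_σ_mul_mem {n : ℕ} (A : H q) (hA : ∀ B, Commute A (σ q n) →
    B ∈ parabolic q (n + 1) → A * B ∈ doubleCoset q n ∧ A * σ q n * B ∈ doubleCoset q n)
    (hc : Commute A (σ q n)) {B : H q} (hB : B ∈ parabolic q (n + 1)) :
    σ q n * (A * σ q n * B) ∈ doubleCoset q n := by
  have e : σ q n * (A * σ q n * B) = ((q : ℂ) - 1) • (A * σ q n * B) + (q : ℂ) • (A * B) := by
    rw [mul_assoc, ← mul_assoc, ← hc.eq, mul_assoc, ← mul_assoc (σ q n), σ_sq, add_mul, mul_add,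
      ← Algebra.smul_def, smul_mul_assoc, mul_smul_comm, mul_smul_comm]
  rw [e]
  exact add_mem (Submodule.smul_mem _ _ (hA B hc hB).2) (Submodule.smul_mem _ _ (hA B hc hB).1)

/-- The double coset space contains 1 and is stable under left multiplication by `H_{n+1}`, so only
stability under `σ q n` is at stake, that is, products `σ q n * A * σ q n * B`. By induction `A`
lies in the previous double coset space, whose outer factors commute with the new generator. What
remains is either a square, treated by the quadratic relation, or a braid word. -/
theorem parabolic_le_doubleCoset (n : ℕ) :
    (parabolic q (n + 2)).toSubmodule ≤ doubleCoset q n := by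
  have key : ∀ {n : ℕ}, (∀ {A B : H q}, A ∈ parabolic q (n + 1) → B ∈ parabolic q (n + 1) →
      σ q n * (A * σ q n * B) ∈ doubleCoset q n) →
      (parabolic q (n + 2)).toSubmodule ≤ doubleCoset q n := by
    intro n h Y hY
    suffices hs : ∀ X ∈ doubleCoset q n, Y * X ∈ doubleCoset q n by
      simpa using hs 1 (mem_doubleCoset_of_mem (one_mem _))
    change Y ∈ parabolic q (n + 2) at hY
    induction hY using parabolic_induction with
    | hσ m hm =>
      intro X hX
      rcases (show m ≤ n by omega).lt_or_eq with hmn | rfl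
      · exact mul_mem_doubleCoset (σ_mem_parabolic (by omega)) hX
      · induction hX using doubleCoset_induction with
        | h1 B hB => simpa using mul_σ_mul_mem_doubleCoset (one_mem _) hB
        | h2 B hB C hC => exact h hB hC
        | hadd B C _ _ hB hC => rw [mul_add]; exact add_mem hB hC
        | hsmul c B _ hB => rw [mul_smul_comm]; exact Submodule.smul_mem _ c hB
    | hc c =>
      intro X hX
      rw [← Algebra.smul_def]
      exact Submodule.smul_mem _ c hX
    | hadd A B _ _ hA hB => intro X hX; rw [add_mul]; exact add_mem (hA X hX) (hB X hX)
    | hmul A B _ _ hA hB => intro X hX; rw [mul_assoc]; exact hA _ (hB X hX)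
  induction n with
  | zero =>
    refine key fun {A B} hA hB => ?_
    obtain ⟨c, rfl⟩ := exists_eq_algebraMap_of_mem_parabolic_one hA
    exact σ_mul_mul_σ_mul_mem _ (fun B _ hB => ⟨mem_doubleCoset_of_mem (mul_mem hA hB),
      mul_σ_mul_mem_doubleCoset hA hB⟩) (Algebra.commutes c _) hB
  | succ n ih =>
    have hcomm : ∀ {A : H q}, A ∈ parabolic q (n + 1) → Commute A (σ q (n + 1)) := fun hA =>
      commute_of_mem_parabolic hA fun m hm => σ_comm q m (n + 1) (Or.inl (by omega))
    have hmono : ∀ {A : H q}, A ∈ parabolic q (n + 1) → A ∈ parabolic q (n + 1 + 1) := fun hA =>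
      parabolic_mono (by omega) hA
    refine key fun {A B} hA hB => ?_
    have hA' := ih hA
    clear hA
    induction hA' using doubleCoset_induction with
    | h1 A hA =>
      exact σ_mul_mul_σ_mul_mem _ (fun B _ hB =>
        ⟨mem_doubleCoset_of_mem (mul_mem (hmono hA) hB),
          mul_σ_mul_mem_doubleCoset (hmono hA) hB⟩) (hcomm hA) hB
    | h2 A hA C hC =>
      have e : σ q (n + 1) * (A * σ q n * C * σ q (n + 1) * B)
          = (A * σ q n) * σ q (n + 1) * (σ q n * C * B) := by
        calc _ = (σ q (n + 1) * A) * σ q n * (C * σ q (n + 1)) * B := by simp only [mul_assoc]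
          _ = A * (σ q (n + 1) * σ q n * σ q (n + 1)) * C * B := by
            rw [← (hcomm hA).eq, (hcomm hC).eq]; simp only [mul_assoc]
          _ = _ := by rw [← σ_braid]; simp only [mul_assoc]
      rw [e]
      have hs : σ q n ∈ parabolic q (n + 1 + 1) := σ_mem_parabolic (by omega)
      exact mul_σ_mul_mem_doubleCoset (mul_mem (hmono hA) hs)
        (mul_mem (mul_mem hs (hmono hC)) hB)
    | hadd C D _ _ hC hD => rw [add_mul, add_mul, mul_add]; exact add_mem hC hD
    | hsmul c D _ hD =>
      rw [smul_mul_assoc, smul_mul_assoc, mul_smul_comm]; exact Submodule.smul_mem _ c hD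

/-! ### Shifts and their realization by conjugation. -/

/-- The endomorphism `σ_m ↦ σ_{m+k}`. -/
def shift (q : ℝ) (k : ℕ) : H q →ₐ[ℂ] H q :=
  lift (fun m => σ q (m + k)) (fun m => σ_sq q _)
    (fun m => by rw [add_right_comm]; exact σ_braid q _)
    (fun m l h => σ_comm q _ _ (Or.inl (by omega)))

@[simp] theorem shift_σ (k m : ℕ) : shift q k (σ q m) = σ q (m + k) := by simp [shift]

theorem algHom_ext {B : Type} [Ring B] [Algebra ℂ B] {f g : H q →ₐ[ℂ] B}
    (h : ∀ m, f (σ q m) = g (σ q m)) (A : H q) : f A = g A := by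
  induction A using H.induction with
  | hσ m => exact h m
  | hc c => rw [AlgHom.commutes, AlgHom.commutes]
  | hadd A B hA hB => rw [map_add, map_add, hA, hB]
  | hmul A B hA hB => rw [map_mul, map_mul, hA, hB]

theorem shift_shift (k l : ℕ) (A : H q) : shift q k (shift q l A) = shift q (l + k) A :=
  algHom_ext (f := (shift q k).comp (shift q l)) (fun m => by simp [add_assoc]) A

@[simp] theorem shift_zero (A : H q) : shift q 0 A = A :=
  algHom_ext (g := AlgHom.id ℂ (H q)) (fun m => by simp) A

theorem star_algebraMap' (c : ℂ) :
    star (algebraMap ℂ (H q) c) = algebraMap ℂ (H q) (starRingEnd ℂ c) := by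
  simp [star_def]

theorem star_shift (k : ℕ) (A : H q) : star (shift q k A) = shift q k (star A) := by
  induction A using H.induction with
  | hσ m => simp
  | hc c => simp only [AlgHom.commutes, star_algebraMap']
  | hadd A B hA hB => rw [map_add, star_add, star_add, map_add, hA, hB]
  | hmul A B hA hB => rw [map_mul, star_mul, star_mul, map_mul, hA, hB]

theorem shift_mem_parabolic {n : ℕ} (k : ℕ) {A : H q} (hA : A ∈ parabolic q n) :
    shift q k A ∈ parabolic q (n + k) := by
  induction hA using parabolic_induction with
  | hσ m hm => rw [shift_σ]; exact σ_mem_parabolic (by omega)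
  | hc c => rw [AlgHom.commutes]; exact Subalgebra.algebraMap_mem _ c
  | hadd A B _ _ hA hB => rw [map_add]; exact add_mem hA hB
  | hmul A B _ _ hA hB => rw [map_mul]; exact mul_mem hA hB

theorem commute_shift {n k : ℕ} (hk : n ≤ k) {A : H q} (hA : A ∈ parabolic q n) (B : H q) :
    Commute A (shift q k B) := by
  refine commute_of_mem_parabolic hA fun m hm => ?_
  induction B using H.induction with
  | hσ l => rw [shift_σ]; exact σ_comm q _ _ (Or.inl (by omega))
  | hc c => rw [AlgHom.commutes]; exact (Algebra.commutes c _).symm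
  | hadd A B hA hB => rw [map_add]; exact hA.add_right hB
  | hmul A B hA hB => rw [map_mul]; exact hA.mul_right hB

theorem isUnit_σ (hq : 0 < q) (m : ℕ) : IsUnit (σ q m) := by
  have hq' : (q : ℂ) ≠ 0 := by exact_mod_cast hq.ne'
  have h : σ q m * (σ q m - ((q : ℂ) - 1) • 1) = (q : ℂ) • 1 := by
    rw [mul_sub, σ_sq, mul_smul_comm, mul_one, Algebra.algebraMap_eq_smul_one]; abel
  have h' : (σ q m - ((q : ℂ) - 1) • 1) * σ q m = (q : ℂ) • 1 := by
    rw [sub_mul, σ_sq, smul_mul_assoc, one_mul, Algebra.algebraMap_eq_smul_one]; abel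
  refine ⟨⟨σ q m, (q : ℂ)⁻¹ • (σ q m - ((q : ℂ) - 1) • 1), ?_, ?_⟩, rfl⟩
  · rw [mul_smul_comm, h, smul_smul, inv_mul_cancel₀ hq', one_smul]
  · rw [smul_mul_assoc, h', smul_smul, inv_mul_cancel₀ hq', one_smul]

/-- The product `σ_1 σ_2 ⋯ σ_k`, which conjugates `H_k` to its shift. -/
def cycle (q : ℝ) : ℕ → H q
  | 0 => 1
  | k + 1 => cycle q k * σ q k

theorem isUnit_cycle (hq : 0 < q) (k : ℕ) : IsUnit (cycle q k) := by
  induction k with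
  | zero => exact isUnit_one
  | succ k ih => exact ih.mul (isUnit_σ hq k)

theorem cycle_mem_parabolic (k : ℕ) : cycle q k ∈ parabolic q (k + 1) := by
  induction k with
  | zero => exact one_mem _
  | succ k ih => exact mul_mem (parabolic_mono (by omega) ih) (σ_mem_parabolic (by omega))

/-- The last letter of the cycle commutes with `σ q m` until the cycle ends in `σ q m * σ q (m +
1)`. There the braid relation creates `σ q (m + 1)` on the left, and this commutes with all the
remaining letters. -/
theorem cycle_mul_σ {k m : ℕ} (h : m + 1 < k) :
    cycle q k * σ q m = σ q (m + 1) * cycle q k := by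
  induction k with
  | zero => omega
  | succ k ih =>
    rcases (show m + 1 ≤ k by omega).lt_or_eq with hk | rfl
    · rw [cycle, mul_assoc, σ_comm q k m (Or.inr hk), ← mul_assoc, ih hk, mul_assoc]
    · have hc : Commute (cycle q m) (σ q (m + 1)) :=
        commute_of_mem_parabolic (cycle_mem_parabolic m) fun l hl =>
          σ_comm q l _ (Or.inl (by omega))
      calc cycle q (m + 1 + 1) * σ q m
          = cycle q m * (σ q m * σ q (m + 1) * σ q m) := by simp only [cycle, mul_assoc]
        _ = (cycle q m * σ q (m + 1)) * (σ q m * σ q (m + 1)) := by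
          rw [σ_braid]; simp only [mul_assoc]
        _ = _ := by rw [hc.eq]; simp only [cycle, mul_assoc]

theorem cycle_mul {k : ℕ} {B : H q} (hB : B ∈ parabolic q k) :
    cycle q k * B = shift q 1 B * cycle q k := by
  induction hB using parabolic_induction with
  | hσ m hm => rw [shift_σ, cycle_mul_σ hm]
  | hc c => rw [AlgHom.commutes, Algebra.commutes]
  | hadd A B _ _ hA hB => rw [map_add, mul_add, add_mul, hA, hB]
  | hmul A B _ _ hA hB => rw [map_mul, ← mul_assoc, hA, mul_assoc, hB, mul_assoc]

/-! ### Central and multiplicative functionals -/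

/-- On a finite subalgebra the shift by one is conjugation by a cycle. After a further shift by `k ≥
n` the conjugating unit commutes with `A`, so centrality removes it. -/
theorem map_mul_shift_succ (hq : 0 < q) {χ : H q →ₗ[ℂ] ℂ} (hχ : ∀ A B, χ (A * B) = χ (B * A))
    {n k : ℕ} (hk : n ≤ k) {A : H q} (hA : A ∈ parabolic q n) (B : H q) :
    χ (A * shift q (k + 1) B) = χ (A * shift q k B) := by
  obtain ⟨l, hl⟩ := exists_mem_parabolic B
  obtain ⟨u, hu⟩ := isUnit_cycle hq l
  have h1 : shift q 1 B = u * B * (↑u⁻¹ : H q) := by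
    rw [hu, cycle_mul hl, ← hu, mul_assoc, Units.mul_inv, mul_one]
  have h2 : shift q (k + 1) B = shift q k (u : H q) * shift q k B * shift q k (↑u⁻¹ : H q) := by
    rw [add_comm, ← shift_shift k 1, h1, map_mul, map_mul]
  rw [h2, ← mul_assoc, hχ, ← mul_assoc, ← mul_assoc, ← (commute_shift hk hA _).eq,
    mul_assoc A, ← map_mul, Units.inv_mul, map_one, mul_one]

theorem map_mul_shift_eq (hq : 0 < q) {χ : H q →ₗ[ℂ] ℂ} (hχ : ∀ A B, χ (A * B) = χ (B * A))
    {n k : ℕ} (hk : n ≤ k) {A : H q} (hA : A ∈ parabolic q n) (B : H q) :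
    χ (A * shift q k B) = χ (A * shift q n B) := by
  induction k, hk using Nat.le_induction with
  | base => rfl
  | succ k hk ih => rw [map_mul_shift_succ hq hχ hk hA, ih]

theorem map_shift (hq : 0 < q) {χ : H q →ₗ[ℂ] ℂ} (hχ : ∀ A B, χ (A * B) = χ (B * A))
    (k : ℕ) (B : H q) : χ (shift q k B) = χ B := by
  simpa using map_mul_shift_eq hq hχ (Nat.zero_le k) (one_mem (parabolic q 0)) B

/-- A functional is multiplicative if it takes products of elements of the algebras on two
consecutive blocks of strands to the products of the values. -/
def IsMultiplicative (χ : H q →ₗ[ℂ] ℂ) : Prop :=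
  ∀ (n : ℕ) (A B : H q), A ∈ parabolic q n → χ (A * shift q n B) = χ A * χ B

theorem zeta_succ_succ (m : ℕ) : zeta q (m + 2) = shift q 1 (zeta q (m + 1)) * σ q 0 := by
  induction m with
  | zero => simp [zeta]
  | succ m ih =>
    change σ q (m + 1) * zeta q (m + 2) = shift q 1 (σ q m * zeta q (m + 1)) * σ q 0
    rw [ih, map_mul, shift_σ, mul_assoc]

/-- This absorbs the middle generator of a double coset into `ζ`: the word becomes one letter longer
and starts one strand lower. -/
theorem shift_zeta_mul_σ (k m : ℕ) :
    shift q (k + 1) (zeta q (m + 1)) * σ q k = shift q k (zeta q (m + 2)) := by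
  rw [zeta_succ_succ, map_mul, shift_shift, shift_σ, zero_add, add_comm 1 k]

/-- A central multiplicative functional is determined by its values on the elements `ζ_m`. -/
theorem eq_of_map_zeta_eq {χ φ : H q →ₗ[ℂ] ℂ} (hχ : ∀ A B, χ (A * B) = χ (B * A))
    (hφ : ∀ A B, φ (A * B) = φ (B * A)) (hχm : IsMultiplicative χ) (hφm : IsMultiplicative φ)
    (h : ∀ m, 1 ≤ m → χ (zeta q m) = φ (zeta q m)) : χ = φ := by
  -- The claim is strengthened so that the induction closes: a shifted `ζ` is attached to `Y`, and
  -- the two share only the top strand of `Y`. Lowering `k` either splits `ζ` off by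
  -- multiplicativity or lengthens it at the expense of `Y`.
  have key : ∀ k m : ℕ, ∀ Y ∈ parabolic q (k + 1),
      χ (shift q k (zeta q (m + 1)) * Y) = φ (shift q k (zeta q (m + 1)) * Y) := by
    intro k
    induction k with
    | zero =>
      intro m Y hY
      obtain ⟨c, rfl⟩ := exists_eq_algebraMap_of_mem_parabolic_one hY
      rw [← Algebra.commutes, ← Algebra.smul_def, map_smul, map_smul, shift_zero,
        h _ (by omega)]
    | succ k ih =>
      intro m Y hY
      have hY' := parabolic_le_doubleCoset k hY
      clear hY
      induction hY' using doubleCoset_induction with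
      | h1 A hA =>
        rw [← (commute_shift le_rfl hA _).eq, hχm _ _ _ hA, hφm _ _ _ hA, h _ (by omega)]
        have := ih 0 A hA
        rw [zeta, map_one, one_mul] at this
        rw [this]
      | h2 A hA B hB =>
        have e : ∀ {χ : H q →ₗ[ℂ] ℂ}, (∀ A B, χ (A * B) = χ (B * A)) →
            χ (shift q (k + 1) (zeta q (m + 1)) * (A * σ q k * B))
              = χ (shift q k (zeta q (m + 2)) * (B * A)) := by
          intro χ hχ
          rw [mul_assoc A, ← mul_assoc, ← (commute_shift le_rfl hA _).eq, mul_assoc, hχ,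
            ← mul_assoc, shift_zeta_mul_σ, mul_assoc]
        rw [e hχ, e hφ]
        exact ih (m + 1) _ (mul_mem hB hA)
      | hadd A B _ _ hA hB => rw [mul_add, map_add, map_add, hA, hB]
      | hsmul c A _ hA => rw [mul_smul_comm, map_smul, map_smul, hA]
  refine LinearMap.ext fun A => ?_
  obtain ⟨n, hn⟩ := exists_mem_parabolic A
  -- For `m = 0` the attached word is `ζ_1 = 1`.
  simpa [zeta] using key n 0 A (parabolic_mono (Nat.le_succ n) hn)

/-! ### Indecomposable traces are the multiplicative ones -/

theorem star_mem_parabolic {n : ℕ} {A : H q} (hA : A ∈ parabolic q n) : star A ∈ parabolic q n := by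
  induction hA using parabolic_induction with
  | hσ m hm => rw [star_σ]; exact σ_mem_parabolic hm
  | hc c => rw [star_algebraMap']; exact Subalgebra.algebraMap_mem _ _
  | hadd A B _ _ hA hB => rw [star_add]; exact add_mem hA hB
  | hmul A B _ _ hA hB => rw [star_mul]; exact mul_mem hB hA

/-- Used to form the limit of `A ↦ χ (A * shift q k B)` as `k → ∞`. The stabilization index may
depend on the argument; linearity survives because only finitely many arguments are compared at a
time. -/
theorem exists_linearMap_of_eventually_const (f : ℕ → H q →ₗ[ℂ] ℂ)
    (hf : ∀ A, ∃ n, ∀ k ≥ n, f k A = f n A) :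
    ∃ ψ : H q →ₗ[ℂ] ℂ, ∀ A, ∀ᶠ k in Filter.atTop, f k A = ψ A := by
  choose n hn using hf
  have hev : ∀ A, ∀ᶠ k in Filter.atTop, f k A = f (n A) A := fun A =>
    Filter.eventually_atTop.mpr ⟨n A, hn A⟩
  refine ⟨{ toFun := fun A => f (n A) A, map_add' := fun A B => ?_, map_smul' := fun c A => ?_ },
    hev⟩
  · obtain ⟨k, h1, h2, h3⟩ := ((hev (A + B)).and ((hev A).and (hev B))).exists
    rw [← h1, ← h2, ← h3, map_add]
  · obtain ⟨k, h1, h2⟩ := ((hev (c • A)).and (hev A)).exists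
    rw [← h1, ← h2, map_smul, RingHom.id_apply]

/-- The bound for a generator in `norm_σ_mul_le` does not depend on its index, so one constant
serves all shifts. This uniformity is what makes the limit functional below dominated by `χ`. -/
theorem exists_norm_shift_mul_le {χ : H q →ₗ[ℂ] ℂ} (hχ : IsTrace χ) (A : H q) :
    ∃ C, 0 ≤ C ∧ ∀ k X, ‖toPreGNS hχ (shift q k A * X)‖ ≤ C * ‖toPreGNS hχ X‖ := by
  induction A using H.induction with
  | hσ m => exact ⟨|q - 1| + |q| + 1, by positivity, fun k X => by
      rw [shift_σ]; exact norm_σ_mul_le hχ _ X⟩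
  | hc c =>
    refine ⟨‖c‖, norm_nonneg c, fun k X => ?_⟩
    rw [AlgHom.commutes, ← Algebra.smul_def, map_smul, norm_smul]
  | hadd A B hA hB =>
    obtain ⟨C, hC0, hC⟩ := hA
    obtain ⟨D, hD0, hD⟩ := hB
    refine ⟨C + D, add_nonneg hC0 hD0, fun k X => ?_⟩
    rw [map_add, add_mul, map_add, add_mul]
    exact (norm_add_le _ _).trans (add_le_add (hC k X) (hD k X))
  | hmul A B hA hB =>
    obtain ⟨C, hC0, hC⟩ := hA
    obtain ⟨D, hD0, hD⟩ := hB
    refine ⟨C * D, mul_nonneg hC0 hD0, fun k X => ?_⟩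
    rw [map_mul (shift q k), mul_assoc, mul_assoc]
    exact (hC k _).trans (mul_le_mul_of_nonneg_left (hD k X) hC0)

theorem IsTrace.ofReal_re {χ : H q →ₗ[ℂ] ℂ} (hχ : IsTrace χ) (A : H q) :
    (((χ (star A * A)).re : ℝ) : ℂ) = χ (star A * A) :=
  Complex.ext rfl (RCLike.nonneg_iff.mp (hχ.nonneg A)).2.symm

/-- Let `ψ A` be the eventual value of `χ (A * shift q k (C⋆C))`. As the far factor commutes with
`A`, `ψ` is central, and `ψ (A⋆A)` is the squared norm of `shift q k C * A`, hence at most `D² χ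
(A⋆A)`. So `χ` is a positive combination of `ψ` and a complementary trace, and indecomposability
makes `ψ` a multiple of `χ`. -/
theorem IsIndecomposableTrace.map_mul_shift_star_mul (hq : 0 < q) {χ : H q →ₗ[ℂ] ℂ}
    (hχ : IsIndecomposableTrace χ) (h1 : χ 1 = 1) {n : ℕ} {A : H q} (hA : A ∈ parabolic q n)
    (C : H q) : χ (A * shift q n (star C * C)) = χ A * χ (star C * C) := by
  have hT := hχ.toIsTrace
  set B := star C * C with hB
  obtain ⟨ψ, hψ⟩ := exists_linearMap_of_eventually_const
    (fun k => χ ∘ₗ LinearMap.mulRight ℂ (shift q k B)) fun A => by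
      obtain ⟨n, hn⟩ := exists_mem_parabolic A
      exact ⟨n, fun k hk => map_mul_shift_eq hq hT.comm hk hn B⟩
  simp only [LinearMap.comp_apply, LinearMap.mulRight_apply] at hψ
  have hψ' : ∀ {n : ℕ} {A : H q}, A ∈ parabolic q n → ψ A = χ (A * shift q n B) := by
    intro n A hA
    obtain ⟨k, h2, h3⟩ := ((hψ A).and (Filter.eventually_ge_atTop n)).exists
    rw [← h2, map_mul_shift_eq hq hT.comm h3 hA]
  have hmem : ∀ A : H q, ∃ n, A ∈ parabolic q n := exists_mem_parabolic
  have hBs : star B = B := by rw [hB, star_mul, star_star]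
  have hcent : ∀ A A', ψ (A * A') = ψ (A' * A) := by
    intro A A'
    obtain ⟨k, h2, h3, h4⟩ := ((hψ (A * A')).and ((hψ (A' * A)).and
      (Filter.eventually_ge_atTop (hmem A').choose))).exists
    rw [← h2, ← h3, mul_assoc, (commute_shift h4 (hmem A').choose_spec B).eq, ← mul_assoc,
      hT.comm, mul_assoc]
  have hherm : ∀ A, ψ (star A) = starRingEnd ℂ (ψ A) := by
    intro A
    obtain ⟨k, h2, h3⟩ := ((hψ (star A)).and (hψ A)).exists
    rw [← h2, ← h3, ← hT.hermitian, star_mul, star_shift, hBs, hT.comm]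
  obtain ⟨D, hD0, hD⟩ := exists_norm_shift_mul_le hT C
  have hsq : ∀ A, ∃ k, ψ (star A * A) = χ (star (shift q k C * A) * (shift q k C * A)) := by
    intro A
    obtain ⟨k, h2, h3⟩ := ((hψ (star A * A)).and
      (Filter.eventually_ge_atTop (hmem A).choose)).exists
    refine ⟨k, ?_⟩
    rw [← h2, mul_assoc, (commute_shift h3 (hmem A).choose_spec B).eq, hB, map_mul (shift q k), star_mul,
      star_shift]
    simp only [mul_assoc]
  have hψT : IsTrace ψ := ⟨hcent, hherm, fun A => by
    obtain ⟨k, hk⟩ := hsq A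
    rw [hk]
    exact hT.nonneg _⟩
  have hlin : ∀ X, (((D ^ 2 + 1 : ℝ) : ℂ) • χ - ψ) X = ((D ^ 2 + 1 : ℝ) : ℂ) * χ X - ψ X :=
    fun X => rfl
  -- `D²` would suffice for positivity; the extra 1 makes the constant invertible, since `D` may
  -- vanish.
  have hχ₂ : IsTrace (((D ^ 2 + 1 : ℝ) : ℂ) • χ - ψ) := by
    refine ⟨fun A A' => ?_, fun A => ?_, fun A => ?_⟩
    · rw [hlin, hlin, hT.comm, hcent]
    · rw [hlin, hlin, hT.hermitian, hherm, map_sub, map_mul, Complex.conj_ofReal]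
    · obtain ⟨k, hk⟩ := hsq A
      rw [hlin, hk, ← hT.ofReal_re A, ← hT.ofReal_re (shift q k C * A), ← Complex.ofReal_mul, ← Complex.ofReal_sub,
        Complex.zero_le_real, ← preGNS_norm_sq hT, ← preGNS_norm_sq hT]
      have h2 := pow_le_pow_left₀ (norm_nonneg _) (hD k A) 2
      rw [mul_pow] at h2
      nlinarith [sq_nonneg ‖toPreGNS hT A‖]
  have hprop : ∃ c : ℂ, ψ = c • χ := by
    by_contra hno
    refine hχ.indecomposable ⟨ψ, _, hψT, hχ₂, hno, ?_, (D ^ 2 + 1)⁻¹, (D ^ 2 + 1)⁻¹,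
      by positivity, by positivity, ?_⟩
    · rintro ⟨c, hc⟩
      refine hno ⟨((D ^ 2 + 1 : ℝ) : ℂ) - c, ?_⟩
      rw [sub_smul, ← hc, sub_sub_cancel]
    · have h0 : ((D ^ 2 + 1 : ℝ) : ℂ) ≠ 0 := by
        exact_mod_cast (by positivity : (D ^ 2 + 1 : ℝ) ≠ 0)
      rw [← smul_add, add_sub_cancel, smul_smul, Complex.ofReal_inv, inv_mul_cancel₀ h0, one_smul]
  obtain ⟨c, hc⟩ := hprop
  -- The factor of proportionality is read off at the unit, using `χ 1 = 1`.
  have hc' : c = χ B := by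
    have h2 := hψ' (one_mem (parabolic q 0))
    rw [shift_zero, one_mul, hc, LinearMap.smul_apply, h1, smul_eq_mul, mul_one] at h2
    exact h2
  rw [← hψ' hA, hc, LinearMap.smul_apply, smul_eq_mul, hc', mul_comm]

theorem polarization (B : H q) : B = (1 / 4 : ℂ) • (star (B + 1) * (B + 1)
    - star (B - 1) * (B - 1) + Complex.I • (star (B + Complex.I • 1) * (B + Complex.I • 1))
    - Complex.I • (star (B - Complex.I • 1) * (B - Complex.I • 1))) := by
  simp only [star_add, star_sub, star_one, star_smul, add_mul, mul_add, sub_mul, mul_sub, one_mul,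
    mul_one, smul_mul_assoc, mul_smul_comm]
  simp only [RCLike.star_def, Complex.conj_I]
  match_scalars <;> ring_nf <;> simp only [Complex.I_sq] <;> ring

/-- By polarization the elements `C⋆C` span the algebra. This removes the positivity restriction on
the second factor in `map_mul_shift_star_mul`. -/
theorem linearMap_ext_star_mul {F G : H q →ₗ[ℂ] ℂ} (h : ∀ C, F (star C * C) = G (star C * C)) :
    F = G := by
  refine LinearMap.ext fun B => ?_
  rw [polarization B]
  simp only [map_smul, map_add, map_sub, h]

theorem IsIndecomposableTrace.isMultiplicative (hq : 0 < q) {χ : H q →ₗ[ℂ] ℂ}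
    (hχ : IsIndecomposableTrace χ) (h1 : χ 1 = 1) : IsMultiplicative χ := by
  intro n A B hA
  have h := linearMap_ext_star_mul
    (F := χ ∘ₗ LinearMap.mulLeft ℂ A ∘ₗ (shift q n).toLinearMap) (G := χ A • χ)
    fun C => hχ.map_mul_shift_star_mul hq h1 hA C
  exact LinearMap.congr_fun h B

theorem IsTrace.norm_map_sq_le {χ : H q →ₗ[ℂ] ℂ} (hχ : IsTrace χ) (X : H q) :
    ‖χ X‖ ^ 2 ≤ (χ 1).re * (χ (star X * X)).re := by
  have h := norm_inner_le_norm (𝕜 := ℂ) (toPreGNS hχ 1) (toPreGNS hχ X)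
  rw [preGNS_inner, star_one, one_mul] at h
  have h' := pow_le_pow_left₀ (norm_nonneg _) h 2
  rwa [mul_pow, preGNS_norm_sq, preGNS_norm_sq, star_one, one_mul] at h'

/-- Copies of `A` on disjoint blocks are orthogonal, because multiplicativity turns each mixed term
into a product with a factor `χ A = 0` or its conjugate. Only the `N` diagonal terms remain, and
they are equal by shift invariance. -/
theorem map_star_sum_shift_mul_sum_shift (hq : 0 < q) {χ : H q →ₗ[ℂ] ℂ} (hχ : IsTrace χ)
    (hm : IsMultiplicative χ) {n : ℕ} {A : H q} (hA : A ∈ parabolic q n) (h0 : χ A = 0) (N : ℕ) :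
    χ (star (∑ j ∈ Finset.range N, shift q (j * n) A) * ∑ j ∈ Finset.range N, shift q (j * n) A)
      = N * χ (star A * A) := by
  have hmem : ∀ {j k : ℕ} {B : H q}, j < k → B ∈ parabolic q n →
      shift q (j * n) B ∈ parabolic q (k * n) := fun {j k B} hjk hB =>
    parabolic_mono (by nlinarith [Nat.mul_le_mul_right n (Nat.succ_le_of_lt hjk)])
      (shift_mem_parabolic (j * n) hB)
  have hs : χ (star A) = 0 := by rw [hχ.hermitian, h0, map_zero]
  simp only [star_sum, Finset.sum_mul, Finset.mul_sum, map_sum, star_shift]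
  rw [Finset.sum_congr rfl fun j hj => Finset.sum_eq_single_of_mem j hj fun k _ hk => ?_]
  · simp only [← map_mul, map_shift hq hχ.comm, Finset.sum_const, Finset.card_range, nsmul_eq_mul]
  · rcases lt_or_gt_of_ne hk with h | h
    · rw [hm _ _ _ (hmem h (star_mem_parabolic hA)), h0, mul_zero]
    · rw [hχ.comm, hm _ _ _ (hmem h hA), hs, mul_zero]

/-- A law of large numbers. If `χ A = 0`, the sum of `N` disjoint copies of `A` has `χ`-norm squared
of order `N`, while `φ` takes the value `N φ(A)` on it. Cauchy–Schwarz for `φ` and domination give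
`N² |φ(A)|² ≤ N K` for all `N`, so `φ` vanishes on the kernel of `χ`. -/
theorem IsMultiplicative.eq_smul_of_dominated (hq : 0 < q) {χ : H q →ₗ[ℂ] ℂ} (hχ : IsTrace χ)
    (h1 : χ 1 = 1) (hm : IsMultiplicative χ) {φ : H q →ₗ[ℂ] ℂ} (hφ : IsTrace φ) (c : ℝ)
    (hle : ∀ X, (φ (star X * X)).re ≤ c * (χ (star X * X)).re) : φ = φ 1 • χ := by
  have key : ∀ A, χ A = 0 → φ A = 0 := by
    intro A h0
    obtain ⟨n, hA⟩ := exists_mem_parabolic A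
    set K := (φ 1).re * (c * (χ (star A * A)).re) with hK
    have hφ1 : 0 ≤ (φ 1).re := by
      have := (RCLike.nonneg_iff.mp (hφ.nonneg 1)).1
      rwa [star_one, one_mul] at this
    have hN : ∀ N : ℕ, (N : ℝ) ^ 2 * ‖φ A‖ ^ 2 ≤ N * K := by
      intro N
      have h2 := hφ.norm_map_sq_le (∑ j ∈ Finset.range N, shift q (j * n) A)
      have h3 := hle (∑ j ∈ Finset.range N, shift q (j * n) A)
      rw [map_star_sum_shift_mul_sum_shift hq hχ hm hA h0] at h3
      have e : (((N : ℂ) * χ (star A * A))).re = N * (χ (star A * A)).re := by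
        rw [← Complex.ofReal_natCast, Complex.re_ofReal_mul]
      rw [e] at h3
      rw [map_sum] at h2
      simp only [map_shift hq hφ.comm, Finset.sum_const, Finset.card_range,
        nsmul_eq_mul, norm_mul, Complex.norm_natCast, mul_pow] at h2
      have h4 := mul_le_mul_of_nonneg_left h3 hφ1
      calc (N : ℝ) ^ 2 * ‖φ A‖ ^ 2 ≤ _ := h2
        _ ≤ _ := h4
        _ = N * K := by rw [hK]; ring
    by_contra hne
    have hpos : 0 < ‖φ A‖ ^ 2 := by positivity
    obtain ⟨N, hN'⟩ := exists_nat_gt (K / ‖φ A‖ ^ 2)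
    rw [div_lt_iff₀ hpos] at hN'
    have h5 := hN (N + 1)
    push_cast at h5
    have h6 : ((N : ℝ) + 1) * ‖φ A‖ ^ 2 ≤ K := by
      refine le_of_mul_le_mul_left ?_ (by positivity : (0 : ℝ) < N + 1)
      linarith [h5]
    linarith
  refine LinearMap.ext fun A => ?_
  have h2 := key (A - χ A • 1) (by rw [map_sub, map_smul, h1, smul_eq_mul, mul_one, sub_self])
  rw [map_sub, map_smul, sub_eq_zero] at h2
  rw [h2, LinearMap.smul_apply, smul_eq_mul, smul_eq_mul, mul_comm]

/-- A summand `χ₁` of a decomposition is dominated by `a₁⁻¹ χ`, hence proportional to `χ`; this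
already contradicts the definition. -/
theorem IsMultiplicative.isIndecomposableTrace (hq : 0 < q) {χ : H q →ₗ[ℂ] ℂ} (hχ : IsTrace χ)
    (h1 : χ 1 = 1) (hm : IsMultiplicative χ) : IsIndecomposableTrace χ := by
  refine ⟨hχ, ?_⟩
  rintro ⟨χ₁, χ₂, hχ₁, hχ₂, hne, -, a₁, a₂, ha₁, ha₂, he⟩
  refine hne ⟨χ₁ 1, hm.eq_smul_of_dominated hq hχ h1 hχ₁ a₁⁻¹ fun X => ?_⟩
  have h2 : (χ (star X * X)).re = a₁ * (χ₁ (star X * X)).re + a₂ * (χ₂ (star X * X)).re := by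
    rw [he]
    simp only [LinearMap.add_apply, LinearMap.smul_apply, smul_eq_mul, Complex.add_re,
      Complex.re_ofReal_mul]
  have h3 := mul_nonneg ha₂.le (RCLike.nonneg_iff.mp (hχ₂.nonneg X)).1
  change 0 ≤ a₂ * (χ₂ (star X * X)).re at h3
  rw [le_inv_mul_iff₀ ha₁, h2]
  linarith

/-! ### The vacuum state -/

theorem swapCoeff_comm (q : ℝ) (a b : Idx) : swapCoeff q a b = swapCoeff q b a := by
  simp only [swapCoeff, eq_comm]

theorem conj_diagCoeff (q : ℝ) (a b : Idx) :
    starRingEnd ℂ (diagCoeff q a b) = diagCoeff q a b := by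
  unfold diagCoeff; split_ifs <;> simp

theorem conj_swapCoeff (q : ℝ) (a b : Idx) :
    starRingEnd ℂ (swapCoeff q a b) = swapCoeff q a b := by
  unfold swapCoeff; split_ifs <;> simp

theorem inner_mulOp {ι : Type} {c : ι → ℂ} {C : ℝ} (hC : ∀ i, ‖c i‖ ≤ C)
    (hc : ∀ i, starRingEnd ℂ (c i) = c i) (f g : L2 ι) :
    inner ℂ f (mulOp c C hC g) = inner ℂ (mulOp c C hC f) g := by
  rw [lp.inner_eq_tsum, lp.inner_eq_tsum]
  refine tsum_congr fun i => ?_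
  change inner ℂ (f i) (c i * g i) = inner ℂ (c i * f i) (g i)
  simp only [RCLike.inner_apply, map_mul, hc]
  ring

theorem inner_permOp {ι : Type} {τ : ι ≃ ι} (hτ : ∀ i, τ (τ i) = i) (f g : L2 ι) :
    inner ℂ f (permOp τ g) = inner ℂ (permOp τ f) g := by
  have h : permOp τ (permOp τ f) = f := lp.ext (funext fun i => congrArg f (hτ i))
  rw [← LinearIsometry.inner_map_map (permOp τ) (permOp τ f) g, h]

/-- R is symmetric: its coefficients are real, the exchange is an involution of the basis, and the
flip coefficient takes the same value before and after the exchange. -/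
theorem inner_pairOp (q : ℝ) (d : Side) {n : ℕ} (a b : Fin n) (f g : L2 (Fin n → Site)) :
    inner ℂ f (pairOp q d a b g) = inner ℂ (pairOp q d a b f) g := by
  have h : permOp (d.exchange a b) (mulOp (fun s => swapCoeff q (d.letter (s a)) (d.letter (s b)))
      (coeffBound q) (fun _ => norm_swapCoeff_le q _ _) f)
      = mulOp (fun s => swapCoeff q (d.letter (s a)) (d.letter (s b)))
      (coeffBound q) (fun _ => norm_swapCoeff_le q _ _) (permOp (d.exchange a b) f) := by
    refine lp.ext (funext fun s => ?_)
    change swapCoeff q (d.letter (d.exchange a b s a)) (d.letter (d.exchange a b s b)) *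
      f (d.exchange a b s) = swapCoeff q (d.letter (s a)) (d.letter (s b)) * f (d.exchange a b s)
    rw [Side.letter_exchange, Side.letter_exchange, Equiv.swap_apply_left,
      Equiv.swap_apply_right, swapCoeff_comm]
  simp only [pairOp, add_apply, ContinuousLinearMap.comp_apply,
    LinearIsometry.coe_toContinuousLinearMap, inner_add_left, inner_add_right]
  rw [inner_mulOp _ fun _ => conj_diagCoeff q _ _, inner_mulOp _ fun _ => conj_swapCoeff q _ _,
    inner_permOp (exchange_exchange d a b), h]

section

variable (ξ : Metric.sphere (0 : L2 Site) 1)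

theorem eventually_inner {S : Type} {ξ : Metric.sphere (0 : L2 S) 1} (x y : PreTensor ξ) :
    ∀ᶠ n in Filter.atTop, inner ℂ (component n x) (component n y)
      = inner ℂ (x : InfTensor ξ) (y : InfTensor ξ) := by
  rw [UniformSpace.Completion.inner_coe]
  exact eventually_tensorInner x y

theorem inner_rOp (d : Side) (j : ℕ) (x y : InfTensor ξ) :
    inner ℂ x (rOp q ξ d j y) = inner ℂ (rOp q ξ d j x) y := by
  induction x, y using UniformSpace.Completion.induction_on₂ with
  | hp => apply isClosed_eq <;> fun_prop
  | ih x y =>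
    rw [rOp_coe, rOp_coe]
    obtain ⟨n, h1, h2, h3⟩ := ((eventually_inner x _).and ((eventually_inner _ y).and
      (Filter.eventually_gt_atTop (j + 1)))).exists
    rw [← h1, ← h2, component_limitOp, component_limitOp, levelOp_of_lt q d h3, inner_pairOp]

theorem inner_rep (hq : 0 < q) (d : Side) (A : H q) (x y : InfTensor ξ) :
    inner ℂ x (rep ξ hq d A y) = inner ℂ (rep ξ hq d (star A) x) y := by
  induction A using H.induction generalizing x y with
  | hσ m => rw [star_σ, rep, lift_σ]; exact inner_rOp ξ d m x y
  | hc c =>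
    rw [star_algebraMap', AlgHom.commutes, AlgHom.commutes, Algebra.algebraMap_eq_smul_one,
      Algebra.algebraMap_eq_smul_one]
    change inner ℂ x (c • y) = inner ℂ ((starRingEnd ℂ c) • x) y
    rw [inner_smul_left, inner_smul_right, Complex.conj_conj]
  | hadd A B hA hB =>
    rw [star_add, map_add, map_add, add_apply, add_apply,
      inner_add_left, inner_add_right, hA, hB]
  | hmul A B hA hB =>
    rw [star_mul, map_mul, map_mul]
    change inner ℂ x (rep ξ hq d A (rep ξ hq d B y)) =
      inner ℂ (rep ξ hq d (star B) (rep ξ hq d (star A) x)) y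
    rw [hA, hB]

/-- The functional `A ↦ ⟨A^{(l)} Ξ, Ξ⟩`. -/
def vacuumState (hq : 0 < q) : H q →ₗ[ℂ] ℂ :=
  ((innerSL ℂ (vacuum ξ)).toLinearMap ∘ₗ
    (ContinuousLinearMap.apply ℂ (InfTensor ξ) (vacuum ξ)).toLinearMap) ∘ₗ
      (rep ξ hq .left).toLinearMap

theorem vacuumState_apply (hq : 0 < q) (A : H q) :
    vacuumState ξ hq A = inner ℂ (vacuum ξ) (rep ξ hq .left A (vacuum ξ)) := rfl

theorem tensorPow_apply {S : Type} (ξ : Metric.sphere (0 : L2 S) 1) (n : ℕ) (s : Fin n → S) :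
    tensorPow ξ n s = ∏ i, (ξ : L2 S) (s i) := by
  induction n with
  | zero =>
    rw [Subsingleton.elim s Fin.elim0]
    simp [tensorPow]
  | succ n ih =>
    rw [Fin.prod_univ_castSucc]
    change tensorPow ξ n (Fin.init s) * _ = _
    rw [ih]
    rfl

theorem norm_tensorPow {S : Type} (ξ : Metric.sphere (0 : L2 S) 1) (n : ℕ) :
    ‖tensorPow ξ n‖ = 1 := by
  induction n with
  | zero => simp [tensorPow, lp.norm_single]
  | succ n ih => rw [tensorPow, LinearIsometry.norm_map, ih]

theorem vacuumState_one (hq : 0 < q) : vacuumState ξ hq 1 = 1 := by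
  rw [vacuumState_apply, map_one]
  change inner ℂ (vacuum ξ) (vacuum ξ) = 1
  obtain ⟨n, hn⟩ := (eventually_inner (ξ := ξ) _ _).exists
  rw [vacuum, ← hn, inner_self_eq_norm_sq_to_K]
  change ((‖tensorPow ξ n‖ : ℝ) : ℂ) ^ 2 = 1
  rw [norm_tensorPow]
  simp

variable {ξ}

/-- The words obtained by exchanging `V`-indices and by exchanging `W`-indices differ only by a
permutation of the sites, to which a power of `ξ` is insensitive. Where that power does not vanish,
the `V`- and `W`-letters agree, so the coefficients of R agree as well. -/
theorem pairOp_tensorPow (hξ : ∀ p : Site, p.1 ≠ p.2 → (ξ : L2 Site) p = 0)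
    {n : ℕ} (a b : Fin n) :
    pairOp q .left a b (tensorPow ξ n) = pairOp q .right a b (tensorPow ξ n) := by
  refine lp.ext (funext fun s => ?_)
  rw [pairOp_apply, pairOp_apply]
  have hdiag : ∀ t : Fin n → Site, tensorPow ξ n t ≠ 0 → ∀ i, (t i).1 = (t i).2 := by
    intro t ht i
    rw [tensorPow_apply] at ht
    by_contra hne
    exact ht (Finset.prod_eq_zero (Finset.mem_univ i) (hξ _ hne))
  have hex : tensorPow ξ n (Side.right.exchange a b s) = tensorPow ξ n (Side.left.exchange a b s) := by
    rw [tensorPow_apply, tensorPow_apply, ← Equiv.prod_comp (Equiv.swap a b)]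
    refine Finset.prod_congr rfl fun i _ => ?_
    simp [Side.exchange, Side.exchangeFun]
  rw [hex]
  congr 1
  · by_cases h : tensorPow ξ n s = 0
    · rw [h, mul_zero, mul_zero]
    · simp only [Side.letter, hdiag s h]
  · by_cases h : tensorPow ξ n (Side.left.exchange a b s) = 0
    · rw [h, mul_zero, mul_zero]
    -- Here it is the exchanged word that is diagonal, so the `W`-letters at `a, b` are the
    -- `V`-letters at `b, a`; symmetry of the flip coefficient compensates.
    · have h1 := hdiag _ h a
      have h2 := hdiag _ h b
      simp only [Side.exchange, Side.exchangeFun, Equiv.coe_fn_mk, Equiv.swap_apply_left,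
        Equiv.swap_apply_right] at h1 h2
      simp only [Side.letter]
      rw [h1, h2, swapCoeff_comm]

theorem rOp_vacuum (hξ : ∀ p : Site, p.1 ≠ p.2 → (ξ : L2 Site) p = 0)
    (j : ℕ) : rOp q ξ .left j (vacuum ξ) = rOp q ξ .right j (vacuum ξ) := by
  rw [vacuum, rOp_coe, rOp_coe]
  refine coe_eq_of_eventually ?_
  filter_upwards [Filter.eventually_gt_atTop (j + 1)] with n hn
  rw [component_limitOp, component_limitOp, levelOp_of_lt q _ hn, levelOp_of_lt q _ hn]
  exact pairOp_tensorPow hξ _ _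

/-- The agreement on generators passes to products by `A^{(r)} B^{(r)} Ξ = A^{(r)} (Bᵗ)^{(l)} Ξ =
(Bᵗ)^{(l)} A^{(r)} Ξ`. The reversal of order is the reason for the transpose. -/
theorem rep_right_vacuum (hξ : ∀ p : Site, p.1 ≠ p.2 → (ξ : L2 Site) p = 0)
    (hq : 0 < q) (B : H q) :
    rep ξ hq .right B (vacuum ξ) = rep ξ hq .left (transpose B) (vacuum ξ) := by
  induction B using H.induction with
  | hσ m => rw [transpose_σ, rep, lift_σ, rep, lift_σ, rOp_vacuum hξ]
  | hc c => rw [transpose_algebraMap, AlgHom.commutes, AlgHom.commutes]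
  | hadd A B hA hB =>
    rw [transpose_add, map_add, map_add, add_apply,
      add_apply, hA, hB]
  | hmul A B hA hB =>
    rw [transpose_mul, map_mul, map_mul]
    change rep ξ hq .right A (rep ξ hq .right B (vacuum ξ)) =
      rep ξ hq .left (transpose B) (rep ξ hq .left (transpose A) (vacuum ξ))
    rw [hB, ← hA]
    exact (congrArg (fun T => T (vacuum ξ)) (rep_commute ξ hq (transpose B) A).eq).symm

theorem rep_left_vacuum (hξ : ∀ p : Site, p.1 ≠ p.2 → (ξ : L2 Site) p = 0)
    (hq : 0 < q) (B : H q) :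
    rep ξ hq .left B (vacuum ξ) = rep ξ hq .right (transpose B) (vacuum ξ) := by
  have h : transpose (transpose B) = B := by
    induction B using H.induction with
    | hσ m => simp
    | hc c => simp
    | hadd A B hA hB => simp [hA, hB]
    | hmul A B hA hB => simp [hA, hB]
  rw [rep_right_vacuum hξ, h]

/-- For centrality, the `B` next to `Ξ` is rewritten as a right operator, moved past `A^{(l)}` and
across the inner product, and turned back into a left operator on the other copy of `Ξ`. -/
theorem isTrace_vacuumState (hξ : ∀ p : Site, p.1 ≠ p.2 → (ξ : L2 Site) p = 0)
    (hq : 0 < q) : IsTrace (vacuumState ξ hq) := by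
  have hst : ∀ B : H q, star (transpose (star (transpose B))) = B := by
    intro B
    induction B using H.induction with
    | hσ m => simp
    | hc c => simp [star_algebraMap']
    | hadd A B hA hB => simp [hA, hB]
    | hmul A B hA hB => simp [hA, hB]
  refine ⟨fun A B => ?_, fun A => ?_, fun A => ?_⟩
  · rw [vacuumState_apply, vacuumState_apply, map_mul, map_mul]
    change inner ℂ _ (rep ξ hq .left A (rep ξ hq .left B (vacuum ξ))) =
      inner ℂ _ (rep ξ hq .left B (rep ξ hq .left A (vacuum ξ)))
    rw [rep_left_vacuum hξ hq B]
    have hc := congrArg (fun T => T (vacuum ξ)) (rep_commute ξ hq A (transpose B)).eq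
    change rep ξ hq .left A (rep ξ hq .right (transpose B) (vacuum ξ)) =
      rep ξ hq .right (transpose B) (rep ξ hq .left A (vacuum ξ)) at hc
    rw [hc, inner_rep, rep_right_vacuum hξ, inner_rep ξ hq .left B]
    conv_rhs => rw [← hst B, star_star]
  · rw [vacuumState_apply, vacuumState_apply, inner_rep, star_star, inner_conj_symm]
  · rw [vacuumState_apply, map_mul]
    change 0 ≤ inner ℂ _ (rep ξ hq .left (star A) (rep ξ hq .left A (vacuum ξ)))
    rw [inner_rep, star_star, inner_self_eq_norm_sq_to_K]
    exact (Complex.zero_le_real.mpr (sq_nonneg _)).trans_eq (Complex.ofReal_pow _ 2)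

end

/-! ### Multiplicativity of the vacuum state -/

theorem component_append {S : Type} {ξ : Metric.sphere (0 : L2 S) 1} {N : ℕ} {x : PreTensor ξ}
    (hx : ∀ n ≥ N, component (n + 1) x = tensorVec ξ n (component n x)) (k : ℕ) (u : Fin N → S)
    (v : Fin k → S) :
    component (N + k) x (Fin.append u v) = component N x u * tensorPow ξ k v := by
  induction k with
  | zero =>
    have : Fin.append u v = u := funext fun i => Fin.append_left u v i
    rw [this, tensorPow_apply, Fin.prod_univ_zero, mul_one]
    rfl
  | succ k ih =>
    have h := ih (Fin.init v)
    have hv : Fin.append (m := N) (n := k + 1) u v = Fin.snoc (n := N + k) (α := fun _ => S)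
        (Fin.append (m := N) (n := k) u (Fin.init v)) (v (Fin.last k)) := by
      rw [← Fin.append_snoc, Fin.snoc_init_self]
    change component (N + k + 1) x (Fin.append (m := N) (n := k + 1) u v) = _
    rw [hx _ (Nat.le_add_right N k), hv]
    change component (N + k) x (Fin.init (Fin.snoc (α := fun _ => S) _ _))
      * (ξ : L2 S) (Fin.snoc (α := fun _ => S) _ _ (Fin.last _)) = _
    rw [Fin.init_snoc, Fin.snoc_last, h, mul_assoc]
    rfl

theorem tensorPow_append {S : Type} (ξ : Metric.sphere (0 : L2 S) 1) {N k : ℕ} (u : Fin N → S)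
    (v : Fin k → S) :
    tensorPow ξ (N + k) (Fin.append u v) = tensorPow ξ N u * tensorPow ξ k v := by
  simp only [tensorPow_apply, Fin.prod_univ_add, Fin.append_left, Fin.append_right]

/-- Summability of the double family is taken from `h`, so no separate estimate for the product is
needed. -/
theorem eq_mul_of_hasSum {ι κ : Type} {a : ι → ℂ} {b : κ → ℂ} {x y z : ℂ} (ha : HasSum a x)
    (hb : HasSum b y) (h : HasSum (fun p : ι × κ => a p.1 * b p.2) z) : z = x * y :=
  h.unique (ha.mul hb h.summable)

theorem inner_append {S : Type} {N k : ℕ} {f g : L2 (Fin (N + k) → S)} {f₁ g₁ : L2 (Fin N → S)}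
    {f₂ g₂ : L2 (Fin k → S)} (hf : ∀ u v, f (Fin.append u v) = f₁ u * f₂ v)
    (hg : ∀ u v, g (Fin.append u v) = g₁ u * g₂ v) :
    inner ℂ f g = inner ℂ f₁ g₁ * inner ℂ f₂ g₂ := by
  have h : HasSum (fun p : (Fin N → S) × (Fin k → S) =>
      (inner ℂ (f₁ p.1) (g₁ p.1) : ℂ) * inner ℂ (f₂ p.2) (g₂ p.2)) (inner ℂ f g) := by
    have h := (Fin.appendEquiv (α := S) N k).hasSum_iff.mpr (lp.hasSum_inner (𝕜 := ℂ) f g)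
    refine h.congr_fun fun p => ?_
    change (inner ℂ (f₁ p.1) (g₁ p.1) : ℂ) * inner ℂ (f₂ p.2) (g₂ p.2)
      = inner ℂ (f (Fin.append p.1 p.2)) (g (Fin.append p.1 p.2))
    rw [hf, hg]
    simp only [RCLike.inner_apply, map_mul]
    ring
  have h1 := lp.hasSum_inner (𝕜 := ℂ) f₁ g₁
  have h2 := lp.hasSum_inner (𝕜 := ℂ) f₂ g₂
  exact eq_mul_of_hasSum h1 h2 h

theorem exchange_append (d : Side) {N k : ℕ} (a b : Fin k) (u : Fin N → Site) (v : Fin k → Site) :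
    d.exchange (Fin.natAdd N a) (Fin.natAdd N b) (Fin.append u v)
      = Fin.append u (d.exchange a b v) := by
  have h1 : ∀ i : Fin N, Equiv.swap (Fin.natAdd N a) (Fin.natAdd N b) (Fin.castAdd k i)
      = Fin.castAdd k i := fun i => by
    refine Equiv.swap_apply_of_ne_of_ne ?_ ?_ <;> intro h <;>
      · have := congrArg Fin.val h
        simp only [Fin.val_castAdd, Fin.val_natAdd] at this
        omega
  have h2 : ∀ i : Fin k, Equiv.swap (Fin.natAdd N a) (Fin.natAdd N b) (Fin.natAdd N i)
      = Fin.natAdd N (Equiv.swap a b i) := fun i => by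
    simp only [Equiv.swap_apply_def, Fin.natAdd_inj]
    split_ifs <;> rfl
  funext l
  refine Fin.addCases (fun i => ?_) (fun i => ?_) l
  · cases d <;> simp [Side.exchange, Side.exchangeFun, h1]
  · cases d <;> simp [Side.exchange, Side.exchangeFun, h2]

theorem pairOp_append (q : ℝ) (d : Side) {N k : ℕ} (a b : Fin k) {f : L2 (Fin (N + k) → Site)}
    {g : L2 (Fin k → Site)} {c : ℂ} {u : Fin N → Site} (h : ∀ v, f (Fin.append u v) = c * g v)
    (v : Fin k → Site) :
    pairOp q d (Fin.natAdd N a) (Fin.natAdd N b) f (Fin.append u v) = c * pairOp q d a b g v := by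
  rw [pairOp_apply, pairOp_apply, exchange_append, h, h, Fin.append_right, Fin.append_right]
  ring

variable {ξ : Metric.sphere (0 : L2 Site) 1}

/-- Elements of `H_N` touch only the first `N` factors. The point is that coherence persists from
the same level `N`, so that all later factors are exactly `ξ`. -/
theorem rep_coe_of_mem_parabolic (hq : 0 < q) (d : Side) {N : ℕ} {A : H q}
    (hA : A ∈ parabolic q N) (x : PreTensor ξ)
    (hx : ∀ n ≥ N, component (n + 1) x = tensorVec ξ n (component n x)) :
    ∃ y : PreTensor ξ, rep ξ hq d A (x : InfTensor ξ) = y ∧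
      ∀ n ≥ N, component (n + 1) y = tensorVec ξ n (component n y) := by
  induction hA using parabolic_induction generalizing x with
  | hσ m hm =>
    refine ⟨_, by rw [rep, lift_σ, rOp_coe], fun n hn => ?_⟩
    rw [component_limitOp, component_limitOp, hx n hn, levelOp_of_lt q d (show m + 1 < n by omega),
      levelOp_of_lt q d (show m + 1 < n + 1 by omega)]
    exact pairOp_tensorVec q d ξ ⟨m, by omega⟩ ⟨m + 1, by omega⟩ _
  | hc c =>
    refine ⟨c • x, ?_, fun n hn => ?_⟩
    · rw [AlgHom.commutes, Algebra.algebraMap_eq_smul_one, UniformSpace.Completion.coe_smul]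
      rfl
    · rw [map_smul, map_smul, hx n hn, map_smul]
  | hadd A B _ _ hA hB =>
    obtain ⟨y, hy, hy'⟩ := hA x hx
    obtain ⟨z, hz, hz'⟩ := hB x hx
    refine ⟨y + z, ?_, fun n hn => ?_⟩
    · rw [map_add, add_apply, hy, hz, UniformSpace.Completion.coe_add]
    · rw [map_add, map_add, hy' n hn, hz' n hn, map_add]
  | hmul A B _ _ hA hB =>
    obtain ⟨y, hy, hy'⟩ := hB x hx
    obtain ⟨z, hz, hz'⟩ := hA y hy'
    refine ⟨z, ?_, hz'⟩
    rw [map_mul, ← hz, ← hy]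
    rfl

/-- The hypothesis expresses `z = ξ^{⊗ N} ⊗ y` in coordinates, and the shifted algebra acts on the
second part only. The relation is kept for large `k` because a generator acts as R only at levels
where its two factors exist. -/
theorem rep_shift_coe (hq : 0 < q) (d : Side) (N : ℕ) (B : H q) (y z : PreTensor ξ)
    (h : ∀ᶠ k in Filter.atTop, ∀ u v, component (N + k) z (Fin.append u v)
      = tensorPow ξ N u * component k y v) :
    ∃ y' z' : PreTensor ξ, rep ξ hq d B (y : InfTensor ξ) = y' ∧
      rep ξ hq d (shift q N B) (z : InfTensor ξ) = z' ∧
      ∀ᶠ k in Filter.atTop, ∀ u v, component (N + k) z' (Fin.append u v)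
        = tensorPow ξ N u * component k y' v := by
  induction B using H.induction generalizing y z with
  | hσ m =>
    refine ⟨_, _, by rw [rep, lift_σ, rOp_coe], by rw [shift_σ, rep, lift_σ, rOp_coe], ?_⟩
    filter_upwards [h, Filter.eventually_gt_atTop (m + 1)] with k hk hm u v
    rw [component_limitOp, component_limitOp, levelOp_of_lt q d hm,
      levelOp_of_lt q d (show m + N + 1 < N + k by omega)]
    have e1 : (⟨m + N, by omega⟩ : Fin (N + k)) = Fin.natAdd N ⟨m, by omega⟩ :=
      Fin.ext (Nat.add_comm m N)
    have e2 : (⟨m + N + 1, by omega⟩ : Fin (N + k)) = Fin.natAdd N ⟨m + 1, hm⟩ :=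
      Fin.ext (by simp only [Fin.val_natAdd]; omega)
    rw [e1, e2]
    exact pairOp_append q d _ _ (hk u) v
  | hc c =>
    refine ⟨c • y, c • z, ?_, ?_, ?_⟩
    · rw [AlgHom.commutes, Algebra.algebraMap_eq_smul_one, UniformSpace.Completion.coe_smul]
      rfl
    · rw [AlgHom.commutes, AlgHom.commutes, Algebra.algebraMap_eq_smul_one,
        UniformSpace.Completion.coe_smul]
      rfl
    · filter_upwards [h] with k hk u v
      rw [map_smul, map_smul, lp.coeFn_smul, lp.coeFn_smul, Pi.smul_apply, Pi.smul_apply, hk,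
        smul_eq_mul, smul_eq_mul, mul_left_comm]
  | hadd A B hA hB =>
    obtain ⟨y₁, z₁, h1, h2, h3⟩ := hA y z h
    obtain ⟨y₂, z₂, h4, h5, h6⟩ := hB y z h
    refine ⟨y₁ + y₂, z₁ + z₂, ?_, ?_, ?_⟩
    · rw [map_add, add_apply, h1, h4, UniformSpace.Completion.coe_add]
    · rw [map_add, map_add, add_apply, h2, h5, UniformSpace.Completion.coe_add]
    · filter_upwards [h3, h6] with k hk hk' u v
      rw [map_add, map_add, lp.coeFn_add, lp.coeFn_add, Pi.add_apply, Pi.add_apply, hk, hk',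
        mul_add]
  | hmul A B hA hB =>
    obtain ⟨y₁, z₁, h1, h2, h3⟩ := hB y z h
    obtain ⟨y₂, z₂, h4, h5, h6⟩ := hA y₁ z₁ h3
    refine ⟨y₂, z₂, ?_, ?_, h6⟩
    · rw [map_mul, ← h4, ← h1]
      rfl
    · rw [map_mul, map_mul, ← h5, ← h2]
      rfl

/-- After `A` is moved across the inner product, one vector has the form `x_n ⊗ ξ ⊗ ξ ⊗ ⋯` and the
other `ξ^{⊗ n} ⊗ y`, so the inner product factorizes. -/
theorem isMultiplicative_vacuumState (hq : 0 < q) : IsMultiplicative (vacuumState ξ hq) := by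
  intro n A B hA
  obtain ⟨x, hx, hx'⟩ := rep_coe_of_mem_parabolic (ξ := ξ) hq .left (star_mem_parabolic hA)
    (PreTensor.mk (tensorPow ξ) ⟨0, fun _ _ => rfl⟩) fun _ _ => rfl
  have key : ∀ B, vacuumState ξ hq (A * shift q n B)
      = inner ℂ (component n x) (tensorPow ξ n) * vacuumState ξ hq B := by
    intro B
    obtain ⟨y, z, hy, hz, hyz⟩ := rep_shift_coe (ξ := ξ) hq .left n B
      (PreTensor.mk (tensorPow ξ) ⟨0, fun _ _ => rfl⟩)
      (PreTensor.mk (tensorPow ξ) ⟨0, fun _ _ => rfl⟩)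
      (Filter.Eventually.of_forall fun k u v => tensorPow_append ξ u v)
    have e1 : vacuumState ξ hq (A * shift q n B) = inner ℂ (x : InfTensor ξ) (z : InfTensor ξ) := by
      rw [vacuumState_apply, map_mul, ← hx, ← hz]
      exact inner_rep ξ hq .left A _ _
    have e2 : vacuumState ξ hq B = inner ℂ (vacuum ξ) (y : InfTensor ξ) := by
      rw [vacuumState_apply, ← hy]
      rfl
    have h1 := (Filter.tendsto_add_atTop_iff_nat n).mpr Filter.tendsto_id |>.eventually
      (eventually_inner x z)
    obtain ⟨k, h1, h2, h3⟩ := (h1.and (hyz.and (eventually_inner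
      (PreTensor.mk (tensorPow ξ) ⟨0, fun _ _ => rfl⟩) y))).exists
    rw [id, add_comm] at h1
    rw [e1, e2, vacuum, ← h1, ← h3]
    exact inner_append (component_append hx' k) h2
  -- The case `B = 1` identifies the first factor as the value at `A`.
  have h1 := key 1
  rw [map_one, mul_one, vacuumState_one, mul_one] at h1
  rw [key B, h1]

/-! ### A recurrence for sums over partitions -/

/-- The weight `∏_k t_k^{μ_k} / (k^{μ_k} μ_k!)` of a multiset in which `k` occurs `μ_k` times. -/
def cycleWeight (t : ℕ → ℝ) (M : Multiset ℕ) : ℝ :=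
  ∏ k ∈ M.toFinset, (t k / k) ^ M.count k / (M.count k).factorial

theorem cycleWeight_eq_prod (t : ℕ → ℝ) {M : Multiset ℕ} {s : Finset ℕ} (h : M.toFinset ⊆ s) :
    cycleWeight t M = ∏ k ∈ s, (t k / k) ^ M.count k / (M.count k).factorial := by
  refine Finset.prod_subset h fun k _ hk => ?_
  rw [Multiset.mem_toFinset] at hk
  simp [Multiset.count_eq_zero_of_notMem hk]

/-- An additional part `k` multiplies the weight by `t_k / (k μ_k)`, where `μ_k` is the new
multiplicity; the denominator has been cleared. -/
theorem count_mul_cycleWeight_cons (t : ℕ → ℝ) {k : ℕ} (hk : k ≠ 0) (M : Multiset ℕ) :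
    (((k ::ₘ M).count k * k : ℕ) : ℝ) * cycleWeight t (k ::ₘ M) = t k * cycleWeight t M := by
  have h1 : (k ::ₘ M).toFinset ⊆ insert k M.toFinset := by rw [Multiset.toFinset_cons]
  rw [cycleWeight_eq_prod t h1, cycleWeight_eq_prod t (Finset.subset_insert k M.toFinset),
    ← Finset.mul_prod_erase _ _ (Finset.mem_insert_self k _),
    ← Finset.mul_prod_erase _ (fun j => (t j / j) ^ M.count j / (M.count j).factorial)
      (Finset.mem_insert_self k _), ← mul_assoc, ← mul_assoc]
  congr 1
  · have hk' : (k : ℝ) ≠ 0 := by exact_mod_cast hk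
    have hf : ((M.count k).factorial : ℝ) ≠ 0 := by exact_mod_cast (M.count k).factorial_ne_zero
    have hs : ((M.count k : ℝ) + 1) ≠ 0 := by positivity
    rw [Multiset.count_cons_self, pow_succ, Nat.factorial_succ]
    push_cast
    field_simp
  · refine Finset.prod_congr rfl fun j hj => ?_
    rw [Multiset.count_cons_of_ne (Finset.ne_of_mem_erase hj)]

/-- The sum of `cycleWeight` over the partitions of `m`. -/
def cycleSum (t : ℕ → ℝ) (m : ℕ) : ℝ := ∑ P : Nat.Partition m, cycleWeight t P.parts

theorem cycleSum_zero (t : ℕ → ℝ) : cycleSum t 0 = 1 := by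
  simp [cycleSum, cycleWeight]

/-- The partition obtained by adding a part. -/
def addPart {m k : ℕ} (hk : k ≠ 0) (h : k ≤ m) (Q : Nat.Partition (m - k)) : Nat.Partition m where
  parts := k ::ₘ Q.parts
  parts_pos {i} hi := by
    rcases Multiset.mem_cons.mp hi with rfl | hi
    · omega
    · exact Q.parts_pos hi
  parts_sum := by rw [Multiset.sum_cons, Q.parts_sum]; omega

/-- Adding the part `k` is a bijection from the partitions of `m - k` onto the partitions of `m`
that contain `k`; the others have multiplicity zero and drop out. -/
theorem sum_count_mul_cycleWeight (t : ℕ → ℝ) {m k : ℕ} (hk : k ≠ 0) (h : k ≤ m) :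
    ∑ P : Nat.Partition m, ((P.parts.count k * k : ℕ) : ℝ) * cycleWeight t P.parts
      = t k * cycleSum t (m - k) := by
  rw [cycleSum, Finset.mul_sum]
  symm
  refine Finset.sum_of_injOn (addPart hk h) ?_ (fun _ _ => Finset.mem_coe.mpr (Finset.mem_univ _))
    ?_ ?_
  · intro Q _ Q' _ hQ
    exact Nat.Partition.ext ((Multiset.cons_inj_right k).mp (congrArg Nat.Partition.parts hQ))
  · intro P _ hP
    have hkP : k ∉ P.parts := by
      intro hmem
      refine hP ⟨⟨P.parts.erase k, fun hi => P.parts_pos (Multiset.mem_of_mem_erase hi), ?_⟩,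
        Finset.mem_coe.mpr (Finset.mem_univ _), ?_⟩
      · have := P.parts_sum
        rw [← Multiset.cons_erase hmem, Multiset.sum_cons] at this
        omega
      · exact Nat.Partition.ext (Multiset.cons_erase hmem)
    rw [Multiset.count_eq_zero_of_notMem hkP, zero_mul, Nat.cast_zero, zero_mul]
  · intro Q _
    exact (count_mul_cycleWeight_cons t hk Q.parts).symm

/-- Write the size `m + 1` of each partition as `∑ k μ_k` and interchange the sums. This is the
coefficient form of `F' = (∑ t_{k+1} z^k) F` for `F = exp (∑ t_k z^k / k)`. -/
theorem cycleSum_succ (t : ℕ → ℝ) (m : ℕ) :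
    ((m : ℝ) + 1) * cycleSum t (m + 1)
      = ∑ k ∈ Finset.range (m + 1), t (k + 1) * cycleSum t (m - k) := by
  have h1 : ∀ P : Nat.Partition (m + 1),
      ∑ k ∈ Finset.range (m + 1), P.parts.count (k + 1) * (k + 1) = m + 1 := by
    intro P
    have h2 := Finset.sum_multiset_count P.parts
    rw [P.parts_sum] at h2
    conv_rhs => rw [h2]
    rw [← Finset.sum_image (f := fun k => P.parts.count k * k) (g := fun k => k + 1)
      (fun a _ b _ hab => by simpa using hab)]
    simp only [smul_eq_mul]
    symm
    refine Finset.sum_subset (fun k hk => ?_) fun k _ hk => ?_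
    · rw [Multiset.mem_toFinset] at hk
      have h3 := P.parts_pos hk
      have h4 := Multiset.le_sum_of_mem hk
      rw [P.parts_sum] at h4
      exact Finset.mem_image.mpr ⟨k - 1, Finset.mem_range.mpr (by omega), by omega⟩
    · rw [Multiset.mem_toFinset] at hk
      rw [Multiset.count_eq_zero_of_notMem hk, zero_mul]
  calc ((m : ℝ) + 1) * cycleSum t (m + 1)
      = ∑ P : Nat.Partition (m + 1), ∑ k ∈ Finset.range (m + 1),
          ((P.parts.count (k + 1) * (k + 1) : ℕ) : ℝ) * cycleWeight t P.parts := by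
        rw [cycleSum, Finset.mul_sum]
        refine Finset.sum_congr rfl fun P _ => ?_
        rw [← Finset.sum_mul, ← Nat.cast_sum, h1]
        push_cast
        rfl
    _ = _ := by
      rw [Finset.sum_comm]
      refine Finset.sum_congr rfl fun k hk => ?_
      rw [Finset.mem_range] at hk
      rw [sum_count_mul_cycleWeight t (Nat.succ_ne_zero k) (by omega)]
      congr 2
      omega

/-! ### Sums over weakly increasing sequences -/

section Chain

variable {ι : Type} [LinearOrder ι]

/-- The sums `∑ a_{j₁} d(i,j₁) ⋯ a_{j_m} d(j_{m-1},j_m)` over a finite set. -/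
def finChain (a : ι → ℂ) (d : ι → ι → ℂ) (s : Finset ι) : ℕ → ι → ℂ
  | 0, _ => 1
  | m + 1, i => ∑ j ∈ s, a j * d i j * finChain a d s m j

/-- The sums `∑ a_{j₁} d(i,j₁) ⋯ a_{j_m} d(j_{m-1},j_m)` over the whole index set. -/
def chain (a : ι → ℂ) (d : ι → ι → ℂ) : ℕ → ι → ℂ
  | 0, _ => 1
  | m + 1, i => ∑' j, a j * d i j * chain a d m j

/-- The geometric series `∑ y^k z^k`. -/
def geomSeries (y : ℂ) : PowerSeries ℂ := PowerSeries.mk fun k => y ^ k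

theorem one_sub_mul_geomSeries (y : ℂ) :
    (1 - PowerSeries.C y * PowerSeries.X) * geomSeries y = 1 := by
  ext n
  cases n with
  | zero => simp [geomSeries, sub_mul, mul_assoc]
  | succ n =>
    rw [sub_mul, one_mul, mul_assoc, map_sub, PowerSeries.coeff_C_mul,
      PowerSeries.coeff_succ_X_mul, PowerSeries.coeff_one, if_neg (Nat.succ_ne_zero n), geomSeries,
      PowerSeries.coeff_mk, PowerSeries.coeff_mk, pow_succ', sub_self]

theorem derivative_geomSeries (y : ℂ) :
    PowerSeries.derivative ℂ (geomSeries y) = PowerSeries.C y * geomSeries y ^ 2 := by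
  have h := congrArg (PowerSeries.derivative ℂ) (one_sub_mul_geomSeries y)
  have h1 := one_sub_mul_geomSeries y
  simp only [Derivation.leibniz, map_sub, Derivation.map_one_eq_zero, PowerSeries.derivative_C,
    PowerSeries.derivative_X, smul_eq_mul] at h
  linear_combination geomSeries y * h - PowerSeries.derivative ℂ (geomSeries y) * h1

/-- The generating function `∏ (1 - x_i z) / (1 - y_i z)`. -/
def prodSeries (x y : ι → ℂ) (s : Finset ι) : PowerSeries ℂ :=
  ∏ i ∈ s, (1 - PowerSeries.C (x i) * PowerSeries.X) * geomSeries (y i)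

/-- The logarithmic derivative of `∏ (1 - x_i z) / (1 - y_i z)`. Inverses are avoided by using
`geomSeries`, whose defining identity is `one_sub_mul_geomSeries`. -/
theorem derivative_prodSeries (x y : ι → ℂ) (s : Finset ι) :
    PowerSeries.derivative ℂ (prodSeries x y s) =
      (∑ i ∈ s, (PowerSeries.C (y i) * geomSeries (y i) -
        PowerSeries.C (x i) * geomSeries (x i))) * prodSeries x y s := by
  induction s using Finset.induction_on with
  | empty => simp [prodSeries]
  | insert i s hi ih =>
    rw [prodSeries, Finset.prod_insert hi, Finset.sum_insert hi]
    rw [prodSeries] at ih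
    have h1 := one_sub_mul_geomSeries (x i)
    simp only [Derivation.leibniz, map_sub, Derivation.map_one_eq_zero, PowerSeries.derivative_C,
      PowerSeries.derivative_X, smul_eq_mul, derivative_geomSeries, ih]
    linear_combination (PowerSeries.C (x i) * geomSeries (y i) *
      ∏ i ∈ s, (1 - PowerSeries.C (x i) * PowerSeries.X) * geomSeries (y i)) * h1

variable {a x y : ι → ℂ} {d : ι → ι → ℂ} {c : ℂ}

/-- Only weakly increasing sequences contribute, so one that starts in `s` never reaches a smaller
letter `i₀`. -/
theorem finChain_insert_of_lt (hgt : ∀ i j, j < i → d i j = 0) {s : Finset ι} {i₀ : ι}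
    (h : ∀ j ∈ s, i₀ < j) (m : ℕ) : ∀ i ∈ s, finChain a d (insert i₀ s) m i = finChain a d s m i := by
  induction m with
  | zero => intro i _; rfl
  | succ m ih =>
    intro i hi
    rw [finChain, finChain, Finset.sum_insert fun h0 => (h _ h0).false, hgt i i₀ (h i hi),
      mul_zero, zero_mul, zero_add]
    exact Finset.sum_congr rfl fun j hj => by rw [ih j hj]

/-- Induction by adding a new minimum `i₀`. With `F` the series for `s` and `B` that of the
sequences starting at `i₀`, one has `(1 - y z) B = 1 + z F`, and the new series is `c a B + F`. As
`c a = y - x`, the quantity `1 + z F` is multiplied by `1 + (y - x) z / (1 - y z) = (1 - x z) / (1 -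
y z)`. -/
theorem one_add_mk_finChain (hlt : ∀ i j, i < j → d i j = c) (hgt : ∀ i j, j < i → d i j = 0)
    (hy : ∀ i, a i * d i i = y i) (hxy : ∀ i, y i - x i = c * a i) (s : Finset ι) :
    1 + PowerSeries.X * PowerSeries.mk (fun m => c * ∑ i ∈ s, a i * finChain a d s m i)
      = prodSeries x y s := by
  induction s using Finset.induction_on_min with
  | empty =>
    ext n
    cases n <;> simp [prodSeries, PowerSeries.coeff_succ_X_mul]
  | insert i₀ s h ih =>
    have hi₀ : i₀ ∉ s := fun h0 => (h _ h0).false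
    set B : PowerSeries ℂ := PowerSeries.mk fun m => finChain a d (insert i₀ s) m i₀ with hB
    set F : PowerSeries ℂ := PowerSeries.mk fun m => c * ∑ i ∈ s, a i * finChain a d s m i with hF
    have h1 : PowerSeries.mk (fun m => c * ∑ i ∈ insert i₀ s,
        a i * finChain a d (insert i₀ s) m i) = PowerSeries.C (c * a i₀) * B + F := by
      ext m
      rw [PowerSeries.coeff_mk, Finset.sum_insert hi₀, map_add, PowerSeries.coeff_C_mul, hB, hF,
        PowerSeries.coeff_mk, PowerSeries.coeff_mk, mul_add, mul_assoc]
      congr 2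
      exact Finset.sum_congr rfl fun j hj => by rw [finChain_insert_of_lt hgt h m j hj]
    -- A sequence from `i₀` stops, repeats `i₀` with weight `y`, or passes to `s`, where every step
    -- has the same coefficient `c`.
    have h2 : B = 1 + PowerSeries.X * (PowerSeries.C (y i₀) * B + F) := by
      ext m
      cases m with
      | zero => simp [hB, finChain]
      | succ m =>
        rw [map_add, PowerSeries.coeff_succ_X_mul, map_add, PowerSeries.coeff_C_mul, hB, hF,
          PowerSeries.coeff_mk, PowerSeries.coeff_mk, PowerSeries.coeff_mk, finChain,
          Finset.sum_insert hi₀, hy, PowerSeries.coeff_one, if_neg (Nat.succ_ne_zero m), zero_add,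
          Finset.mul_sum]
        congr 1
        exact Finset.sum_congr rfl fun j hj => by
          rw [finChain_insert_of_lt hgt h m j hj, hlt _ _ (h j hj)]; ring
    have h3 : (1 - PowerSeries.C (y i₀) * PowerSeries.X) * B = prodSeries x y s := by
      rw [← ih]; linear_combination h2
    have h4 := one_sub_mul_geomSeries (y i₀)
    have h5 : PowerSeries.C (c * a i₀) = PowerSeries.C (y i₀) - PowerSeries.C (x i₀) := by
      rw [← hxy, map_sub]
    have h6 : B = geomSeries (y i₀) * prodSeries x y s := by
      linear_combination geomSeries (y i₀) * h3 - B * h4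
    rw [h1, h5, prodSeries, Finset.prod_insert hi₀, ← prodSeries]
    linear_combination ih + (1 - PowerSeries.C (x i₀) * PowerSeries.X) * h6 - h3

end Chain

/-! ### Passage from finite to infinite sets of letters. -/

section Limits

variable {ι : Type}

/-- Dominated convergence, needed in this form because both the range of summation and the summand
depend on `s`. -/
theorem tendsto_finset_sum_of_dominated {F : Finset ι → ι → ℂ} {g : ι → ℂ} {bound : ι → ℝ}
    (hb : Summable bound) (hF : ∀ i, Filter.Tendsto (fun s => F s i) Filter.atTop (nhds (g i)))
    (hle : ∀ s i, ‖F s i‖ ≤ bound i) :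
    Filter.Tendsto (fun s => ∑ i ∈ s, F s i) Filter.atTop (nhds (∑' i, g i)) := by
  classical
  have h : Filter.Tendsto (fun s : Finset ι => ∑' i, if i ∈ s then F s i else 0) Filter.atTop
      (nhds (∑' i, g i)) := by
    refine tendsto_tsum_of_dominated_convergence hb (fun i => ?_) (.of_forall fun s i => ?_)
    · refine (hF i).congr' ?_
      filter_upwards [Filter.eventually_ge_atTop {i}] with s hs
      rw [if_pos (Finset.singleton_subset_iff.mp hs)]
    · split_ifs
      · exact hle s i
      · rw [norm_zero]; exact (norm_nonneg _).trans (hle s i)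
  refine h.congr fun s => ?_
  rw [tsum_eq_sum (s := s) fun i hi => if_neg hi]
  exact Finset.sum_congr rfl fun i hi => if_pos hi

variable {a x y : ι → ℂ} {d : ι → ι → ℂ} {c : ℂ} {D : ℝ}

theorem norm_finChain_le (ha : Summable fun i => ‖a i‖) (hD0 : 0 ≤ D) (hD : ∀ i j, ‖d i j‖ ≤ D)
    (s : Finset ι) (m : ℕ) (i : ι) : ‖finChain a d s m i‖ ≤ (D * ∑' j, ‖a j‖) ^ m := by
  have h0 : 0 ≤ D * ∑' j, ‖a j‖ := mul_nonneg hD0 (tsum_nonneg fun _ => norm_nonneg _)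
  induction m generalizing i with
  | zero => simp [finChain]
  | succ m ih =>
    calc ‖finChain a d s (m + 1) i‖ ≤ ∑ j ∈ s, ‖a j‖ * (D * (D * ∑' j, ‖a j‖) ^ m) := by
          refine norm_sum_le_of_le s fun j _ => ?_
          rw [norm_mul, norm_mul, mul_assoc]
          exact mul_le_mul_of_nonneg_left (mul_le_mul (hD i j) (ih j) (norm_nonneg _) hD0)
            (norm_nonneg _)
      _ ≤ (∑' j, ‖a j‖) * (D * (D * ∑' j, ‖a j‖) ^ m) := by
          rw [← Finset.sum_mul]
          exact mul_le_mul_of_nonneg_right (ha.sum_le_tsum s fun _ _ => norm_nonneg _)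
            (mul_nonneg hD0 (pow_nonneg h0 m))
      _ = _ := by rw [pow_succ]; ring

theorem tendsto_finChain (ha : Summable fun i => ‖a i‖) (hD0 : 0 ≤ D) (hD : ∀ i j, ‖d i j‖ ≤ D)
    (m : ℕ) (i : ι) :
    Filter.Tendsto (fun s => finChain a d s m i) Filter.atTop (nhds (chain a d m i)) := by
  induction m generalizing i with
  | zero => exact tendsto_const_nhds
  | succ m ih =>
    refine tendsto_finset_sum_of_dominated (ha.mul_right (D * (D * ∑' j, ‖a j‖) ^ m))
      (fun j => (ih j).const_mul _) fun s j => ?_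
    rw [norm_mul, norm_mul, mul_assoc]
    exact mul_le_mul_of_nonneg_left (mul_le_mul (hD i j) (norm_finChain_le ha hD0 hD s m j)
      (norm_nonneg _) hD0) (norm_nonneg _)

theorem norm_chain_le (ha : Summable fun i => ‖a i‖) (hD0 : 0 ≤ D) (hD : ∀ i j, ‖d i j‖ ≤ D)
    (m : ℕ) (i : ι) : ‖chain a d m i‖ ≤ (D * ∑' j, ‖a j‖) ^ m :=
  le_of_tendsto (tendsto_finChain ha hD0 hD m i).norm
    (.of_forall fun s => norm_finChain_le ha hD0 hD s m i)

/-- The coefficients of the generating function of the sums over weakly increasing sequences. -/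
def chainCoeff (c : ℂ) (a : ι → ℂ) (d : ι → ι → ℂ) : ℕ → ℂ
  | 0 => 1
  | m + 1 => c * ∑' i, a i * chain a d m i

/-- For a finite set of letters this is the coefficient form of `derivative_prodSeries`. All terms
converge along the finite sets, so the recurrence passes to the limit. -/
theorem chainCoeff_succ [LinearOrder ι] (ha : Summable fun i => ‖a i‖) (hD0 : 0 ≤ D)
    (hD : ∀ i j, ‖d i j‖ ≤ D) (hlt : ∀ i j, i < j → d i j = c) (hgt : ∀ i j, j < i → d i j = 0)
    (hy : ∀ i, a i * d i i = y i) (hxy : ∀ i, y i - x i = c * a i) {p : ℕ → ℂ}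
    (hp : ∀ k, HasSum (fun i => y i ^ (k + 1) - x i ^ (k + 1)) (p (k + 1))) (m : ℕ) :
    ((m : ℂ) + 1) * chainCoeff c a d (m + 1)
      = ∑ k ∈ Finset.range (m + 1), p (k + 1) * chainCoeff c a d (m - k) := by
  have hcoeff : ∀ m, Filter.Tendsto (fun s => PowerSeries.coeff m (prodSeries x y s)) Filter.atTop
      (nhds (chainCoeff c a d m)) := by
    intro m
    simp only [← one_add_mk_finChain hlt hgt hy hxy]
    cases m with
    | zero => simp [chainCoeff]
    | succ m =>
      simp only [map_add, PowerSeries.coeff_succ_X_mul, PowerSeries.coeff_mk,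
        PowerSeries.coeff_one, if_neg (Nat.succ_ne_zero m), zero_add]
      refine Filter.Tendsto.const_mul c (tendsto_finset_sum_of_dominated
        (ha.mul_right ((D * ∑' j, ‖a j‖) ^ m))
        (fun i => (tendsto_finChain ha hD0 hD m i).const_mul _) fun s i => ?_)
      rw [norm_mul]
      exact mul_le_mul_of_nonneg_left (norm_finChain_le ha hD0 hD s m i) (norm_nonneg _)
  have hfin : ∀ s, ((m : ℂ) + 1) * PowerSeries.coeff (m + 1) (prodSeries x y s) =
      ∑ k ∈ Finset.range (m + 1), (∑ i ∈ s, (y i ^ (k + 1) - x i ^ (k + 1))) *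
        PowerSeries.coeff (m - k) (prodSeries x y s) := by
    intro s
    have h := congrArg (PowerSeries.coeff m) (derivative_prodSeries x y s)
    rw [PowerSeries.coeff_derivative, PowerSeries.coeff_mul,
      Finset.Nat.sum_antidiagonal_eq_sum_range_succ_mk] at h
    rw [mul_comm, h]
    refine Finset.sum_congr rfl fun k _ => ?_
    rw [map_sum]
    congr 1
    refine Finset.sum_congr rfl fun i _ => ?_
    rw [map_sub, PowerSeries.coeff_C_mul, PowerSeries.coeff_C_mul, geomSeries, geomSeries,
      PowerSeries.coeff_mk, PowerSeries.coeff_mk, pow_succ', pow_succ']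
  refine tendsto_nhds_unique ((hcoeff (m + 1)).const_mul ((m : ℂ) + 1)) ?_
  simp only [hfin]
  have hp' : ∀ k, Filter.Tendsto (fun s => ∑ i ∈ s, (y i ^ (k + 1) - x i ^ (k + 1))) Filter.atTop
      (nhds (p (k + 1))) := hp
  exact tendsto_finsetSum _ fun k _ => (hp' k).mul (hcoeff (m - k))

theorem chainCoeff_eq_cycleSum [LinearOrder ι] (ha : Summable fun i => ‖a i‖) (hD0 : 0 ≤ D)
    (hD : ∀ i j, ‖d i j‖ ≤ D) (hlt : ∀ i j, i < j → d i j = c) (hgt : ∀ i j, j < i → d i j = 0)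
    (hy : ∀ i, a i * d i i = y i) (hxy : ∀ i, y i - x i = c * a i) {t : ℕ → ℝ}
    (ht : ∀ k, HasSum (fun i => y i ^ (k + 1) - x i ^ (k + 1)) (t (k + 1) : ℂ)) (m : ℕ) :
    chainCoeff c a d m = (cycleSum t m : ℂ) := by
  induction m using Nat.strong_induction_on with
  | _ m ih =>
    cases m with
    | zero => rw [cycleSum_zero]; simp [chainCoeff]
    | succ m =>
      have h1 := chainCoeff_succ (p := fun k => (t k : ℂ)) ha hD0 hD hlt hgt hy hxy ht m
      have h2 := congrArg (fun r : ℝ => (r : ℂ)) (cycleSum_succ t m)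
      push_cast at h2
      have h0 : ((m : ℂ) + 1) ≠ 0 := by exact_mod_cast Nat.succ_ne_zero m
      refine mul_left_cancel₀ h0 ?_
      rw [h1, h2]
      refine Finset.sum_congr rfl fun k _ => ?_
      rw [ih (m - k) (by omega)]

end Limits

/-! ### The values of the vacuum state on the elements `ζ_m` -/

variable {α β : ℕ → ℝ}

theorem xi_apply (h : IsParameter α β 0) (p : Site) : (xi α β h : L2 Site) p = xiCoeff α β p := rfl

theorem xi_eq_zero (h : IsParameter α β 0) (p : Site) (hp : p.1 ≠ p.2) :
    (xi α β h : L2 Site) p = 0 := by rw [xi_apply, xiCoeff, if_neg hp]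

theorem summable_norm_weight (h : IsParameter α β 0) :
    Summable fun i => ‖(weight α β i : ℂ)‖ := by
  simpa using (hasSum_weight h).summable.norm

/-- `ξ` lives on the diagonal and `|ξ|²` is the weight there, so a sum over sites collapses to a
weighted sum over letters. -/
theorem hasSum_site (h : IsParameter α β 0) {b : Idx → ℂ} {C : ℝ} (hb : ∀ i, ‖b i‖ ≤ C) :
    HasSum (fun p : Site => starRingEnd ℂ ((xi α β h : L2 Site) p) * (xi α β h : L2 Site) p * b p.1)
      (∑' i, (weight α β i : ℂ) * b i) := by
  have hinj : Function.Injective fun i : Idx => ((i, i) : Site) := fun i j hij =>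
    congrArg Prod.fst hij
  rw [← hinj.hasSum_iff]
  · have hs : Summable fun i => (weight α β i : ℂ) * b i :=
      Summable.of_norm_bounded ((summable_norm_weight h).mul_right C) fun i => by
        rw [norm_mul]; exact mul_le_mul_of_nonneg_left (hb i) (norm_nonneg _)
    refine hs.hasSum.congr_fun fun i => ?_
    rw [Function.comp_apply, xi_apply, xiCoeff, if_pos rfl, Complex.conj_ofReal,
      ← Complex.ofReal_mul, Real.mul_self_sqrt (weight_nonneg h i)]
  · rintro ⟨i, j⟩ hij
    rw [xi_eq_zero h _ fun e => hij ⟨i, Prod.ext rfl e⟩, mul_zero, zero_mul]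

/-- The flip term dies against `ξ`. It brings the previous `V`-letter to the last site while the
`W`-letter stays; as `ξ` is diagonal, both copies of `ξ` survive only if the two `V`-letters are
equal, and then the flip coefficient is zero. -/
theorem pairOp_tensorVec_last (h : IsParameter α β 0) (q : ℝ) {n : ℕ} (f : L2 (Fin (n + 1) → Site))
    (s : Fin (n + 1) → Site) (p : Site) :
    starRingEnd ℂ ((xi α β h : L2 Site) p) *
      pairOp q .left (Fin.last n).castSucc (Fin.last (n + 1)) (tensorVec (xi α β h) (n + 1) f)
        (Fin.snoc (α := fun _ => Site) s p)
      = starRingEnd ℂ ((xi α β h : L2 Site) p) * (xi α β h : L2 Site) p *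
          diagCoeff q (s (Fin.last n)).1 p.1 * f s := by
  set t : Fin (n + 2) → Site := Fin.snoc (α := fun _ => Site) s p with ht
  have h1 : t (Fin.last n).castSucc = s (Fin.last n) := by rw [ht, Fin.snoc_castSucc]
  have h2 : t (Fin.last (n + 1)) = p := by rw [ht, Fin.snoc_last]
  have h3 : tensorVec (xi α β h) (n + 1) f t = f s * (xi α β h : L2 Site) p := by
    change f (Fin.init t) * (xi α β h : L2 Site) (t (Fin.last (n + 1))) = _
    rw [h2, ht, Fin.init_snoc]
  rw [pairOp_apply, h1, h2, h3]
  by_cases hp : p.1 = p.2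
  · have h4 : swapCoeff q (Side.left.letter (s (Fin.last n))) (Side.left.letter p) *
        tensorVec (xi α β h) (n + 1) f (Side.left.exchange (Fin.last n).castSucc
          (Fin.last (n + 1)) t) = 0 := by
      by_cases he : (s (Fin.last n)).1 = p.1
      · rw [swapCoeff, if_pos (show Side.left.letter (s (Fin.last n)) = Side.left.letter p from he),
          zero_mul]
      · have h5 : (xi α β h : L2 Site) (Side.left.exchange (Fin.last n).castSucc
            (Fin.last (n + 1)) t (Fin.last (n + 1))) = 0 := by
          refine xi_eq_zero h _ ?_
          simp only [Side.exchange, Side.exchangeFun, Equiv.coe_fn_mk, Equiv.swap_apply_right, h1,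
            h2]
          rwa [← hp]
        change _ * (_ * (xi α β h : L2 Site) _) = 0
        rw [h5, mul_zero, mul_zero]
    rw [h4]
    simp only [Side.letter]
    ring
  · rw [xi_eq_zero h p hp]
    simp

theorem norm_chain_weight_le (q : ℝ) (h : IsParameter α β 0) (k : ℕ) : ∃ C, ∀ i,
    ‖chain (fun i => (weight α β i : ℂ)) (diagCoeff q) k i‖ ≤ C :=
  ⟨_, norm_chain_le (summable_norm_weight h) ((norm_nonneg _).trans
    (norm_diagCoeff_le q ⟨1, one_ne_zero⟩ ⟨1, one_ne_zero⟩)) (norm_diagCoeff_le q) k⟩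

/-- The newest generator of `ζ` acts after the others and meets one fresh factor `ξ`. Summing over
that last site turns the test function `chain k` of the last letter into `chain (k + 1)` of the
preceding one, which is why the sum carries such a function for every `k`. -/
theorem rep_zeta_vacuum (hq : 0 < q) (h : IsParameter α β 0) (m : ℕ) :
    ∃ x : PreTensor (xi α β h), rep (xi α β h) hq .left (zeta q (m + 1)) (vacuum (xi α β h)) = x ∧
      (∀ n ≥ m + 1, component (n + 1) x = tensorVec (xi α β h) n (component n x)) ∧
      ∀ k, HasSum (fun s : Fin (m + 1) → Site => starRingEnd ℂ (tensorPow (xi α β h) (m + 1) s) *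
          component (m + 1) x s *
          chain (fun i => (weight α β i : ℂ)) (diagCoeff q) k (s (Fin.last m)).1)
        (∑' i, (weight α β i : ℂ) *
          chain (fun i => (weight α β i : ℂ)) (diagCoeff q) (m + k) i) := by
  induction m with
  | zero =>
    refine ⟨PreTensor.mk (tensorPow (xi α β h)) ⟨0, fun _ _ => rfl⟩, ?_, fun _ _ => rfl,
      fun k => ?_⟩
    · rw [zeta, map_one]; rfl
    · obtain ⟨C, hC⟩ := norm_chain_weight_le q h k
      rw [← (Equiv.funUnique (Fin 1) Site).symm.hasSum_iff, zero_add k]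
      refine (hasSum_site h hC).congr_fun fun p => ?_
      change starRingEnd ℂ (tensorPow (xi α β h) 1 _) * tensorPow (xi α β h) 1 _ * _ = _
      rw [tensorPow_apply]
      simp
  | succ m ih =>
    obtain ⟨x, hx, hlev, hsum⟩ := ih
    refine ⟨limitOp (levelOp q .left m) _ (norm_levelOp_le q .left m)
      (levelOp_tensorVec q .left m (xi α β h)) x, ?_, fun n hn => ?_, fun k => ?_⟩
    · rw [← rOp_coe, ← hx, zeta, map_mul]
      simp only [rep, lift_σ]
      rfl
    · rw [component_limitOp, component_limitOp, hlev n (by omega),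
        levelOp_of_lt q _ (show m + 1 < n by omega), levelOp_of_lt q _ (show m + 1 < n + 1 by omega)]
      exact pairOp_tensorVec q .left _ ⟨m, by omega⟩ ⟨m + 1, by omega⟩ _
    · obtain ⟨C, hC⟩ := norm_chain_weight_le q h k
      set ch := chain (fun i => (weight α β i : ℂ)) (diagCoeff q) with hch
      set g := component (m + 1 + 1) (limitOp (levelOp q .left m) _ (norm_levelOp_le q .left m)
        (levelOp_tensorVec q .left m (xi α β h)) x) with hg
      have hg' : g = pairOp q .left (Fin.last m).castSucc (Fin.last (m + 1))
          (tensorVec (xi α β h) (m + 1) (component (m + 1) x)) := by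
        rw [hg, component_limitOp, hlev _ le_rfl, levelOp_of_lt q _ (show m + 1 < m + 1 + 1 by omega)]
        rfl
      have hsummable : Summable fun s : Fin (m + 1 + 1) → Site =>
          starRingEnd ℂ (tensorPow (xi α β h) (m + 1 + 1) s) * g s * ch k (s (Fin.last (m + 1))).1 := by
        refine Summable.of_norm_bounded
          ((lp.summable_inner (𝕜 := ℂ) (tensorPow (xi α β h) (m + 1 + 1)) g).norm.mul_right C) fun s => ?_
        rw [norm_mul, RCLike.inner_apply, mul_comm (starRingEnd ℂ _)]
        exact mul_le_mul_of_nonneg_left (hC _) (norm_nonneg _)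
      have h1 := ((Equiv.prodComm _ _).trans (snocEquiv Site (m + 1))).hasSum_iff.mpr
        hsummable.hasSum
      -- The sum over the last site is carried out first; the result is the induction hypothesis for
      -- `k + 1`.
      have h2 := h1.prod_fiberwise (g := fun s : Fin (m + 1) → Site =>
        starRingEnd ℂ (tensorPow (xi α β h) (m + 1) s) * component (m + 1) x s *
          ch (k + 1) (s (Fin.last m)).1) fun s => by
        have hb : ∀ i, ‖diagCoeff q (s (Fin.last m)).1 i * ch k i‖ ≤ coeffBound q * C := fun i => by
          rw [norm_mul]
          exact mul_le_mul (norm_diagCoeff_le q _ _) (hC i) (norm_nonneg _)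
            ((norm_nonneg _).trans (norm_diagCoeff_le q i i))
        have h3 := (hasSum_site h hb).mul_left
          (starRingEnd ℂ (tensorPow (xi α β h) (m + 1) s) * component (m + 1) x s)
        have h4 : ∑' i, (weight α β i : ℂ) * (diagCoeff q (s (Fin.last m)).1 i * ch k i)
            = ch (k + 1) (s (Fin.last m)).1 := by
          rw [hch, chain]
          simp only [mul_assoc]
        rw [h4] at h3
        refine h3.congr_fun fun p => ?_
        change starRingEnd ℂ (tensorPow (xi α β h) (m + 1) (Fin.init (Fin.snoc (α := fun _ => Site) s p))
            * (xi α β h : L2 Site) (Fin.snoc (α := fun _ => Site) s p (Fin.last (m + 1)))) *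
          g (Fin.snoc (α := fun _ => Site) s p) *
          ch k (Fin.snoc (α := fun _ => Site) s p (Fin.last (m + 1))).1 = _
        have h5 := pairOp_tensorVec_last h q (component (m + 1) x) s p
        rw [← hg'] at h5
        rw [Fin.init_snoc, Fin.snoc_last, map_mul, mul_assoc (starRingEnd ℂ _) _ (g _), h5]
        ring
      have h6 := h2.unique (hsum (k + 1))
      rw [show m + 1 + k = m + (k + 1) by omega, ← h6]
      exact hsummable.hasSum

theorem vacuumState_zeta (hq : 0 < q) (h : IsParameter α β 0) (m : ℕ) :
    vacuumState (xi α β h) hq (zeta q (m + 1))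
      = ∑' i, (weight α β i : ℂ) *
          chain (fun i => (weight α β i : ℂ)) (diagCoeff q) m i := by
  obtain ⟨x, hx, hlev, hsum⟩ := rep_zeta_vacuum hq h m
  rw [← add_zero m, ← (hsum 0).tsum_eq, add_zero m, vacuumState_apply, hx]
  have hconst : ∀ n ≥ m + 1, inner ℂ (tensorPow (xi α β h) n) (component n x)
      = inner ℂ (tensorPow (xi α β h) (m + 1)) (component (m + 1) x) := by
    intro n hn
    induction n, hn using Nat.le_induction with
    | base => rfl
    | succ n hn ih => rw [hlev n hn, tensorPow, LinearIsometry.inner_map_map, ih]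
  obtain ⟨n, h1, h2⟩ := ((eventually_inner
    (PreTensor.mk (tensorPow (xi α β h)) ⟨0, fun _ _ => rfl⟩) x).and
      (Filter.eventually_ge_atTop (m + 1))).exists
  rw [vacuum, ← h1]
  refine (hconst n h2).trans ?_
  rw [lp.inner_eq_tsum]
  refine tsum_congr fun s => ?_
  rw [RCLike.inner_apply, chain, mul_one, mul_comm]

/-! ### Evaluation in terms of the parameters `α`, `β`. -/

theorem hasSum_idx {f : Idx → ℂ} {g₁ g₂ : ℕ → ℂ} {s₁ s₂ : ℂ} (h1 : HasSum g₁ s₁)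
    (h2 : HasSum g₂ s₂) (e1 : ∀ k, f (idxEquiv (Sum.inl k)) = g₁ k)
    (e2 : ∀ k, f (idxEquiv (Sum.inr k)) = g₂ k) : HasSum f (s₁ + s₂) := by
  rw [← idxEquiv.hasSum_iff]
  exact HasSum.sum (f := f ∘ idxEquiv) (h1.congr_fun e1) (h2.congr_fun e2)

theorem weight_inl (α β : ℕ → ℝ) (k : ℕ) : weight α β (idxEquiv (Sum.inl k)) = α k := by
  have : ¬ ((k : ℤ) + 1 < 0) := by omega
  simp only [weight, idxEquiv, Equiv.coe_fn_mk, Sum.elim_inl, this, if_false]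
  congr 1

theorem weight_inr (α β : ℕ → ℝ) (k : ℕ) : weight α β (idxEquiv (Sum.inr k)) = β k := by
  have : -((k : ℤ) + 1) < 0 := by omega
  simp only [weight, idxEquiv, Equiv.coe_fn_mk, Sum.elim_inr, this, if_true]
  congr 1

theorem diagCoeff_inl (q : ℝ) (k : ℕ) :
    diagCoeff q (idxEquiv (Sum.inl k)) (idxEquiv (Sum.inl k)) = q := by
  have : ¬ ((k : ℤ) + 1 < 0) := by omega
  simp [diagCoeff, idxEquiv, this]

theorem diagCoeff_inr (q : ℝ) (k : ℕ) :
    diagCoeff q (idxEquiv (Sum.inr k)) (idxEquiv (Sum.inr k)) = -1 := by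
  have : -((k : ℤ) + 1) < 0 := by omega
  simp only [diagCoeff, idxEquiv, Equiv.coe_fn_mk, Sum.elim_inr, this, if_true]

theorem diagCoeff_of_lt (q : ℝ) (i j : Idx) (h : i < j) : diagCoeff q i j = (q : ℂ) - 1 := by
  rw [diagCoeff, if_neg h.ne, if_pos (show i.1 < j.1 from h)]

theorem diagCoeff_of_gt (q : ℝ) (i j : Idx) (h : j < i) : diagCoeff q i j = 0 := by
  rw [diagCoeff, if_neg h.ne', if_neg (show ¬ i.1 < j.1 from fun h' => lt_asymm h h')]

theorem summable_pow_succ {a : ℕ → ℝ} (ha : Summable a) (ha0 : ∀ i, 0 ≤ a i) (k : ℕ) :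
    Summable fun i => a i ^ (k + 1) := by
  refine Summable.of_nonneg_of_le (fun i => pow_nonneg (ha0 i) _) (fun i => ?_)
    (ha.mul_left ((∑' i, a i) ^ k))
  rw [pow_succ]
  exact mul_le_mul_of_nonneg_right (pow_le_pow_left₀ (ha0 i)
    (ha.le_tsum i fun j _ => ha0 j) k) (ha0 i)

theorem IsParameter.hasSum_left (h : IsParameter α β 0) (k : ℕ) :
    HasSum (fun i => (α i : ℂ) ^ (k + 1)) (∑' i, α i ^ (k + 1) : ℝ) := by
  exact_mod_cast Complex.hasSum_ofReal.mpr
    (summable_pow_succ h.summable_left h.nonneg_left k).hasSum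

theorem IsParameter.hasSum_right (h : IsParameter α β 0) (k : ℕ) :
    HasSum (fun i => (β i : ℂ) ^ (k + 1)) (∑' i, β i ^ (k + 1) : ℝ) := by
  exact_mod_cast Complex.hasSum_ofReal.mpr
    (summable_pow_succ h.summable_right h.nonneg_right k).hasSum

theorem superNewton_one (h : IsParameter α β 0) : superNewton α β 1 = 1 := by
  have := h.sum_eq
  simpa [superNewton] using this

/-- As `γ = 0`, the Newton sum `p_1` equals 1, so the second product may start at `k = 1` and merge
with the first. -/
theorem sum_prod_eq_cycleSum (h : IsParameter α β 0) (q : ℝ) (m : ℕ) :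
    ∑ P : Nat.Partition m, (∏ k ∈ Finset.Icc 1 m, (q ^ k - 1) ^ P.parts.count k /
        ((k : ℝ) ^ P.parts.count k * (P.parts.count k).factorial)) *
      ∏ k ∈ Finset.Icc 2 m, superNewton α β k ^ P.parts.count k
      = cycleSum (fun k => (q ^ k - 1) * superNewton α β k) m := by
  refine Finset.sum_congr rfl fun P _ => ?_
  have h1 : P.parts.toFinset ⊆ Finset.Icc 1 m := fun k hk => by
    rw [Multiset.mem_toFinset] at hk
    have h3 := P.parts_pos hk
    have h4 := Multiset.le_sum_of_mem hk
    rw [P.parts_sum] at h4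
    exact Finset.mem_Icc.mpr ⟨h3, h4⟩
  have h2 : ∏ k ∈ Finset.Icc 2 m, superNewton α β k ^ P.parts.count k
      = ∏ k ∈ Finset.Icc 1 m, superNewton α β k ^ P.parts.count k := by
    refine Finset.prod_subset (Finset.Icc_subset_Icc_left one_le_two) fun k hk hk' => ?_
    rw [Finset.mem_Icc] at hk hk'
    rw [show k = 1 by omega, superNewton_one h, one_pow]
  rw [h2, cycleWeight_eq_prod _ h1, ← Finset.prod_mul_distrib]
  refine Finset.prod_congr rfl fun k _ => ?_
  rw [div_pow, mul_pow, div_mul_eq_mul_div, div_div]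

theorem vacuumState_zeta_eq (hq : 0 < q) (h : IsParameter α β 0) (m : ℕ) :
    vacuumState (xi α β h) hq (zeta q (m + 1)) = (traceValue q α β (m + 1) : ℂ) := by
  have hD0 : 0 ≤ coeffBound q :=
    (norm_nonneg _).trans (norm_diagCoeff_le q ⟨1, one_ne_zero⟩ ⟨1, one_ne_zero⟩)
  rw [vacuumState_zeta]
  by_cases hq1 : q = 1
  · subst hq1
    -- At `q = 1` all off-diagonal coefficients vanish, so only constant sequences contribute and
    -- the sum is a Newton sum.
    have h1 : ∀ m i, chain (fun i => (weight α β i : ℂ)) (diagCoeff 1) m i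
        = ((weight α β i : ℂ) * diagCoeff 1 i i) ^ m := by
      intro m
      induction m with
      | zero => intro i; rfl
      | succ m ih =>
        intro i
        rw [chain, tsum_eq_single i fun j hj => ?_, ih, pow_succ']
        rcases lt_or_gt_of_ne hj with hj | hj
        · rw [diagCoeff_of_gt 1 i j hj, mul_zero, zero_mul]
        · rw [diagCoeff_of_lt 1 i j hj, Complex.ofReal_one, sub_self, mul_zero, zero_mul]
    have h2 : HasSum (fun i => (weight α β i : ℂ) *
        chain (fun i => (weight α β i : ℂ)) (diagCoeff 1) m i) (superNewton α β (m + 1) : ℂ) := by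
      have h3 := hasSum_idx (f := fun i => (weight α β i : ℂ) *
        chain (fun i => (weight α β i : ℂ)) (diagCoeff 1) m i) (h.hasSum_left m)
        ((h.hasSum_right m).mul_left ((-1) ^ m))
        (fun k => by rw [h1, weight_inl, diagCoeff_inl]; push_cast; ring)
        (fun k => by rw [h1, weight_inr, diagCoeff_inr]; ring)
      convert h3 using 1
      rw [superNewton]
      push_cast
      ring
    rw [h2.tsum_eq, traceValue, if_pos rfl]
    split_ifs with hm
    · rw [hm, superNewton_one h]
    · rfl
  · rw [traceValue, if_neg hq1, sum_prod_eq_cycleSum h]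
    have hq1' : (q : ℂ) - 1 ≠ 0 := by
      rw [sub_ne_zero]; exact_mod_cast hq1
    have h1 := chainCoeff_eq_cycleSum (c := (q : ℂ) - 1) (summable_norm_weight h) hD0
      (norm_diagCoeff_le q) (diagCoeff_of_lt q) (diagCoeff_of_gt q) (fun _ => rfl)
      -- This choice is forced by `y - x = (q - 1) a`. It gives `y = qα`, `x = α` at positive
      -- letters and `y = -β`, `x = -qβ` at negative ones, whence `∑ (y^k - x^k) = (q^k - 1) p_k`.
      (x := fun i => (weight α β i : ℂ) * (diagCoeff q i i - (q - 1)))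
      (t := fun k => (q ^ k - 1) * superNewton α β k) (fun i => by ring) (fun k => by
        have h3 := hasSum_idx (f := fun i => ((weight α β i : ℂ) * diagCoeff q i i) ^ (k + 1) -
          ((weight α β i : ℂ) * (diagCoeff q i i - (q - 1))) ^ (k + 1))
          ((h.hasSum_left k).mul_left ((q : ℂ) ^ (k + 1) - 1))
          ((h.hasSum_right k).mul_left (((q : ℂ) ^ (k + 1) - 1) * (-1) ^ k))
          (fun k => by rw [weight_inl, diagCoeff_inl]; ring)
          (fun j => by
            rw [weight_inr, diagCoeff_inr,
              show (β j : ℂ) * (-1 - (q - 1)) = (-1) * (q * β j) by ring,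
              show (β j : ℂ) * (-1) = (-1) * β j by ring, mul_pow, mul_pow, mul_pow]
            ring)
        convert h3 using 1
        rw [superNewton]
        push_cast
        ring) (m + 1)
    rw [chainCoeff] at h1
    rw [Complex.ofReal_mul, ← h1]
    push_cast
    field_simp

theorem isVershikKerovTrace_vacuumState (hq : 0 < q) (h : IsParameter α β 0) :
    IsVershikKerovTrace q α β 0 (vacuumState (xi α β h) hq) where
  toIsIndecomposableTrace := (isMultiplicative_vacuumState hq).isIndecomposableTrace hq
    (isTrace_vacuumState (xi_eq_zero h) hq) (vacuumState_one _ hq)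
  parameter := h
  map_one := vacuumState_one _ hq
  map_zeta m hm := by
    obtain ⟨m, rfl⟩ := Nat.exists_eq_add_of_le' hm
    exact vacuumState_zeta_eq hq h m

/-- Indecomposability makes `χ` multiplicative, so it is determined by its values on the `ζ_m`,
which are those of the vacuum state. -/
theorem IsVershikKerovTrace.eq_vacuumState (hq : 0 < q) {χ : H q →ₗ[ℂ] ℂ}
    (hχ : IsVershikKerovTrace q α β 0 χ) (h : IsParameter α β 0) :
    vacuumState (xi α β h) hq = χ := by
  have h' := isVershikKerovTrace_vacuumState hq h
  exact eq_of_map_zeta_eq h'.comm hχ.comm (isMultiplicative_vacuumState hq)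
    (hχ.toIsIndecomposableTrace.isMultiplicative hq hχ.map_one)
    fun m hm => (h'.map_zeta m hm).trans (hχ.map_zeta m hm).symm

/-! ### The cyclic span -/

section CyclicSpan

variable {ξ : Metric.sphere (0 : L2 Site) 1}

theorem doubleRep_tmul (hq : 0 < q) (A B : H q) (x : InfTensor ξ) :
    doubleRep ξ hq (A ⊗ₜ B) x = rep ξ hq .left A (rep ξ hq .right B x) := by
  rw [doubleRep, Algebra.TensorProduct.lift_tmul]
  rfl

theorem gnsDouble_tmul {χ : H q →ₗ[ℂ] ℂ} (hχ : IsTrace χ) (A B X : H q) :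
    gnsDouble hχ (A ⊗ₜ B) (toPreGNS hχ X : GNS hχ)
      = (toPreGNS hχ (A * X * transpose B) : GNS hχ) := by
  rw [gnsDouble, Algebra.TensorProduct.lift_tmul, mul_assoc, ← gnsLeft_coe, ← gnsRight_coe]
  rfl

/-- Since right operators on `Ξ` are left operators, `A Bᵗ` serves for `A ⊗ B`. The left action
alone thus generates the cyclic span. -/
theorem exists_doubleRep_vacuum (hξ : ∀ p : Site, p.1 ≠ p.2 → (ξ : L2 Site) p = 0) (hq : 0 < q)
    (T : H q ⊗[ℂ] H q) :
    ∃ A, doubleRep ξ hq T (vacuum ξ) = rep ξ hq .left A (vacuum ξ) := by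
  induction T using TensorProduct.induction_on with
  | zero => exact ⟨0, by rw [map_zero, map_zero]⟩
  | tmul A B =>
    refine ⟨A * transpose B, ?_⟩
    rw [doubleRep_tmul, rep_right_vacuum hξ, map_mul]
    rfl
  | add S T hS hT =>
    obtain ⟨A, hA⟩ := hS
    obtain ⟨B, hB⟩ := hT
    exact ⟨A + B, by rw [map_add, map_add, add_apply, add_apply, hA, hB]⟩

/-- The vector `A^{(l)} Ξ` of the cyclic span. -/
def cyclicVector (ξ : Metric.sphere (0 : L2 Site) 1) (hq : 0 < q) :
    H q →ₗ[ℂ] cyclicSpan ξ hq :=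
  LinearMap.codRestrict (cyclicSpan ξ hq)
    ((ContinuousLinearMap.apply ℂ (InfTensor ξ) (vacuum ξ)).toLinearMap ∘ₗ
      (rep ξ hq .left).toLinearMap) fun A => Submodule.le_topologicalClosure _
        ⟨A ⊗ₜ 1, by
          change doubleRep ξ hq (A ⊗ₜ 1) (vacuum ξ) = rep ξ hq .left A (vacuum ξ)
          rw [doubleRep_tmul, map_one]
          rfl⟩

theorem cyclicVector_coe (hq : 0 < q) (A : H q) :
    (cyclicVector ξ hq A : InfTensor ξ) = rep ξ hq .left A (vacuum ξ) := rfl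

theorem denseRange_cyclicVector (hξ : ∀ p : Site, p.1 ≠ p.2 → (ξ : L2 Site) p = 0)
    (hq : 0 < q) : DenseRange (cyclicVector ξ hq) := by
  refine Subtype.dense_iff.mpr fun x hx => ?_
  refine closure_mono ?_ hx
  rintro _ ⟨T, rfl⟩
  obtain ⟨A, hA⟩ := exists_doubleRep_vacuum hξ hq T
  exact ⟨cyclicVector ξ hq A, ⟨A, rfl⟩, hA.symm⟩

theorem norm_cyclicVector (hq : 0 < q) {χ : H q →ₗ[ℂ] ℂ} (hχ : IsTrace χ)
    (h : vacuumState ξ hq = χ) (A : H q) : ‖cyclicVector ξ hq A‖ = ‖toPreGNS hχ A‖ := by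
  rw [← sq_eq_sq₀ (norm_nonneg _) (norm_nonneg _), preGNS_norm_sq, ← h, vacuumState_apply, map_mul,
    Submodule.coe_norm, cyclicVector_coe, norm_sq_eq_re_inner (𝕜 := ℂ)]
  change _ = (inner ℂ (vacuum ξ) (rep ξ hq .left (star A) (rep ξ hq .left A (vacuum ξ)))).re
  rw [inner_rep ξ hq .left (star A), star_star]
  rfl

/-- The algebra maps with dense range into both Hilbert spaces, with equal norms, so the spaces are
identified. By continuity and linearity, intertwining need only be checked on vectors from the
algebra and on pure tensors. -/
theorem exists_isometryEquiv_cyclicSpan (hξ : ∀ p : Site, p.1 ≠ p.2 → (ξ : L2 Site) p = 0)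
    (hq : 0 < q) {χ : H q →ₗ[ℂ] ℂ} (hχ : IsTrace χ) (h : vacuumState ξ hq = χ) :
    ∃ U : GNS hχ ≃ₗᵢ[ℂ] cyclicSpan ξ hq, ∀ (T : H q ⊗[ℂ] H q) (x : GNS hχ),
      (U (gnsDouble hχ T x) : InfTensor ξ) = doubleRep ξ hq T (U x : InfTensor ξ) := by
  have hcomplete : CompleteSpace (cyclicSpan ξ hq) :=
    (Submodule.isClosed_topologicalClosure _).completeSpace_coe
  let e : H q →ₗ[ℂ] GNS hχ := (UniformSpace.Completion.toComplₗᵢ (𝕜 := ℂ)).toLinearMap ∘ₗ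
    (toPreGNS hχ).toLinearMap
  have he : DenseRange e := UniformSpace.Completion.denseRange_coe.comp
    (toPreGNS hχ).surjective.denseRange (UniformSpace.Completion.continuous_coe _)
  have hnorm : ∀ A, ‖cyclicVector ξ hq (LinearEquiv.refl ℂ (H q) A)‖ = ‖e A‖ := fun A =>
    (norm_cyclicVector hq hχ h A).trans (UniformSpace.Completion.norm_coe _).symm
  -- Neither dense map need be injective, as the trace may have null vectors; equality of norms is
  -- enough, and no quotient has to be formed.
  let U := (LinearEquiv.refl ℂ (H q)).extendOfIsometry e (cyclicVector ξ hq) he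
    (denseRange_cyclicVector hξ hq) hnorm
  have hU : ∀ A, (U (toPreGNS hχ A : GNS hχ) : InfTensor ξ) = rep ξ hq .left A (vacuum ξ) :=
    fun A => congrArg Subtype.val (LinearEquiv.extendOfIsometry_eq (LinearEquiv.refl ℂ (H q)) e
      (cyclicVector ξ hq) he (denseRange_cyclicVector hξ hq) hnorm A)
  refine ⟨U, fun T x => ?_⟩
  induction x using UniformSpace.Completion.induction_on with
  | hp =>
    refine isClosed_eq ?_ ?_
    · exact continuous_subtype_val.comp (U.continuous.comp (gnsDouble hχ T).continuous)
    · exact (doubleRep ξ hq T).continuous.comp (continuous_subtype_val.comp U.continuous)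
  | ih x =>
    obtain ⟨X, rfl⟩ := (toPreGNS hχ).surjective x
    induction T using TensorProduct.induction_on with
    | zero => rw [map_zero, map_zero, zero_apply, zero_apply, map_zero]; rfl
    | tmul A B =>
      rw [gnsDouble_tmul, hU, hU, doubleRep_tmul, map_mul, map_mul]
      change rep ξ hq .left A (rep ξ hq .left X (rep ξ hq .left (transpose B) (vacuum ξ))) = _
      -- The factor `Bᵗ` next to `Ξ` becomes `B^{(r)}`, which then moves past `X^{(l)}`.
      rw [← rep_right_vacuum hξ]
      exact congrArg (rep ξ hq .left A)
        (congrArg (fun S => S (vacuum ξ)) (rep_commute ξ hq X B).eq)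
    | add S T hS hT =>
      rw [map_add, map_add, add_apply, add_apply, map_add, Submodule.coe_add, hS, hT]

end CyclicSpan

end IwahoriHecke

end

/-! ### The main theorem. -/

theorem mainTheorem1 (q : ℝ) (hq : 0 < q) (α β : ℕ → ℝ) (h : IwahoriHecke.IsParameter α β 0) :
    (∃ χ : IwahoriHecke.H q →ₗ[ℂ] ℂ, IwahoriHecke.IsVershikKerovTrace q α β 0 χ) ∧
    ∀ (χ : IwahoriHecke.H q →ₗ[ℂ] ℂ) (hχ : IwahoriHecke.IsVershikKerovTrace q α β 0 χ),
      (∀ A : IwahoriHecke.H q,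
        inner ℂ (IwahoriHecke.vacuum (IwahoriHecke.xi α β h))
          (IwahoriHecke.rep (IwahoriHecke.xi α β h) hq IwahoriHecke.Side.left A
            (IwahoriHecke.vacuum (IwahoriHecke.xi α β h))) = χ A) ∧
      ∃ U : IwahoriHecke.GNS hχ.toIsTrace ≃ₗᵢ[ℂ]
          IwahoriHecke.cyclicSpan (IwahoriHecke.xi α β h) hq,
        ∀ (T : IwahoriHecke.H q ⊗[ℂ] IwahoriHecke.H q) (x : IwahoriHecke.GNS hχ.toIsTrace),
          (U (IwahoriHecke.gnsDouble hχ.toIsTrace T x) :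
              IwahoriHecke.InfTensor (IwahoriHecke.xi α β h)) =
            IwahoriHecke.doubleRep (IwahoriHecke.xi α β h) hq T
              (U x : IwahoriHecke.InfTensor (IwahoriHecke.xi α β h)) := by
  refine ⟨⟨_, IwahoriHecke.isVershikKerovTrace_vacuumState hq h⟩, fun χ hχ => ?_⟩
  have e := hχ.eq_vacuumState hq h
  exact ⟨fun A => LinearMap.congr_fun e A, IwahoriHecke.exists_isometryEquiv_cyclicSpan
    (IwahoriHecke.xi_eq_zero h) hq hχ.toIsTrace e⟩
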